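/- **Theorem 3.1 (representation result).** Let $0<T\le\infty$ and let $u(x,t)$, $x\in\mathbb R$, $0\le t<T$, be a real classical solution of the Cauchy problem $$u_{xt}=u+\tfrac16(u^3)_{xx}\quad(0<t<T),\qquad u(x,0)=u_0(x),$$ with $u,u_x,u_{xx}$ continuous on $\mathbb R\times[0,T)$, which decays in the following sense: for every $t\in[0,T)$, $u(x,t)\to0$ as $x\to\pm\infty$ and $u_x(\cdot,t),u_{xx}(\cdot,t)\in L^1(\mathbb R)$, and $u,u_x$ are bounded on $\mathbb R\times[0,t_1]$ for every $t_1<T$. Put $$q=\sqrt{1+u_x^2},\qquad \hat x(x,t)=x-\int_x^\infty(q(y,t)-1)\,dy,\qquad \sigma_3=\begin{pmatrix}1&0\\0&-1\end{pmatrix}.$$ *Spectral data of $u_0$.* At $t=0$ let $\hat U=\frac{u_0''}{2q^2}\begin{pmatrix}0&1\\-1&0\end{pmatrix}$, $Q=ik\hat x(x,0)\sigma_3$, and let $\Phi_\pm(x,k)$ be the (columnwise bounded continuous) solutions of $$\Phi_\pm(x,k)=I+\int_{\pm\infty}^x e^{Q(y,k)-Q(x,k)}\hat U(y)\Phi_\pm(y,k)e^{Q(x,k)-Q(y,k)}\,dy,$$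 where the columns $\Phi_-^{(1)},\Phi_+^{(2)}$ are defined for $\operatorname{Im}k\ge0$ and $\Phi_+^{(1)},\Phi_-^{(2)}$ for $\operatorname{Im}k\le0$. Define $s(k)$ for $k\in\mathbb R$ by $\Phi_+=\Phi_-e^{-Q}s(k)e^{Q}$, put $b=s_{12}$, and let $a(k)=\det(\Phi_-^{(1)}\ \Phi_+^{(2)})$ for $\operatorname{Im}k\ge0$ (so $a=s_{22}$ on $\mathbb R$). Assume that the zeros of $a$ are finite in number, simple, and not real; denote them by $k_1,\dots,k_N$. Let $r(k)=\overline{b(k)}/a(k)$ for $k\in\mathbb R$, let $\chi_j$ be given by $\Phi_-^{(1)}(x,k_j)=\chi_je^{2ik_j\hat x(x,0)}\Phi_+^{(2)}(x,k_j)$, and let $\gamma_j=\chi_j/(i\,a'(k_j))$. *Riemann–Hilbert problem.* For all $\hat x\in\mathbb R$ and $t\in[0,T)$ let $\hat M(\hat x,t,k)$ be a $2\times2$ matrix function of $k\in\mathbb C\setminus\mathbb R$ such that 1. the first column $\hat M^{(1)}$ is analytic except at the $k_j$ and the second column $\hat M^{(2)}$ is analytic except at the $\bar k_j$, where they have at most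 simple poles, with $$\operatorname*{Res}_{k=k_j}\hat M^{(1)}=i\gamma_je^{2i(k_j\hat x-\frac t{4k_j})}\hat M^{(2)}(\hat x,t,k_j),\qquad \operatorname*{Res}_{k=\bar k_j}\hat M^{(2)}=i\bar\gamma_je^{-2i(\bar k_j\hat x-\frac t{4\bar k_j})}\hat M^{(1)}(\hat x,t,\bar k_j);$$ 2. $\hat M$ has limits $\hat M_\pm$ at every point of $\mathbb R$ from $\pm\operatorname{Im}k>0$, and for real $k\ne0$ $$\hat M_+=\hat M_-\,e^{-\hat Q}\begin{pmatrix}1+|r(k)|^2&\overline{r(k)}\\ r(k)&1\end{pmatrix}e^{\hat Q},\qquad \hat Q=\Bigl(ik\hat x+\frac{t}{4ik}\Bigr)\sigma_3;$$ 3. $\hat M\to I$ as $k\to\infty$. *Conclusion.* For all $\hat x\in\mathbb R$, $t\in[0,T)$ the limit $\hat M(\hat x,t,0)=\lim_{k\to0}\hat M(\hat x,t,k)$ (over non-real $k$) exists and is invertible, and there are real $f_1,f_2$ with $$\lim_{k\to0}\frac ik\left(\hat M(\hat x,t,0)^{-1}\hat M(\hat x,t,k)-I\right)=\begin{pmatrix}f_1&f_2\\f_2&-f_1\end{pmatrix}(\hat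 x,t).$$ Moreover, for each $t\in[0,T)$ the map $\hat x\mapsto x(\hat x,t):=\hat x+f_1(\hat x,t)$ is the (two-sided) inverse of $x\mapsto\hat x(x,t)$ on $\mathbb R$, and, with $\hat u:=f_2$, $$u(x,t)=\hat u(\hat x(x,t),t)\qquad(x\in\mathbb R,\ 0\le t<T).$$ -/

import Mathlib

open Filter Topology MeasureTheory

noncomputable section

namespace ShortPulse

/-- The times `0 ≤ t < T`; the value `T = ⊤` gives all `t ≥ 0`. -/
def timeDomain (T : EReal) : Set ℝ := {t : ℝ | 0 ≤ t ∧ (t : EReal) < T}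

/-- `u` is a classical decaying solution on `ℝ × [0, T)` of the Cauchy problem
`u_{xt} = u + (u³)_{xx} / 6` for `t > 0`, with `u(x, 0) = u₀(x)`.
Decay means: at every time `u → 0` as `x → ±∞`, and `u_x`, `u_{xx}` are integrable over the line
(so that `q - 1` and the coefficient of the spatial Lax equation are integrable);
`u` and `u_x` are bounded on every strip `ℝ × [0, t₁]` with `t₁ < T`. -/
structure IsDecayingSolution (T : EReal) (u₀ : ℝ → ℝ) (u : ℝ → ℝ → ℝ) : Prop where
  contDiff : ∀ t ∈ timeDomain T, ContDiff ℝ 2 (fun x => u x t)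
  continuousOn_u : ContinuousOn (fun p : ℝ × ℝ => u p.1 p.2) (Set.univ ×ˢ timeDomain T)
  continuousOn_ux : ContinuousOn (fun p : ℝ × ℝ => deriv (fun y => u y p.2) p.1)
    (Set.univ ×ˢ timeDomain T)
  continuousOn_uxx : ContinuousOn (fun p : ℝ × ℝ => deriv (deriv (fun y => u y p.2)) p.1)
    (Set.univ ×ˢ timeDomain T)
  equation : ∀ x t : ℝ, 0 < t → (t : EReal) < T →
    HasDerivAt (fun s => deriv (fun y => u y s) x)
      (u x t + (1 / 6) * deriv (deriv (fun y => (u y t) ^ 3)) x) t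
  initial : ∀ x, u x 0 = u₀ x
  decay : ∀ t ∈ timeDomain T, Tendsto (fun x => u x t) (cocompact ℝ) (𝓝 0)
  integrable_ux : ∀ t ∈ timeDomain T, Integrable (deriv (fun x => u x t))
  integrable_uxx : ∀ t ∈ timeDomain T, Integrable (deriv (deriv (fun x => u x t)))
  bounded : ∀ t₁ ∈ timeDomain T, ∃ C : ℝ, ∀ t ∈ Set.Icc 0 t₁, ∀ x,
    |u x t| ≤ C ∧ |deriv (fun y => u y t) x| ≤ C

/-! ### The spatial profile at a fixed time

In the following definitions `f : ℝ → ℝ` is the profile `x ↦ u(x, t)` at a fixed time. -/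

/-- `q = √(1 + u_x²)`. -/
def q (f : ℝ → ℝ) (x : ℝ) : ℝ := Real.sqrt (1 + (deriv f x) ^ 2)

/-- `x̂(x) = x - ∫_x^∞ (q(y) - 1) dy`. -/
def xhat (f : ℝ → ℝ) (x : ℝ) : ℝ := x - ∫ y in Set.Ioi x, (q f y - 1)

/-- The matrix `Û = u_{xx} / (2 q²) * (0 1; -1 0)`. -/
def Uhat (f : ℝ → ℝ) (x : ℝ) : Matrix (Fin 2) (Fin 2) ℂ :=
  ((deriv (deriv f) x / (2 * (q f x) ^ 2) : ℝ) : ℂ) • !![0, 1; -1, 0]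

/-- The diagonal entries `1, -1` of the Pauli matrix `σ₃`. -/
def sigma3 (i : Fin 2) : ℂ := if i = 0 then 1 else -1

/-- The matrix `e^{φ σ₃}`. -/
def expSigma3 (φ : ℂ) : Matrix (Fin 2) (Fin 2) ℂ :=
  !![Complex.exp φ, 0; 0, Complex.exp (-φ)]

/-- The factor multiplying the entry `(i, j)` of a matrix `A` in
`e^{Q(y) - Q(x)} A e^{Q(x) - Q(y)}`, where `Q = (i k x̂ + t / (4 i k)) σ₃`. -/
def conjFactor (f : ℝ → ℝ) (k : ℂ) (i j : Fin 2) (x y : ℝ) : ℂ :=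
  Complex.exp (Complex.I * k * ((xhat f y - xhat f x : ℝ) : ℂ) * (sigma3 i - sigma3 j))

/-- `v` is the `j`-th column of the Jost solution normalized at `-∞`: the bounded continuous
solution of the `j`-th column of
`Φ₋(x) = I + ∫_{-∞}^x e^{Q(y) - Q(x)} Û(y) Φ₋(y) e^{Q(x) - Q(y)} dy`. -/
structure IsJostMinus (f : ℝ → ℝ) (j : Fin 2) (k : ℂ) (v : ℝ → Fin 2 → ℂ) : Prop where
  continuous : Continuous v
  bounded : ∃ C : ℝ, ∀ x i, ‖v x i‖ ≤ C
  volterra : ∀ x i, v x i = (if i = j then 1 else 0) +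
    ∫ y in Set.Iic x, conjFactor f k i j x y * (Uhat f y).mulVec (v y) i

/-- `v` is the `j`-th column of the Jost solution normalized at `+∞`: the bounded continuous
solution of the `j`-th column of
`Φ₊(x) = I - ∫_x^∞ e^{Q(y) - Q(x)} Û(y) Φ₊(y) e^{Q(x) - Q(y)} dy`. -/
structure IsJostPlus (f : ℝ → ℝ) (j : Fin 2) (k : ℂ) (v : ℝ → Fin 2 → ℂ) : Prop where
  continuous : Continuous v
  bounded : ∃ C : ℝ, ∀ x i, ‖v x i‖ ≤ C
  volterra : ∀ x i, v x i = (if i = j then 1 else 0) -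
    ∫ y in Set.Ioi x, conjFactor f k i j x y * (Uhat f y).mulVec (v y) i

/-- The column `Φ₋^{(j)}(x, k)`. It is meaningful for `Im k ≥ 0` if `j = 0` (the first column)
and for `Im k ≤ 0` if `j = 1` (the second column). -/
def jostMinus (f : ℝ → ℝ) (j : Fin 2) (k : ℂ) : ℝ → Fin 2 → ℂ :=
  Classical.epsilon (IsJostMinus f j k)

/-- The column `Φ₊^{(j)}(x, k)`. It is meaningful for `Im k ≤ 0` if `j = 0` (the first column)
and for `Im k ≥ 0` if `j = 1` (the second column). -/
def jostPlus (f : ℝ → ℝ) (j : Fin 2) (k : ℂ) : ℝ → Fin 2 → ℂ :=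
  Classical.epsilon (IsJostPlus f j k)

/-- The matrix `Φ₋(x, k)` for real `k`. -/
def jostMinusMatrix (f : ℝ → ℝ) (k x : ℝ) : Matrix (Fin 2) (Fin 2) ℂ :=
  Matrix.of fun i j => jostMinus f j k x i

/-- The matrix `Φ₊(x, k)` for real `k`. -/
def jostPlusMatrix (f : ℝ → ℝ) (k x : ℝ) : Matrix (Fin 2) (Fin 2) ℂ :=
  Matrix.of fun i j => jostPlus f j k x i

/-! ### The spectral data of an initial profile -/

/-- The scattering matrix `s(k)`, `k ∈ ℝ`, defined by
`Φ₊(x, k) = Φ₋(x, k) e^{-Q} s(k) e^{Q}` with `Q = i k x̂(x) σ₃` (time `0`); it does not depend on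
`x`, and the relation is solved for `s(k)` at `x = 0`. -/
def scatteringMatrix (u₀ : ℝ → ℝ) (k : ℝ) : Matrix (Fin 2) (Fin 2) ℂ :=
  expSigma3 (Complex.I * k * xhat u₀ 0) * (jostMinusMatrix u₀ k 0)⁻¹ *
    jostPlusMatrix u₀ k 0 * expSigma3 (-(Complex.I * k * xhat u₀ 0))

/-- The spectral function `b(k) = s₁₂(k)`, `k ∈ ℝ`. -/
def b (u₀ : ℝ → ℝ) (k : ℝ) : ℂ := scatteringMatrix u₀ k 0 1

/-- The spectral function `a(k)`, `Im k ≥ 0`: the determinant with columns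
`Φ₋^{(1)}(x, k)` and `Φ₊^{(2)}(x, k)`, which does not depend on `x` and is taken at `x = 0`. For
real `k` it is `s₂₂(k)` (Cramer's rule, with `det Φ₋ = 1`), and it is analytic for `Im k > 0`. -/
def a (u₀ : ℝ → ℝ) (k : ℂ) : ℂ :=
  jostMinus u₀ 0 k 0 0 * jostPlus u₀ 1 k 0 1 - jostMinus u₀ 0 k 0 1 * jostPlus u₀ 1 k 0 0

/-- The zeros `k_j` of `a` in the upper half-plane. -/
def zeros (u₀ : ℝ → ℝ) : Set ℂ := {k : ℂ | 0 < k.im ∧ a u₀ k = 0}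

/-- The genericity assumption: the zeros of `a` are finite in number and simple, none is real. -/
structure Generic (u₀ : ℝ → ℝ) : Prop where
  finite : (zeros u₀).Finite
  simple : ∀ k ∈ zeros u₀, deriv (a u₀) k ≠ 0
  no_real : ∀ k : ℝ, a u₀ k ≠ 0

/-- The reflection coefficient `r(k) = conj (b(k)) / a(k)`, `k ∈ ℝ`. -/
def reflection (u₀ : ℝ → ℝ) (k : ℝ) : ℂ := (starRingEnd ℂ) (b u₀ k) / a u₀ k

/-- At a zero `k` of `a`, the constant `χ` in
`Φ₋^{(1)}(x, k) = χ e^{2 i k x̂(x)} Φ₊^{(2)}(x, k)` (time `0`). -/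
def chi (u₀ : ℝ → ℝ) (k : ℂ) : ℂ :=
  Classical.epsilon fun c : ℂ => ∀ x i, jostMinus u₀ 0 k x i =
    c * Complex.exp (2 * Complex.I * k * xhat u₀ x) * jostPlus u₀ 1 k x i

/-- The residue constant `γ` at a simple zero `k` of `a`: the residue at `k` of
`Φ₋^{(1)} / a` is `i γ e^{2 i k x̂} Φ₊^{(2)}`, that is, `i γ = χ / a'(k)`. -/
def gamma (u₀ : ℝ → ℝ) (k : ℂ) : ℂ := chi u₀ k / (Complex.I * deriv (a u₀) k)

/-! ### The Riemann--Hilbert problem -/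

/-- `J₀(k) = (1 + |r|², conj r; r, 1)`. -/
def J0 (r : ℝ → ℂ) (k : ℝ) : Matrix (Fin 2) (Fin 2) ℂ :=
  !![1 + ((‖r k‖ ^ 2 : ℝ) : ℂ), (starRingEnd ℂ) (r k); r k, 1]

/-- The jump matrix `J = e^{-Q̂} J₀ e^{Q̂}` with `Q̂ = (i k x̂ + t / (4 i k)) σ₃`, `k ≠ 0`. -/
def jump (r : ℝ → ℂ) (xh t k : ℝ) : Matrix (Fin 2) (Fin 2) ℂ :=
  expSigma3 (-(Complex.I * k * xh + t / (4 * Complex.I * k))) * J0 r k *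
    expSigma3 (Complex.I * k * xh + t / (4 * Complex.I * k))

/-- `M` solves the Riemann--Hilbert problem with reflection coefficient `r`, poles at the points
of `Z` (in the upper half-plane) and at their conjugates, residue constants `γ`, and parameters
`x̂ = xh` and `t`. Index `0` is the first column and index `1` the second. The values of `M` on the
real axis and the values of a column at its poles play no role. -/
structure IsRHSolution (r : ℝ → ℂ) (Z : Set ℂ) (γ : ℂ → ℂ) (xh t : ℝ)
    (M : ℂ → Matrix (Fin 2) (Fin 2) ℂ) : Prop where
  analytic_first : ∀ i, DifferentiableOn ℂ (fun k => M k i 0) {k : ℂ | k.im ≠ 0 ∧ k ∉ Z}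
  analytic_second : ∀ i, DifferentiableOn ℂ (fun k => M k i 1)
    {k : ℂ | k.im ≠ 0 ∧ (starRingEnd ℂ) k ∉ Z}
  residue_first : ∀ z ∈ Z, ∀ i, Tendsto (fun k => (k - z) * M k i 0) (𝓝[≠] z)
    (𝓝 (Complex.I * γ z * Complex.exp (2 * Complex.I * (z * xh - t / (4 * z))) * M z i 1))
  residue_second : ∀ z ∈ Z, ∀ i, Tendsto (fun k => (k - (starRingEnd ℂ) z) * M k i 1)
    (𝓝[≠] ((starRingEnd ℂ) z))
    (𝓝 (Complex.I * (starRingEnd ℂ) (γ z) *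
      Complex.exp (-2 * Complex.I *
        ((starRingEnd ℂ) z * xh - t / (4 * (starRingEnd ℂ) z))) * M ((starRingEnd ℂ) z) i 0))
  /-- `M` has limits `M₊`, `M₋` at every real point from the two half-planes, related by the
  jump. -/
  jump_relation : ∃ Mp Mm : ℝ → Matrix (Fin 2) (Fin 2) ℂ,
    (∀ s : ℝ, Tendsto M (𝓝[{k : ℂ | 0 < k.im}] (s : ℂ)) (𝓝 (Mp s))) ∧
    (∀ s : ℝ, Tendsto M (𝓝[{k : ℂ | k.im < 0}] (s : ℂ)) (𝓝 (Mm s))) ∧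
    ∀ s : ℝ, s ≠ 0 → Mp s = Mm s * jump r xh t s
  normalization : Tendsto M (cocompact ℂ ⊓ 𝓟 {k : ℂ | k.im ≠ 0}) (𝓝 1)

end ShortPulse

end

/-!
The proof identifies the given Riemann--Hilbert solution explicitly. For fixed `t` and `x` the
Jost columns of the profile `u(·, t)` form the matrix `(Φ₋^{(1)} / a, Φ₊^{(2)})` in the upper
half-plane; continued to the lower half-plane by conjugation it is `rhSolution`. It has
determinant one, and it solves the Riemann--Hilbert problem with the parameters `x̂ = x̂(x, t)`
and `t`, poles and jump being those of the initial data
(`IsDecayingSolution.isRHSolution_rhSolution`). The solution is unique (`IsRHSolution.unique`):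
for two solutions the jumps and the singular parts cancel in `M adj(N)`, which is therefore entire
and tends to the identity at infinity. So the behaviour of `M` at `k = 0` is that of the Jost
columns.

That the data of `u(·, t)` are the evolved data of `u₀` is the inverse scattering mechanism. A
rotation by half the angle `arctan u_x`, which diagonalizes `(1, u_x; u_x, -1)`, transforms the
Jost columns into solutions of the spatial Lax equation `ψ_x = U ψ`. The temporal flow `ψ_t = V ψ`
preserves the spatial equation, because the equation for `u` is the vanishing of the curvature of
the Lax pair (`IsEvolution.hasDerivAt_of_zero_curvature`). No time derivative of the Jost
solutions is presupposed: the flow of the initial Jost column is constructed, and then identified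
with a multiple of the Jost column at time `t` by its asymptotics (`tendsto_of_isEvolution`). The
phases match at both ends of the line because `∫ (q - 1) dx` is conserved
(`IsDecayingSolution.lengthDefect_eq`). Since `V` is traceless, and anti-Hermitian for real `k`,
Wronskians and Hermitian products of evolved solutions are constant, which gives `a_conserved` and
`b_evolution`; linearity gives `laxMinus_eq_chi_smul`, the evolution of the residue constants.

The existence, boundedness, continuity and analyticity of the Jost columns come from a Neumann
series for Volterra equations with parameters (`VolterraKernel`), and their limits at `k = ∞` from
an argument of Riemann--Lebesgue type (`IsProfile.norm_integral_oscillating_le`). Near `k = 0` the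
rotation is undone and the phase `x̂` is replaced by `x`: in this frame (`zeroFrame`) the equation
has coefficients proportional to `k`, and the solution is `(1, -i k u) + o(k)`
(`IsProfile.zeroFrame_hasDerivWithinAt`). Consequently `M` tends to the inverse of the rotation
matrix as `k → 0`, and the coefficient of the next order has the entries `f₁ = x - x̂` and `f₂ =
u` (`IsProfile.tendsto_rotMatrix_mul_rhSolution`). Since `x̂` is a strictly increasing bijection
of the line, this holds at every `x̂` and gives the parametric representation of `u`.
-/

/-! ### Uniqueness for the Riemann--Hilbert problem -/

namespace ShortPulse
open Complex in
/-- A continuous function on an open set that is holomorphic off the real axis is holomorphic. -/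
theorem differentiableOn_of_off_real {U : Set ℂ} (hU : IsOpen U) {g : ℂ → ℂ}
    (hc : ContinuousOn g U) (hd : DifferentiableOn ℂ g {k | k ∈ U ∧ k.im ≠ 0}) :
    DifferentiableOn ℂ g U := by
  refine (isConservativeOn_and_continuousOn_iff_isDifferentiableOn hU).1 ⟨?_, hc⟩
  have hopen : IsOpen {k : ℂ | k ∈ U ∧ k.im ≠ 0} :=
    hU.inter (isOpen_ne_fun continuous_im continuous_const)
  -- Rectangles whose interior misses the real axis.
  have key : ∀ z w : ℂ, Rectangle z w ⊆ U → 0 ∉ Set.Ioo (min z.im w.im) (max z.im w.im) →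
      (∫ x : ℝ in z.re..w.re, g (x + z.im * I)) - (∫ x : ℝ in z.re..w.re, g (x + w.im * I)) +
      I • (∫ y : ℝ in z.im..w.im, g (w.re + y * I)) -
      I • (∫ y : ℝ in z.im..w.im, g (z.re + y * I)) = 0 := by
    intro z w hzw h0
    refine integral_boundary_rect_eq_zero_of_continuousOn_of_differentiableOn g z w
      (hc.mono hzw) (hd.mono ?_)
    rintro k ⟨hk1, hk2⟩
    refine ⟨hzw ⟨Set.Ioo_subset_Icc_self hk1, Set.Ioo_subset_Icc_self hk2⟩, fun h => h0 ?_⟩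
    rwa [← h]
  rintro z w hzw
  rw [← add_eq_zero_iff_eq_neg, wedgeIntegral_add_wedgeIntegral_eq]
  by_cases h0 : (0 : ℝ) ∈ Set.Ioo (min z.im w.im) (max z.im w.im)
  swap
  · exact key z w hzw h0
  -- A rectangle that meets the real axis is cut along it into two rectangles of the first kind.
  have h0' : (0 : ℝ) ∈ Set.uIcc z.im w.im := Set.Ioo_subset_Icc_self h0
  have hsub1 : Rectangle z (w.re : ℂ) ⊆ U := by
    refine subset_trans ?_ hzw
    rintro k ⟨hk1, hk2⟩
    refine ⟨by simpa using hk1, ?_⟩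
    exact Set.uIcc_subset_uIcc_left h0' (by simpa using hk2)
  have hsub2 : Rectangle (z.re : ℂ) w ⊆ U := by
    refine subset_trans ?_ hzw
    rintro k ⟨hk1, hk2⟩
    refine ⟨by simpa using hk1, ?_⟩
    exact Set.uIcc_subset_uIcc_right h0' (by simpa using hk2)
  have k1 := key z (w.re : ℂ) hsub1 (by simpa using le_of_lt)
  have k2 := key (z.re : ℂ) w hsub2 (by simpa using le_of_lt)
  have hint : ∀ a : ℝ, a ∈ Set.uIcc z.re w.re → ∀ b c : ℝ, b ∈ Set.uIcc z.im w.im →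
      c ∈ Set.uIcc z.im w.im →
      IntervalIntegrable (fun y : ℝ => g (a + y * I)) volume b c := by
    intro a ha b c hb hc'
    refine ContinuousOn.intervalIntegrable (hc.comp (by fun_prop) ?_)
    intro y hy
    refine hzw ⟨by simpa using ha, ?_⟩
    simpa using Set.uIcc_subset_uIcc hb hc' hy
  have e1 := intervalIntegral.integral_add_adjacent_intervals
    (hint w.re Set.right_mem_uIcc z.im 0 Set.left_mem_uIcc h0')
    (hint w.re Set.right_mem_uIcc 0 w.im h0' Set.right_mem_uIcc)
  have e2 := intervalIntegral.integral_add_adjacent_intervals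
    (hint z.re Set.left_mem_uIcc z.im 0 Set.left_mem_uIcc h0')
    (hint z.re Set.left_mem_uIcc 0 w.im h0' Set.right_mem_uIcc)
  rw [← e1, ← e2]
  simp only [ofReal_re, ofReal_im, ofReal_zero, zero_mul, add_zero, smul_eq_mul] at k1 k2 ⊢
  linear_combination k1 + k2

/-- Finitely many singularities at which `(k - s) F(k) → 0` are removable. -/
theorem exists_differentiable_extension (S : Finset ℂ) : ∀ F : ℂ → ℂ,
    DifferentiableOn ℂ F (S : Set ℂ)ᶜ →
    (∀ s ∈ S, Tendsto (fun k => (k - s) * F k) (𝓝[≠] s) (𝓝 0)) →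
    ∃ h : ℂ → ℂ, Differentiable ℂ h ∧ ∀ k, k ∉ S → h k = F k := by
  classical
  induction S using Finset.induction_on with
  | empty =>
    intro F hF _
    exact ⟨F, by simpa [differentiableOn_univ] using hF, fun _ _ => rfl⟩
  | insert s S hs ih =>
    intro F hF hlim
    set F' := Function.update F s (limUnder (𝓝[≠] s) F) with hF'
    have hopen : IsOpen ((S : Set ℂ)ᶜ) := (Finset.finite_toSet S).isClosed.isOpen_compl
    have hne : ∀ k, k ≠ s → F' k = F k := fun k hk => Function.update_of_ne hk _ _
    have hd : DifferentiableOn ℂ F' (S : Set ℂ)ᶜ := by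
      refine Complex.differentiableOn_update_limUnder_of_isLittleO
        (hopen.mem_nhds (by simpa using hs)) (hF.mono ?_) ?_
      · rintro k ⟨hk1, hk2⟩
        simp only [Finset.coe_insert, Set.mem_compl_iff, Set.mem_insert_iff, not_or]
        exact ⟨hk2, hk1⟩
      · have h1 := hlim s (Finset.mem_insert_self _ _)
        have h2 : Tendsto (fun k => (k - s) * (F k - F s)) (𝓝[≠] s) (𝓝 0) := by
          have h3 : Tendsto (fun k : ℂ => (k - s) * F s) (𝓝[≠] s) (𝓝 0) := by
            refine tendsto_nhdsWithin_of_tendsto_nhds ?_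
            have : Continuous fun k : ℂ => (k - s) * F s := by fun_prop
            simpa using this.tendsto s
          simpa [mul_sub] using h1.sub h3
        rw [Asymptotics.isLittleO_iff_tendsto']
        · refine h2.congr fun k => ?_
          rw [div_inv_eq_mul, mul_comm]
        · filter_upwards [self_mem_nhdsWithin] with k hk h
          exact absurd (inv_eq_zero.1 h) (sub_ne_zero.2 hk)
    obtain ⟨h, h1, h2⟩ := ih F' hd fun s' hs' => by
      have hss : s' ≠ s := fun e => hs (e ▸ hs')
      refine (hlim s' (Finset.mem_insert_of_mem hs')).congr' ?_
      filter_upwards [nhdsWithin_le_nhds (isOpen_ne.mem_nhds hss)] with k hk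
      rw [hne k hk]
    refine ⟨h, h1, fun k hk => ?_⟩
    simp only [Finset.mem_insert, not_or] at hk
    rw [h2 k hk.2, hne k hk.1]

/-- A Liouville theorem for functions holomorphic off the real axis and finitely many points,
whose boundary values from the two half-planes agree. -/
theorem eq_zero_of_off_real {S : Finset ℂ} {F : ℂ → ℂ}
    (hd : DifferentiableOn ℂ F {k | k.im ≠ 0 ∧ k ∉ S})
    (hS : ∀ s ∈ S, Tendsto (fun k => (k - s) * F k) (𝓝[{k | k.im ≠ 0 ∧ k ∉ S}] s) (𝓝 0))
    (hreal : ∀ s : ℝ, (s : ℂ) ∉ S → ∃ y, Tendsto F (𝓝[{k | k.im ≠ 0}] (s : ℂ)) (𝓝 y))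
    (hinf : Tendsto F (cocompact ℂ ⊓ 𝓟 {k | k.im ≠ 0}) (𝓝 0)) :
    ∀ k : ℂ, k.im ≠ 0 → k ∉ S → F k = 0 := by
  set A : Set ℂ := {k | k.im ≠ 0 ∧ k ∉ S} with hA
  have hSo : IsOpen ((S : Set ℂ)ᶜ) := (Finset.finite_toSet S).isClosed.isOpen_compl
  have hAo : IsOpen A := (isOpen_ne_fun Complex.continuous_im continuous_const).inter hSo
  have hAd : Dense A := by
    refine Dense.inter_of_isOpen_right ?_ ?_ hSo
    · have h1 : Dense ({0}ᶜ : Set ℝ) := dense_compl_singleton 0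
      exact h1.preimage Complex.isOpenMap_im
    · exact (Finset.countable_toSet S).dense_compl ℝ
  have hlim : ∀ k ∈ ((S : Set ℂ)ᶜ), ∃ y, Tendsto F (𝓝[A] k) (𝓝 y) := by
    intro k hk
    by_cases h : k.im = 0
    · have hre : ((k.re : ℝ) : ℂ) = k := Complex.ext rfl (by simp [h])
      obtain ⟨y, hy⟩ := hreal k.re (by rwa [hre])
      rw [hre] at hy
      exact ⟨y, hy.mono_left (nhdsWithin_mono _ fun x hx => hx.1)⟩
    · exact ⟨F k, hd.continuousOn k ⟨h, hk⟩⟩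
  set g := extendFrom A F with hg
  have hgc : ContinuousOn g (S : Set ℂ)ᶜ := continuousOn_extendFrom (fun k _ => hAd k) hlim
  have hgA : ∀ k ∈ A, g k = F k := extendFrom_extends hd.continuousOn
  have hgt : ∀ k ∈ ((S : Set ℂ)ᶜ), Tendsto F (𝓝[A] k) (𝓝 (g k)) :=
    fun k hk => tendsto_extendFrom (hlim k hk)
  have hNB : ∀ k, (𝓝[A] k).NeBot := fun k => mem_closure_iff_nhdsWithin_neBot.1 (hAd k)
  have hgd : DifferentiableOn ℂ g (S : Set ℂ)ᶜ := by
    refine differentiableOn_of_off_real hSo hgc ?_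
    have : {k : ℂ | k ∈ ((S : Set ℂ)ᶜ) ∧ k.im ≠ 0} = A := by
      ext k; simp [hA, and_comm]
    rw [this]
    exact hd.congr hgA
  obtain ⟨h, h1, h2⟩ := exists_differentiable_extension S g hgd fun s hs => by
    rw [Metric.tendsto_nhdsWithin_nhds]
    intro ε hε
    have := hS s hs
    rw [Metric.tendsto_nhdsWithin_nhds] at this
    obtain ⟨δ, hδ, hb⟩ := this (ε / 2) (by positivity)
    have hpunc : ∀ᶠ k in 𝓝[≠] s, k ∉ S := by
      have : ((S.erase s : Finset ℂ) : Set ℂ)ᶜ ∈ 𝓝 s :=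
        (Finset.finite_toSet _).isClosed.isOpen_compl.mem_nhds (by simp)
      filter_upwards [nhdsWithin_le_nhds this, self_mem_nhdsWithin] with k hk hk' hkS
      exact hk (by simpa using ⟨hkS, hk'⟩)
    obtain ⟨δ', hδ', hb'⟩ := Metric.mem_nhdsWithin_iff.1 hpunc
    refine ⟨min δ δ', lt_min hδ hδ', fun k hk hkd => ?_⟩
    have hkS : k ∉ S := hb' ⟨lt_of_lt_of_le hkd (min_le_right _ _), hk⟩
    rw [dist_zero_right]
    refine lt_of_le_of_lt ?_ (half_lt_self hε)
    have := hNB k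
    have ht : Tendsto (fun x => ‖(x - s) * F x‖) (𝓝[A] k) (𝓝 ‖(k - s) * g k‖) := by
      refine Tendsto.norm (Tendsto.mul ?_ (hgt k hkS))
      exact tendsto_nhdsWithin_of_tendsto_nhds
        ((continuous_id.sub continuous_const).tendsto k)
    refine le_of_tendsto ht ?_
    have hball : ∀ᶠ x in 𝓝[A] k, dist x s < δ :=
      nhdsWithin_le_nhds (Metric.isOpen_ball.mem_nhds (lt_of_lt_of_le hkd (min_le_left _ _)))
    filter_upwards [hball, self_mem_nhdsWithin] with x hx hxA
    have := hb hxA hx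
    rw [dist_zero_right] at this
    exact this.le
  have hSc : ((S : Set ℂ)ᶜ) ∈ cocompact ℂ := (Finset.finite_toSet S).isCompact.compl_mem_cocompact
  have hz : Tendsto h (cocompact ℂ) (𝓝 0) := by
    rw [Metric.tendsto_nhds]
    intro ε hε
    have h3 := (Metric.tendsto_nhds.1 hinf) (ε / 2) (by positivity)
    rw [eventually_inf_principal] at h3
    obtain ⟨K, hK, hKs⟩ := mem_cocompact.1 h3
    filter_upwards [hSc, hK.compl_mem_cocompact] with k hk hkK
    rw [h2 k hk, dist_zero_right]
    refine lt_of_le_of_lt ?_ (half_lt_self hε)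
    have := hNB k
    refine le_of_tendsto (hgt k hk).norm ?_
    filter_upwards [nhdsWithin_le_nhds (hK.isClosed.isOpen_compl.mem_nhds hkK),
      self_mem_nhdsWithin] with x hx hxA
    have := hKs hx hxA.1
    rw [dist_zero_right] at this
    exact this.le
  intro k hk hkS
  rw [← hgA k ⟨hk, hkS⟩, ← h2 k hkS, h1.apply_eq_of_tendsto_cocompact k hz]

theorem det_J0 (r : ℝ → ℂ) (k : ℝ) : (J0 r k).det = 1 := by
  have := Complex.conj_mul' (r k)
  simp only [J0, Matrix.det_fin_two_of]
  push_cast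
  linear_combination -this

theorem det_expSigma3 (φ : ℂ) : (expSigma3 φ).det = 1 := by
  simp [expSigma3, Matrix.det_fin_two_of, ← Complex.exp_add]

theorem det_jump (r : ℝ → ℂ) (xh t k : ℝ) : (jump r xh t k).det = 1 := by
  simp [jump, det_J0, det_expSigma3]

theorem nhdsWithin_im_ne_zero (s : ℂ) :
    𝓝[{k : ℂ | k.im ≠ 0}] s = 𝓝[{k : ℂ | 0 < k.im}] s ⊔ 𝓝[{k : ℂ | k.im < 0}] s := by
  rw [← nhdsWithin_union]
  congr 1
  ext k
  simp only [Set.mem_ofPred_eq, Set.mem_union]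
  rw [or_comm]
  exact ne_iff_lt_or_gt

/-- At a pole `z` the matrix `M adj(N)` of two solutions is `o(1 / (k - z))`: the residue
conditions make the rank-one singular parts cancel. -/
theorem tendsto_sub_mul_mul_adjugate {M N : ℂ → Matrix (Fin 2) (Fin 2) ℂ} {z γ : ℂ} {l : Filter ℂ}
    {j j' : Fin 2} (hj : j' = 1 - j)
    (hMr : ∀ i, Tendsto (fun k => (k - z) * M k i j) l (𝓝 (γ * M z i j')))
    (hNr : ∀ i, Tendsto (fun k => (k - z) * N k i j) l (𝓝 (γ * N z i j')))
    (hM : ∀ i, Tendsto (fun k => M k i j') l (𝓝 (M z i j')))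
    (hN : ∀ i, Tendsto (fun k => N k i j') l (𝓝 (N z i j'))) (i i' : Fin 2) :
    Tendsto (fun k => (k - z) * (M k * (N k).adjugate) i i') l (𝓝 0) := by
  subst hj
  have h1 := ((hMr i).mul (hN (1 - i'))).sub ((hM i).mul (hNr (1 - i')))
  have h2 : γ * M z i (1 - j) * N z (1 - i') (1 - j) - M z i (1 - j) * (γ * N z (1 - i') (1 - j))
    = 0 := by ring
  rw [h2] at h1
  have h3 := h1.neg
  rw [neg_zero] at h3
  fin_cases j <;> fin_cases i' <;>
    simp only [Matrix.mul_apply, Matrix.adjugate_fin_two, Fin.sum_univ_two, Fin.zero_eta,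
      Fin.mk_one, Fin.isValue, sub_zero, sub_self, Matrix.of_apply, Matrix.cons_val',
      Matrix.cons_val_zero, Matrix.cons_val_one, Matrix.cons_val_fin_one] at h1 h3 ⊢ <;>
    first
      | (refine h1.congr fun k => ?_; ring1)
      | (refine h3.congr fun k => ?_; ring1)

theorem tendsto_entry {X : Type*} {l : Filter X} {M : X → Matrix (Fin 2) (Fin 2) ℂ}
    {A : Matrix (Fin 2) (Fin 2) ℂ} (hM : Tendsto M l (𝓝 A)) (i j : Fin 2) :
    Tendsto (fun k => M k i j) l (𝓝 (A i j)) :=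
  ((continuous_id.matrix_elem i j).tendsto A).comp hM

theorem tendsto_mul_adjugate {l : Filter ℂ} {M N : ℂ → Matrix (Fin 2) (Fin 2) ℂ}
    {A B : Matrix (Fin 2) (Fin 2) ℂ} (hM : Tendsto M l (𝓝 A)) (hN : Tendsto N l (𝓝 B)) :
    Tendsto (fun k => M k * (N k).adjugate) l (𝓝 (A * B.adjugate)) := by
  have h : Tendsto (fun k => (N k).adjugate) l (𝓝 B.adjugate) := by
    have hc : Continuous fun X : Matrix (Fin 2) (Fin 2) ℂ => X.adjugate :=
      continuous_id.matrix_adjugate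
    exact (hc.tendsto B).comp hN
  exact hM.mul h

/-- Uniqueness for the Riemann--Hilbert problem, against a solution of determinant one. -/
theorem IsRHSolution.unique {r : ℝ → ℂ} {Z : Set ℂ} {γ : ℂ → ℂ} {xh t : ℝ}
    {M N : ℂ → Matrix (Fin 2) (Fin 2) ℂ} (hZ : Z.Finite) (hZim : ∀ z ∈ Z, 0 < z.im)
    (hM : IsRHSolution r Z γ xh t M) (hN : IsRHSolution r Z γ xh t N)
    (hdet : ∀ k : ℂ, k.im ≠ 0 → k ∉ Z → (starRingEnd ℂ) k ∉ Z → (N k).det = 1) :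
    ∀ k : ℂ, k.im ≠ 0 → k ∉ Z → (starRingEnd ℂ) k ∉ Z → M k = N k := by
  classical
  set Zf := hZ.toFinset with hZf
  -- The point `0` is included because no jump relation is available there; it is removable since
  -- `M adj(N)` stays bounded near it.
  set S : Finset ℂ := insert 0 (Zf ∪ Zf.image (starRingEnd ℂ)) with hSdef
  have hmemS : ∀ k : ℂ, k ∈ S ↔ k = 0 ∨ k ∈ Z ∨ (starRingEnd ℂ) k ∈ Z := by
    intro k
    simp only [hSdef, Finset.mem_insert, Finset.mem_union, Finset.mem_image, hZf,
      Set.Finite.mem_toFinset]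
    refine or_congr Iff.rfl (or_congr Iff.rfl ⟨?_, fun h => ⟨_, h, by simp⟩⟩)
    rintro ⟨a, ha, rfl⟩
    simpa using ha
  have hcoZ : IsOpen Zᶜ := hZ.isClosed.isOpen_compl
  have himo : IsOpen {k : ℂ | k.im ≠ 0} := isOpen_ne_fun Complex.continuous_im continuous_const
  have ho1 : IsOpen {k : ℂ | k.im ≠ 0 ∧ k ∉ Z} := himo.inter hcoZ
  have ho2 : IsOpen {k : ℂ | k.im ≠ 0 ∧ (starRingEnd ℂ) k ∉ Z} :=
    himo.inter (hcoZ.preimage Complex.continuous_conj)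
  have hnot : ∀ z ∈ Z, (starRingEnd ℂ) z ∉ Z := fun z hz h => by
    have h1 := hZim _ h
    have h2 := hZim z hz
    simp only [Complex.conj_im] at h1
    linarith
  set E : ℂ → Matrix (Fin 2) (Fin 2) ℂ := fun k => M k * (N k).adjugate with hE
  -- The limits of `M adj(N)` at real points.
  have hreal : ∀ s : ℝ, ∃ Ep Em : Matrix (Fin 2) (Fin 2) ℂ,
      Tendsto E (𝓝[{k : ℂ | 0 < k.im}] (s : ℂ)) (𝓝 Ep) ∧
      Tendsto E (𝓝[{k : ℂ | k.im < 0}] (s : ℂ)) (𝓝 Em) ∧ (s ≠ 0 → Ep = Em) := by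
    obtain ⟨Mp, Mm, h1, h2, h3⟩ := hM.jump_relation
    obtain ⟨Np, Nm, h1', h2', h3'⟩ := hN.jump_relation
    intro s
    refine ⟨Mp s * (Np s).adjugate, Mm s * (Nm s).adjugate,
      tendsto_mul_adjugate (h1 s) (h1' s), tendsto_mul_adjugate (h2 s) (h2' s), fun hs => ?_⟩
    rw [h3 s hs, h3' s hs, Matrix.adjugate_mul_distrib, Matrix.mul_assoc,
      ← Matrix.mul_assoc (jump r xh t s), Matrix.mul_adjugate, det_jump, one_smul, Matrix.one_mul]
  -- The jump matrices cancel in `M adj(N)`, so each entry of `M adj(N) - 1` vanishes by Liouville.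
  have hone : ∀ i j, ∀ k : ℂ, k.im ≠ 0 → k ∉ S → E k i j - (1 : Matrix (Fin 2) (Fin 2) ℂ) i j = 0 := by
    intro i j
    refine eq_zero_of_off_real (S := S) (F := fun k => E k i j - (1 : Matrix (Fin 2) (Fin 2) ℂ) i j)
      ?_ ?_ ?_ ?_
    · have hsub1 : {k : ℂ | k.im ≠ 0 ∧ k ∉ S} ⊆ {k : ℂ | k.im ≠ 0 ∧ k ∉ Z} := fun k hk =>
        ⟨hk.1, fun h => hk.2 ((hmemS k).2 (Or.inr (Or.inl h)))⟩
      have hsub2 : {k : ℂ | k.im ≠ 0 ∧ k ∉ S} ⊆ {k : ℂ | k.im ≠ 0 ∧ (starRingEnd ℂ) k ∉ Z} :=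
        fun k hk => ⟨hk.1, fun h => hk.2 ((hmemS k).2 (Or.inr (Or.inr h)))⟩
      have a1 := fun i => (hM.analytic_first i).mono hsub1
      have a2 := fun i => (hM.analytic_second i).mono hsub2
      have b1 := fun i => (hN.analytic_first i).mono hsub1
      have b2 := fun i => (hN.analytic_second i).mono hsub2
      refine DifferentiableOn.sub_const ?_ _
      fin_cases j <;>
        simp only [hE, Matrix.mul_apply, Matrix.adjugate_fin_two, Fin.sum_univ_two, Fin.zero_eta,
          Fin.mk_one, Fin.isValue, Matrix.of_apply, Matrix.cons_val', Matrix.cons_val_zero,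
          Matrix.cons_val_one, Matrix.cons_val_fin_one]
      · exact ((a1 i).mul (b2 1)).add ((a2 i).mul (b1 1).neg)
      · exact ((a1 i).mul (b2 0).neg).add ((a2 i).mul (b1 0))
    · intro s hs
      have hconst : ∀ l : Filter ℂ, l ≤ 𝓝 s →
          Tendsto (fun k => (k - s) * (1 : Matrix (Fin 2) (Fin 2) ℂ) i j) l (𝓝 0) := by
        intro l hl
        have : Continuous fun k : ℂ => (k - s) * (1 : Matrix (Fin 2) (Fin 2) ℂ) i j := by fun_prop
        simpa using (this.tendsto s).mono_left hl
      have hmain : Tendsto (fun k => (k - s) * E k i j) (𝓝[{k | k.im ≠ 0 ∧ k ∉ S}] s) (𝓝 0) := by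
        rcases (hmemS s).1 hs with rfl | hz | hz
        · obtain ⟨Ep, Em, h1, h2, -⟩ := hreal 0
          rw [Complex.ofReal_zero] at h1 h2
          have h0 : Tendsto (fun k : ℂ => k - 0) (𝓝 0) (𝓝 0) := by
            simp only [sub_zero]
            exact tendsto_id
          have h1' := (h0.mono_left nhdsWithin_le_nhds).mul (tendsto_entry h1 i j)
          have h2' := (h0.mono_left nhdsWithin_le_nhds).mul (tendsto_entry h2 i j)
          rw [zero_mul] at h1' h2'
          refine Tendsto.mono_left (h1'.sup h2') ?_
          rw [← nhdsWithin_im_ne_zero]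
          exact nhdsWithin_mono _ fun k hk => hk.1
        · have hl : 𝓝[{k | k.im ≠ 0 ∧ k ∉ S}] s ≤ 𝓝[≠] s :=
            nhdsWithin_mono _ fun k hk (h : k = s) => hk.2 (h ▸ hs)
          have hmem : s ∈ {k : ℂ | k.im ≠ 0 ∧ (starRingEnd ℂ) k ∉ Z} := ⟨(hZim s hz).ne', hnot s hz⟩
          refine tendsto_sub_mul_mul_adjugate (j := 0) (j' := 1) rfl
            (fun i => (hM.residue_first s hz i).mono_left hl)
            (fun i => (hN.residue_first s hz i).mono_left hl) (fun i => ?_) (fun i => ?_) i j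
          · exact (((hM.analytic_second i).continuousOn.continuousAt
              (ho2.mem_nhds hmem)).tendsto).mono_left nhdsWithin_le_nhds
          · exact (((hN.analytic_second i).continuousOn.continuousAt
              (ho2.mem_nhds hmem)).tendsto).mono_left nhdsWithin_le_nhds
        · have hl : 𝓝[{k | k.im ≠ 0 ∧ k ∉ S}] s ≤ 𝓝[≠] s :=
            nhdsWithin_mono _ fun k hk (h : k = s) => hk.2 (h ▸ hs)
          have him : s.im ≠ 0 := by
            have := hZim _ hz
            simp only [Complex.conj_im] at this
            linarith
          have hmem : s ∈ {k : ℂ | k.im ≠ 0 ∧ k ∉ Z} := ⟨him, fun h => hnot s h hz⟩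
          have r1 := hM.residue_second _ hz
          have r2 := hN.residue_second _ hz
          simp only [Complex.conj_conj] at r1 r2
          refine tendsto_sub_mul_mul_adjugate (j := 1) (j' := 0) rfl
            (fun i => (r1 i).mono_left hl)
            (fun i => (r2 i).mono_left hl) (fun i => ?_) (fun i => ?_) i j
          · exact (((hM.analytic_first i).continuousOn.continuousAt
              (ho1.mem_nhds hmem)).tendsto).mono_left nhdsWithin_le_nhds
          · exact (((hN.analytic_first i).continuousOn.continuousAt
              (ho1.mem_nhds hmem)).tendsto).mono_left nhdsWithin_le_nhds
      have := hmain.sub (hconst _ nhdsWithin_le_nhds)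
      simpa [mul_sub] using this
    · intro s hs
      have hs0 : s ≠ 0 := fun h => hs ((hmemS _).2 (Or.inl (by simp [h])))
      obtain ⟨Ep, Em, h1, h2, h3⟩ := hreal s
      rw [← h3 hs0] at h2
      refine ⟨Ep i j - (1 : Matrix (Fin 2) (Fin 2) ℂ) i j, ?_⟩
      rw [nhdsWithin_im_ne_zero]
      exact Tendsto.sub_const (tendsto_entry (h1.sup h2) i j) _
    · have h1 := tendsto_mul_adjugate hM.normalization hN.normalization
      simp only [Matrix.adjugate_one, mul_one] at h1
      have h2 := Tendsto.sub_const (tendsto_entry h1 i j)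
        ((1 : Matrix (Fin 2) (Fin 2) ℂ) i j)
      rw [sub_self] at h2
      exact h2
  intro k hk1 hk2 hk3
  have hkS : k ∉ S := by
    rw [hmemS]
    rintro (rfl | h | h)
    · simp at hk1
    · exact hk2 h
    · exact hk3 h
  have h1 : E k = 1 := by
    ext i j
    exact sub_eq_zero.1 (hone i j k hk1 hkS)
  have h2 : M k * ((N k).adjugate * N k) = N k := by
    rw [← Matrix.mul_assoc]
    change E k * N k = N k
    rw [h1, Matrix.one_mul]
  rwa [Matrix.adjugate_mul, hdet k hk1 hk2 hk3, one_smul, Matrix.mul_one] at h2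
end ShortPulse

/-! ### Volterra integral equations -/

namespace ShortPulse

section Improper

variable {E : Type*} [NormedAddCommGroup E] [NormedSpace ℝ E] [CompleteSpace E] {f : ℝ → E}

theorem hasDerivAt_integral_Iic_of_integrableOn (hf : Continuous f)
    (hi : ∀ x, IntegrableOn f (Set.Iic x)) (x : ℝ) :
    HasDerivAt (fun x => ∫ y in Set.Iic x, f y) (f x) x := by
  have h1 : (fun x => ∫ y in Set.Iic x, f y) = fun x =>
      (∫ y in Set.Iic 0, f y) + ∫ y in (0 : ℝ)..x, f y := by
    ext x
    rw [← intervalIntegral.integral_Iic_sub_Iic (hi _) (hi _)]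
    abel
  rw [h1]
  exact (intervalIntegral.integral_hasDerivAt_right (hf.intervalIntegrable _ _)
    hf.stronglyMeasurable.stronglyMeasurableAtFilter hf.continuousAt).const_add _

theorem hasDerivAt_integral_Iic (hf : Continuous f) (hi : Integrable f) (x : ℝ) :
    HasDerivAt (fun x => ∫ y in Set.Iic x, f y) (f x) x :=
  hasDerivAt_integral_Iic_of_integrableOn hf (fun _ => hi.integrableOn) x

omit [CompleteSpace E] in
theorem tendsto_integral_Iic_atBot (hi : Integrable f) :
    Tendsto (fun x => ∫ y in Set.Iic x, f y) atBot (𝓝 0) := by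
  have h := (intervalIntegral_tendsto_integral_Iic (f := f) 0 hi.integrableOn
    tendsto_id).const_sub (∫ y in Set.Iic 0, f y)
  rw [sub_self] at h
  refine h.congr fun x => ?_
  rw [id, ← intervalIntegral.integral_Iic_sub_Iic hi.integrableOn hi.integrableOn]
  abel

omit [CompleteSpace E] in
theorem tendsto_integral_Iic_atTop (hi : Integrable f) :
    Tendsto (fun x => ∫ y in Set.Iic x, f y) atTop (𝓝 (∫ y, f y)) := by
  have h := (intervalIntegral_tendsto_integral_Ioi (f := f) 0 hi.integrableOn
    tendsto_id).const_add (∫ y in Set.Iic 0, f y)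
  rw [intervalIntegral.integral_Iic_add_Ioi hi.integrableOn hi.integrableOn] at h
  refine h.congr fun x => ?_
  rw [id, ← intervalIntegral.integral_Iic_sub_Iic hi.integrableOn hi.integrableOn]
  abel

end Improper

/-- An integral of holomorphic functions with an integrable bound is holomorphic. -/
theorem differentiableOn_integral {E : Type*} [NormedAddCommGroup E] [NormedSpace ℂ E]
    [CompleteSpace E] {U : Set ℂ} (hU : IsOpen U) {μ : Measure ℝ} {F : ℂ → ℝ → E} {bound : ℝ → ℝ}
    (hmeas : ∀ k ∈ U, AEStronglyMeasurable (F k) μ)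
    (hdiff : ∀ᵐ y ∂μ, DifferentiableOn ℂ (fun k => F k y) U)
    (hbound : ∀ᵐ y ∂μ, ∀ k ∈ U, ‖F k y‖ ≤ bound y) (hb : Integrable bound μ) :
    DifferentiableOn ℂ (fun k => ∫ y, F k y ∂μ) U := by
  intro k₀ hk₀
  obtain ⟨r, hr, hrU⟩ := Metric.isOpen_iff.1 hU k₀ hk₀
  have hsub : ∀ k ∈ Metric.ball k₀ (r / 2), Metric.closedBall k (r / 4) ⊆ U := by
    intro k hk z hz
    refine hrU ?_
    rw [Metric.mem_ball] at hk ⊢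
    rw [Metric.mem_closedBall] at hz
    calc dist z k₀ ≤ dist z k + dist k k₀ := dist_triangle _ _ _
      _ < r := by linarith
  have hmem : ∀ k ∈ Metric.ball k₀ (r / 2), k ∈ U := fun k hk =>
    hsub k hk (Metric.mem_closedBall_self (by positivity))
  have hk₀' : k₀ ∈ Metric.ball k₀ (r / 2) := Metric.mem_ball_self (by positivity)
  have hderiv : ∀ᵐ y ∂μ, ∀ k ∈ U, HasDerivAt (fun k => F k y) (deriv (fun k => F k y) k) k := by
    filter_upwards [hdiff] with y hy k hk
    exact (hy.differentiableAt (hU.mem_nhds hk)).hasDerivAt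
  have hD := hasDerivAt_integral_of_dominated_loc_of_deriv_le (μ := μ) (F := F)
    (F' := fun k y => deriv (fun k => F k y) k) (x₀ := k₀) (s := Metric.ball k₀ (r / 2))
    (bound := fun y => bound y / (r / 4)) (Metric.ball_mem_nhds _ (by positivity)) ?_ ?_ ?_ ?_
    (hb.div_const _) ?_
  · exact hD.2.differentiableAt.differentiableWithinAt
  · filter_upwards [hU.mem_nhds hk₀] with k hk using hmeas k hk
  · refine hb.mono' (hmeas k₀ hk₀) ?_
    filter_upwards [hbound] with y hy using hy k₀ hk₀
  · obtain ⟨c, hc⟩ : ∃ c : ℕ → ℂ, c = fun n : ℕ => ((r / 4 / ((n : ℝ) + 1) : ℝ) : ℂ) := ⟨_, rfl⟩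
    have hc0 : ∀ n, c n ≠ 0 := fun n => by
      rw [hc]
      exact Complex.ofReal_ne_zero.2 (by positivity)
    have hct : Tendsto c atTop (𝓝 0) := by
      rw [hc, ← Complex.ofReal_zero]
      refine (Complex.continuous_ofReal.tendsto 0).comp ?_
      have := (tendsto_one_div_add_atTop_nhds_zero_nat (𝕜 := ℝ)).const_mul (r / 4)
      rw [mul_zero] at this
      refine this.congr fun n => ?_
      field_simp
    have hcU : ∀ n, k₀ + c n ∈ U := fun n => by
      refine hsub k₀ hk₀' ?_
      rw [Metric.mem_closedBall, dist_self_add_left, hc, Complex.norm_real, Real.norm_eq_abs,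
        abs_of_pos (by positivity)]
      exact div_le_self (by positivity) (by linarith [Nat.cast_nonneg (α := ℝ) n])
    refine aestronglyMeasurable_of_tendsto_ae atTop
      (f := fun n y => (c n)⁻¹ • (F (k₀ + c n) y - F k₀ y))
      (fun n => ((hmeas _ (hcU n)).sub (hmeas _ hk₀)).const_smul _) ?_
    filter_upwards [hderiv] with y hy
    have h1 := (hasDerivAt_iff_tendsto_slope_zero.1 (hy k₀ hk₀))
    refine h1.comp (tendsto_nhdsWithin_iff.2 ⟨hct, Eventually.of_forall hc0⟩)
  · filter_upwards [hdiff, hbound] with y hy hyb k hk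
    refine Complex.norm_deriv_le_of_forall_mem_sphere_norm_le (by positivity) ?_ ?_
    · refine (hy.mono ?_).diffContOnCl
      rw [closure_ball _ (by positivity)]
      exact hsub k hk
    · intro z hz
      exact hyb z (hsub k hk (Metric.sphere_subset_closedBall hz))
  · filter_upwards [hderiv] with y hy k hk using hy k (hmem k hk)

/-- `W` dominates the iterated primitives of the weight `g`: `∫_{-∞}^x g Wⁿ ≤ Wⁿ⁺¹ / (n + 1)`,
as it does when `W` is the primitive of `g` vanishing at `-∞`. -/
structure VolterraWeight (g W : ℝ → ℝ) : Prop where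
  nonneg : ∀ x, 0 ≤ g x
  integrable : Integrable g
  W_nonneg : ∀ x, 0 ≤ W x
  W_measurable : Measurable W
  W_bounded : ∃ B, ∀ x, W x ≤ B
  iter : ∀ (n : ℕ) (x : ℝ), ∫ y in Set.Iic x, g y * W y ^ n ≤ W x ^ (n + 1) / (n + 1)

theorem VolterraWeight.integrable_mul_pow {g W : ℝ → ℝ} (h : VolterraWeight g W) (n : ℕ) :
    Integrable fun y => g y * W y ^ n := by
  obtain ⟨B, hB⟩ := h.W_bounded
  refine (h.integrable.mul_const (B ^ n)).mono'
    (h.integrable.aestronglyMeasurable.mul (h.W_measurable.pow_const n).aestronglyMeasurable) ?_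
  filter_upwards with y
  rw [Real.norm_of_nonneg (mul_nonneg (h.nonneg y) (pow_nonneg (h.W_nonneg y) n))]
  exact mul_le_mul_of_nonneg_left (pow_le_pow_left₀ (h.W_nonneg y) (hB y) n) (h.nonneg y)

/-- A continuous integrable weight together with its primitive vanishing at `-∞`. -/
theorem VolterraWeight.of_continuous {g : ℝ → ℝ} (hg : Continuous g) (hi : Integrable g)
    (h0 : ∀ x, 0 ≤ g x) : VolterraWeight g fun x => ∫ y in Set.Iic x, g y := by
  have hd := hasDerivAt_integral_Iic hg hi
  have hcont : Continuous fun x => ∫ y in Set.Iic x, g y :=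
    continuous_iff_continuousAt.2 fun x => (hd x).continuousAt
  have hW0 : ∀ x, 0 ≤ ∫ y in Set.Iic x, g y := fun x =>
    setIntegral_nonneg measurableSet_Iic fun y _ => h0 y
  have hWB : ∀ x, ∫ y in Set.Iic x, g y ≤ ∫ y, g y := fun x =>
    setIntegral_le_integral hi (Eventually.of_forall h0)
  refine ⟨h0, hi, hW0, hcont.measurable, ⟨∫ y, g y, hWB⟩, fun n x => le_of_eq ?_⟩
  have hint : Integrable fun y => g y * (∫ z in Set.Iic y, g z) ^ n := by
    refine (hi.mul_const ((∫ y, g y) ^ n)).mono' (by fun_prop) ?_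
    filter_upwards with y
    rw [Real.norm_of_nonneg (mul_nonneg (h0 y) (pow_nonneg (hW0 y) n))]
    exact mul_le_mul_of_nonneg_left (pow_le_pow_left₀ (hW0 y) (hWB y) n) (h0 y)
  have := integral_Iic_of_hasDerivAt_of_tendsto' (a := x) (m := 0)
    (f := fun x => (∫ y in Set.Iic x, g y) ^ (n + 1) / (n + 1))
    (f' := fun y => g y * (∫ z in Set.Iic y, g z) ^ n) (fun y _ => ?_) hint.integrableOn ?_
  · rw [this, sub_zero]
  · refine (((hd y).fun_pow (n + 1)).div_const ((n : ℝ) + 1)).congr_deriv ?_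
    rw [Nat.add_sub_cancel]
    push_cast
    field_simp
  · have h := ((tendsto_integral_Iic_atBot hi).pow (n + 1)).div_const ((n : ℝ) + 1)
    simpa using h

/-- The weight `C` on `(0, t]`. -/
theorem VolterraWeight.const_indicator {C t : ℝ} (hC : 0 ≤ C) (ht : 0 ≤ t) :
    VolterraWeight ((Set.Ioc 0 t).indicator fun _ => C) fun x => C * max 0 (min x t) := by
  have hm : ∀ x, max 0 (min x t) ≤ t := fun x => max_le ht (min_le_right _ _)
  refine ⟨fun x => Set.indicator_nonneg (fun _ _ => hC) x,
    (integrable_indicator_iff measurableSet_Ioc).2 (integrableOn_const (by simp)),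
    fun x => mul_nonneg hC (le_max_left _ _), by fun_prop,
    ⟨C * t, fun x => mul_le_mul_of_nonneg_left (hm x) hC⟩, fun n x => le_of_eq ?_⟩
  have h1 : ∀ y, (Set.Ioc 0 t).indicator (fun _ => C) y * (C * max 0 (min y t)) ^ n =
      (Set.Ioc 0 t).indicator (fun y => C ^ (n + 1) * y ^ n) y := by
    intro y
    by_cases hy : y ∈ Set.Ioc 0 t
    · rw [Set.indicator_of_mem hy, Set.indicator_of_mem hy, min_eq_left hy.2,
        max_eq_right hy.1.le]
      ring
    · simp [Set.indicator_of_notMem hy]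
  simp_rw [h1]
  rw [setIntegral_indicator measurableSet_Ioc]
  have h2 : Set.Iic x ∩ Set.Ioc 0 t = Set.Ioc 0 (max 0 (min x t)) := by
    ext y
    simp only [Set.mem_inter_iff, Set.mem_Iic, Set.mem_Ioc, le_max_iff, le_min_iff]
    constructor
    · rintro ⟨h1, h2, h3⟩
      exact ⟨h2, Or.inr ⟨h1, h3⟩⟩
    · rintro ⟨h1, h2 | ⟨h2, h3⟩⟩
      · exact absurd h1 (not_lt.2 h2)
      · exact ⟨h2, h1, h3⟩
  rw [h2, ← intervalIntegral.integral_of_le (le_max_left _ _), intervalIntegral.integral_const_mul,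
    integral_pow]
  simp only [ne_eq, Nat.add_eq_zero_iff, one_ne_zero, and_false, not_false_eq_true, zero_pow,
    sub_zero, mul_pow]
  ring

/-- Grönwall's inequality in integral form. -/
theorem VolterraWeight.gronwall {g W : ℝ → ℝ} (h : VolterraWeight g W) {φ : ℝ → ℝ} {X D ε : ℝ}
    (h0 : ∀ x ≤ X, 0 ≤ φ x) (hD : ∀ x ≤ X, φ x ≤ D) (hε : 0 ≤ ε)
    (hφ : ∀ x ≤ X, φ x ≤ ε + ∫ y in Set.Iic x, g y * φ y) :
    ∀ x ≤ X, φ x ≤ ε * Real.exp (W x) := by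
  have hD0 : 0 ≤ D := (h0 X le_rfl).trans (hD X le_rfl)
  have key : ∀ n : ℕ, ∀ x ≤ X, φ x ≤ ε * (∑ j ∈ Finset.range n, W x ^ j / j.factorial) +
      D * (W x ^ n / n.factorial) := by
    intro n
    induction n with
    | zero => intro x hx; simpa using hD x hx
    | succ n ih =>
      intro x hx
      refine (hφ x hx).trans ?_
      have hint : ∀ j : ℕ, IntegrableOn (fun y => g y * (W y ^ j / j.factorial)) (Set.Iic x) := by
        intro j
        refine (((h.integrable_mul_pow j).div_const (j.factorial : ℝ)).integrableOn).congr_fun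
          (fun y _ => ?_) measurableSet_Iic
        ring
      have hle : ∀ j : ℕ, ∫ y in Set.Iic x, g y * (W y ^ j / j.factorial) ≤
          W x ^ (j + 1) / (j + 1).factorial := by
        intro j
        have : ∀ y, g y * (W y ^ j / j.factorial) = (g y * W y ^ j) / j.factorial :=
          fun y => by ring
        simp_rw [this]
        rw [integral_div]
        refine (div_le_div_of_nonneg_right (h.iter j x) (by positivity)).trans (le_of_eq ?_)
        rw [Nat.factorial_succ]
        push_cast
        field_simp
      have h1 : ∫ y in Set.Iic x, g y * φ y ≤ ∫ y in Set.Iic x,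
          ((∑ j ∈ Finset.range n, ε * (g y * (W y ^ j / j.factorial))) +
            D * (g y * (W y ^ n / n.factorial))) := by
        refine integral_mono_of_nonneg ?_ ?_ ?_
        · filter_upwards [ae_restrict_mem measurableSet_Iic] with y hy
          exact mul_nonneg (h.nonneg y) (h0 y (le_trans hy hx))
        · exact (integrable_finsetSum _ fun j _ => (hint j).const_mul ε).add
            ((hint n).const_mul D)
        · filter_upwards [ae_restrict_mem measurableSet_Iic] with y hy
          refine (mul_le_mul_of_nonneg_left (ih y (le_trans hy hx)) (h.nonneg y)).trans
            (le_of_eq ?_)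
          rw [← Finset.mul_sum, ← Finset.mul_sum]
          ring
      rw [integral_add (integrable_finsetSum _ fun j _ => (hint j).const_mul ε)
        ((hint n).const_mul D), integral_finsetSum _ fun j _ => (hint j).const_mul ε] at h1
      simp_rw [integral_const_mul] at h1
      rw [Finset.sum_range_succ', mul_add]
      have h2 : ∑ j ∈ Finset.range n, ε * ∫ y in Set.Iic x, g y * (W y ^ j / j.factorial) ≤
          ε * ∑ j ∈ Finset.range n, W x ^ (j + 1) / (j + 1).factorial := by
        rw [Finset.mul_sum]
        exact Finset.sum_le_sum fun j _ => mul_le_mul_of_nonneg_left (hle j) hε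
      have h3 := mul_le_mul_of_nonneg_left (hle n) hD0
      simp only [pow_zero, Nat.factorial_zero, Nat.cast_one, div_one, mul_one]
      linarith
  intro x hx
  have hlim : Tendsto (fun n : ℕ => ε * (Real.exp (W x)) + D * (W x ^ n / n.factorial)) atTop
      (𝓝 (ε * Real.exp (W x) + D * 0)) :=
    ((FloorSemiring.tendsto_pow_div_factorial_atTop (W x)).const_mul D).const_add _
  rw [mul_zero, add_zero] at hlim
  refine ge_of_tendsto hlim (Eventually.of_forall fun n => (key n x hx).trans ?_)
  gcongr
  exact Real.sum_le_exp_of_nonneg (h.W_nonneg x) n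

section Volterra

variable {P E : Type*} [TopologicalSpace P] [FirstCountableTopology P] [NormedAddCommGroup E]
  [NormedSpace ℂ E] [CompleteSpace E]

/-- A family of Volterra kernels `A p x y`, `y ≤ x`, depending continuously on a parameter `p` and
dominated by the weight `g`. -/
structure VolterraKernel (A : P → ℝ → ℝ → E →L[ℂ] E) (g W : ℝ → ℝ) : Prop where
  weight : VolterraWeight g W
  meas : ∀ p x, AEStronglyMeasurable (A p x) volume
  cont : ∀ y, Continuous fun z : P × ℝ => A z.1 z.2 y
  bound : ∀ p x y, y ≤ x → ‖A p x y‖ ≤ g y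

/-- The terms of the Neumann series of the Volterra equation
`v(x) = v₀ + ∫_{-∞}^x A(x, y) v(y) dy`. -/
noncomputable def picard (A : P → ℝ → ℝ → E →L[ℂ] E) (v₀ : P → E) : ℕ → P → ℝ → E
  | 0 => fun p _ => v₀ p
  | n + 1 => fun p x => ∫ y in Set.Iic x, A p x y (picard A v₀ n p y)

/-- The solution of `v(x) = v₀ + ∫_{-∞}^x A(x, y) v(y) dy`, as a Neumann series. -/
noncomputable def volterraSol (A : P → ℝ → ℝ → E →L[ℂ] E) (v₀ : P → E) (p : P) (x : ℝ) : E :=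
  ∑' n, picard A v₀ n p x

namespace VolterraKernel

variable {A : P → ℝ → ℝ → E →L[ℂ] E} {g W : ℝ → ℝ} (h : VolterraKernel A g W) {v₀ : P → E}
include h

omit [FirstCountableTopology P] [CompleteSpace E] in
theorem aestronglyMeasurable_apply {φ : ℝ → E} (hφ : Continuous φ) (p : P) (x : ℝ) :
    AEStronglyMeasurable (fun y => A p x y (φ y)) volume :=
  isBoundedBilinearMap_apply.continuous.comp_aestronglyMeasurable
    ((h.meas p x).prodMk hφ.aestronglyMeasurable)

omit [CompleteSpace E] in
/-- Continuity and the factorial bound of the Neumann terms, proved together because the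
continuity of each term is obtained by dominated convergence from the bound on the previous one. -/
theorem picard_aux (hv₀ : Continuous v₀) (n : ℕ) :
    (Continuous fun z : P × ℝ => picard A v₀ n z.1 z.2) ∧
      ∀ p x, ‖picard A v₀ n p x‖ ≤ ‖v₀ p‖ * (W x ^ n / n.factorial) := by
  obtain ⟨B, hB⟩ := h.weight.W_bounded
  induction n with
  | zero =>
    exact ⟨hv₀.comp continuous_fst, fun p x => by simp [picard]⟩
  | succ n ih =>
    obtain ⟨ihc, ihb⟩ := ih
    have hcp : ∀ p, Continuous (picard A v₀ n p) := fun p =>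
      ihc.comp (Continuous.prodMk_right p)
    constructor
    · have heq : (fun z : P × ℝ => picard A v₀ (n + 1) z.1 z.2) = fun z =>
          ∫ y, (Set.Iic z.2).indicator (fun y => A z.1 z.2 y (picard A v₀ n z.1 y)) y := by
        ext z
        rw [integral_indicator measurableSet_Iic, picard]
      rw [heq, continuous_iff_continuousAt]
      rintro ⟨p₀, x₀⟩
      have hnear : ∀ᶠ z : P × ℝ in 𝓝 (p₀, x₀), ‖v₀ z.1‖ < ‖v₀ p₀‖ + 1 := by
        have hc : Continuous fun z : P × ℝ => ‖v₀ z.1‖ := by fun_prop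
        exact (hc.tendsto (p₀, x₀)).eventually_lt_const (by simp)
      refine continuousAt_of_dominated
        (bound := fun y => g y * ((‖v₀ p₀‖ + 1) * (B ^ n / n.factorial))) ?_ ?_
        (h.weight.integrable.mul_const _) ?_
      · filter_upwards with z
        exact (h.aestronglyMeasurable_apply (hcp z.1) z.1 z.2).indicator measurableSet_Iic
      · filter_upwards [hnear] with z hz
        filter_upwards with y
        have hB0 : 0 ≤ B := (h.weight.W_nonneg y).trans (hB y)
        by_cases hy : y ∈ Set.Iic z.2
        · rw [Set.indicator_of_mem hy]
          refine ((A z.1 z.2 y).le_opNorm _).trans ?_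
          refine mul_le_mul (h.bound _ _ _ hy) ((ihb z.1 y).trans ?_) (norm_nonneg _)
            (h.weight.nonneg y)
          have := h.weight.W_nonneg y
          have := hB y
          gcongr
        · rw [Set.indicator_of_notMem hy, norm_zero]
          exact mul_nonneg (h.weight.nonneg y) (by positivity)
      · have hne : ∀ᵐ y : ℝ ∂volume, y ≠ x₀ := by simp [ae_iff]
        filter_upwards [hne] with y hy
        have hc : Continuous fun z : P × ℝ => A z.1 z.2 y (picard A v₀ n z.1 y) :=
          (h.cont y).clm_apply (ihc.comp (continuous_fst.prodMk continuous_const))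
        rcases lt_or_gt_of_ne hy with hlt | hgt
        · refine hc.continuousAt.congr ?_
          have : ∀ᶠ z : P × ℝ in 𝓝 (p₀, x₀), y < z.2 :=
            (continuous_snd.tendsto (p₀, x₀)).eventually_const_lt hlt
          filter_upwards [this] with z hz
          rw [Set.indicator_of_mem (Set.mem_Iic.2 hz.le)]
        · refine (continuousAt_const (y := (0 : E))).congr ?_
          have : ∀ᶠ z : P × ℝ in 𝓝 (p₀, x₀), z.2 < y :=
            (continuous_snd.tendsto (p₀, x₀)).eventually_lt_const hgt
          filter_upwards [this] with z hz
          rw [Set.indicator_of_notMem (by simpa using hz)]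
    · intro p x
      rw [picard]
      have h1 : ‖∫ y in Set.Iic x, A p x y (picard A v₀ n p y)‖ ≤
          ∫ y in Set.Iic x, (g y * W y ^ n) * (‖v₀ p‖ / n.factorial) := by
        refine norm_integral_le_of_norm_le ((h.weight.integrable_mul_pow n).mul_const _).integrableOn ?_
        filter_upwards [ae_restrict_mem measurableSet_Iic] with y hy
        refine ((A p x y).le_opNorm _).trans ?_
        refine (mul_le_mul (h.bound _ _ _ hy) (ihb p y) (norm_nonneg _)
            (h.weight.nonneg y)).trans (le_of_eq (by ring))
      refine h1.trans ?_
      rw [integral_mul_const]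
      refine (mul_le_mul_of_nonneg_right (h.weight.iter n x) (by positivity)).trans (le_of_eq ?_)
      rw [Nat.factorial_succ]
      push_cast
      field_simp

omit [CompleteSpace E] in
theorem continuous_picard (hv₀ : Continuous v₀) (n : ℕ) :
    Continuous fun z : P × ℝ => picard A v₀ n z.1 z.2 := (h.picard_aux hv₀ n).1

omit [CompleteSpace E] in
theorem norm_picard_le (hv₀ : Continuous v₀) (n : ℕ) (p : P) (x : ℝ) :
    ‖picard A v₀ n p x‖ ≤ ‖v₀ p‖ * (W x ^ n / n.factorial) := (h.picard_aux hv₀ n).2 p x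

omit [CompleteSpace E] in
theorem norm_picard_le' (hv₀ : Continuous v₀) {B : ℝ} (hB : ∀ x, W x ≤ B) (n : ℕ) (p : P) (x : ℝ) :
    ‖picard A v₀ n p x‖ ≤ ‖v₀ p‖ * (B ^ n / n.factorial) := by
  refine (h.norm_picard_le hv₀ n p x).trans ?_
  have := h.weight.W_nonneg x
  have := hB x
  gcongr

theorem summable_picard (hv₀ : Continuous v₀) (p : P) (x : ℝ) :
    Summable fun n => picard A v₀ n p x := by
  obtain ⟨B, hB⟩ := h.weight.W_bounded
  exact Summable.of_norm_bounded ((Real.summable_pow_div_factorial B).mul_left _)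
    fun n => h.norm_picard_le' hv₀ hB n p x

omit [CompleteSpace E] in
theorem norm_volterraSol_le (hv₀ : Continuous v₀) {B : ℝ} (hB : ∀ x, W x ≤ B) (p : P) (x : ℝ) :
    ‖volterraSol A v₀ p x‖ ≤ ‖v₀ p‖ * Real.exp B := by
  have hs : HasSum (fun n : ℕ => ‖v₀ p‖ * (B ^ n / n.factorial)) (‖v₀ p‖ * Real.exp B) := by
    rw [Real.exp_eq_exp_ℝ]
    exact (NormedSpace.expSeries_div_hasSum_exp B).mul_left _
  exact tsum_of_norm_bounded hs fun n => h.norm_picard_le' hv₀ hB n p x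

theorem continuous_volterraSol (hv₀ : Continuous v₀) :
    Continuous fun z : P × ℝ => volterraSol A v₀ z.1 z.2 := by
  obtain ⟨B, hB⟩ := h.weight.W_bounded
  rw [continuous_iff_continuousAt]
  rintro ⟨p₀, x₀⟩
  set U : Set (P × ℝ) := {z | ‖v₀ z.1‖ < ‖v₀ p₀‖ + 1} with hU
  have hUo : IsOpen U := isOpen_lt (by fun_prop) continuous_const
  have hmem : (p₀, x₀) ∈ U := by simp [hU]
  have hB0 : 0 ≤ B := (h.weight.W_nonneg 0).trans (hB 0)
  have := continuousOn_tsum (s := U) (f := fun n (z : P × ℝ) => picard A v₀ n z.1 z.2)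
    (u := fun n : ℕ => (‖v₀ p₀‖ + 1) * (B ^ n / n.factorial))
    (fun n => (h.continuous_picard hv₀ n).continuousOn)
    ((Real.summable_pow_div_factorial B).mul_left _) (fun n z hz => by
      refine (h.norm_picard_le' hv₀ hB n z.1 z.2).trans ?_
      have : ‖v₀ z.1‖ < ‖v₀ p₀‖ + 1 := hz
      gcongr)
  exact this.continuousAt (hUo.mem_nhds hmem)

/-- The Neumann series solves the Volterra equation. -/
theorem volterraSol_eq (hv₀ : Continuous v₀) (p : P) (x : ℝ) :
    volterraSol A v₀ p x = v₀ p + ∫ y in Set.Iic x, A p x y (volterraSol A v₀ p y) := by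
  obtain ⟨B, hB⟩ := h.weight.W_bounded
  have hB0 : 0 ≤ B := (h.weight.W_nonneg 0).trans (hB 0)
  have hcp : ∀ n p, Continuous (picard A v₀ n p) := fun n p =>
    (h.continuous_picard hv₀ n).comp (Continuous.prodMk_right p)
  have h1 : HasSum (fun n => ∫ y in Set.Iic x, A p x y (picard A v₀ n p y))
      (∫ y in Set.Iic x, A p x y (volterraSol A v₀ p y)) := by
    refine hasSum_integral_of_dominated_convergence
      (bound := fun n y => g y * (‖v₀ p‖ * (B ^ n / n.factorial))) ?_ ?_ ?_ ?_ ?_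
    · intro n
      exact (h.aestronglyMeasurable_apply (hcp n p) p x).restrict
    · intro n
      filter_upwards [ae_restrict_mem measurableSet_Iic] with y hy
      refine ((A p x y).le_opNorm _).trans ?_
      exact mul_le_mul (h.bound _ _ _ hy) (h.norm_picard_le' hv₀ hB n p y) (norm_nonneg _)
        (h.weight.nonneg y)
    · filter_upwards with y
      exact ((Real.summable_pow_div_factorial B).mul_left _).mul_left _
    · simp_rw [tsum_mul_left]
      exact (h.weight.integrable.mul_const _).integrableOn
    · filter_upwards with y
      exact ((h.summable_picard hv₀ p y).hasSum).mapL (A p x y)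
  have h2 := (h.summable_picard hv₀ p x).tsum_eq_zero_add
  rw [volterraSol, h2, ← h1.tsum_eq]
  rfl

end VolterraKernel

omit [TopologicalSpace P] [FirstCountableTopology P] in
/-- If the kernel is holomorphic in the parameter, so is the solution, as a uniformly convergent
series of holomorphic functions. -/
theorem VolterraKernel.differentiableOn_volterraSol {A : ℂ → ℝ → ℝ → E →L[ℂ] E} {g W : ℝ → ℝ}
    (h : VolterraKernel A g W) {v : E} {U : Set ℂ} (hU : IsOpen U)
    (hA : ∀ x y, DifferentiableOn ℂ (fun k => A k x y) U) (x : ℝ) :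
    DifferentiableOn ℂ (fun k => volterraSol A (fun _ => v) k x) U := by
  obtain ⟨B, hB⟩ := h.weight.W_bounded
  have hv₀ : Continuous fun _ : ℂ => v := continuous_const
  have hcp : ∀ n p, Continuous (picard A (fun _ => v) n p) := fun n p =>
    (h.continuous_picard hv₀ n).comp (Continuous.prodMk_right p)
  have hd : ∀ n x, DifferentiableOn ℂ (fun k => picard A (fun _ => v) n k x) U := by
    intro n
    induction n with
    | zero => intro x; exact differentiableOn_const _
    | succ n ih =>
      intro x
      refine differentiableOn_integral hU (bound := fun y => g y * (‖v‖ * (B ^ n / n.factorial)))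
        ?_ ?_ ?_ (h.weight.integrable.mul_const _).integrableOn
      · intro k _
        exact (h.aestronglyMeasurable_apply (hcp n k) k x).restrict
      · filter_upwards with y
        exact (hA x y).clm_apply (ih y)
      · filter_upwards [ae_restrict_mem measurableSet_Iic] with y hy k _
        refine ((A k x y).le_opNorm _).trans ?_
        exact mul_le_mul (h.bound _ _ _ hy) (h.norm_picard_le' hv₀ hB n k y) (norm_nonneg _)
          (h.weight.nonneg y)
  exact Complex.differentiableOn_tsum_of_summable_norm
    ((Real.summable_pow_div_factorial B).mul_left ‖v‖) (fun n => hd n x) hU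
    fun n k _ => h.norm_picard_le' hv₀ hB n k x

end Volterra
end ShortPulse

/-! ### Spatial profiles and the change of variable -/

namespace ShortPulse

/-- A spatial profile: twice continuously differentiable, vanishing at infinity, with integrable
first and second derivatives. -/
structure IsProfile (f : ℝ → ℝ) : Prop where
  contDiff : ContDiff ℝ 2 f
  decay : Tendsto f (cocompact ℝ) (𝓝 0)
  integrable_deriv : Integrable (deriv f)
  integrable_deriv_deriv : Integrable (deriv (deriv f))

/-- The coefficient `f'' / (2 q²)` of `Û`. -/
noncomputable def uhatCoeff (f : ℝ → ℝ) (x : ℝ) : ℝ := deriv (deriv f) x / (2 * (q f x) ^ 2)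

/-- The conserved length defect `∫ (q - 1)`. -/
noncomputable def lengthDefect (f : ℝ → ℝ) : ℝ := ∫ y, (q f y - 1)

/-- `cos(θ / 2)`, where `tan θ = f'`: an entry of the rotation that diagonalizes the matrix
`(1, f'; f', -1)`. -/
noncomputable def halfCos (f : ℝ → ℝ) (x : ℝ) : ℝ := Real.cos (Real.arctan (deriv f x) / 2)

/-- `sin(θ / 2)`, where `tan θ = f'`. -/
noncomputable def halfSin (f : ℝ → ℝ) (x : ℝ) : ℝ := Real.sin (Real.arctan (deriv f x) / 2)

section q

variable (f : ℝ → ℝ) (x : ℝ)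

theorem q_sq : q f x ^ 2 = 1 + deriv f x ^ 2 := Real.sq_sqrt (by positivity)

theorem one_le_q : 1 ≤ q f x := Real.one_le_sqrt.2 (by nlinarith [sq_nonneg (deriv f x)])

theorem q_pos : 0 < q f x := lt_of_lt_of_le one_pos (one_le_q f x)

theorem q_le : q f x ≤ 1 + |deriv f x| :=
  Real.sqrt_le_iff.2 ⟨by positivity, by nlinarith [abs_nonneg (deriv f x), sq_abs (deriv f x)]⟩

theorem halfCos_sq_add_halfSin_sq : halfCos f x ^ 2 + halfSin f x ^ 2 = 1 :=
  Real.cos_sq_add_sin_sq _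

theorem q_mul_cos_double : q f x * (halfCos f x ^ 2 - halfSin f x ^ 2) = 1 := by
  have h1 : halfCos f x ^ 2 - halfSin f x ^ 2 = Real.cos (Real.arctan (deriv f x)) := by
    rw [halfCos, halfSin, ← Real.cos_two_mul']
    congr 1
    ring
  rw [h1, Real.cos_arctan, q, mul_one_div_cancel]
  exact (q_pos f x).ne'

theorem q_mul_sin_double : q f x * (2 * halfSin f x * halfCos f x) = deriv f x := by
  have h1 : 2 * halfSin f x * halfCos f x = Real.sin (Real.arctan (deriv f x)) := by
    rw [halfCos, halfSin, ← Real.sin_two_mul]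
    congr 1
    ring
  rw [h1, Real.sin_arctan, q, mul_div_cancel₀]
  exact (q_pos f x).ne'

/-- The half angle diagonalizes `(1, p; p, -1)`, `p = f'`, with eigenvalues `±q`: the first row of
the eigenvector equation. -/
theorem q_mul_halfCos : q f x * halfCos f x = halfCos f x + deriv f x * halfSin f x := by
  have h1 := halfCos_sq_add_halfSin_sq f x
  have h2 := q_mul_cos_double f x
  have h3 := q_mul_sin_double f x
  linear_combination halfCos f x * h2 + halfSin f x * h3 - q f x * halfCos f x * h1

/-- The second row of the eigenvector equation in `q_mul_halfCos`. -/
theorem q_mul_halfSin : q f x * halfSin f x = deriv f x * halfCos f x - halfSin f x := by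
  have h1 := halfCos_sq_add_halfSin_sq f x
  have h2 := q_mul_cos_double f x
  have h3 := q_mul_sin_double f x
  linear_combination -halfSin f x * h2 + halfCos f x * h3 - q f x * halfSin f x * h1

end q

namespace IsProfile

variable {f : ℝ → ℝ} (h : IsProfile f)
include h

theorem contDiff_deriv : ContDiff ℝ 1 (deriv f) :=
  ((contDiff_succ_iff_deriv (n := 1)).1 (by exact_mod_cast h.contDiff)).2.2

theorem hasDerivAt (x : ℝ) : HasDerivAt f (deriv f x) x :=
  (h.contDiff.differentiable (by norm_num) x).hasDerivAt

theorem hasDerivAt_deriv (x : ℝ) : HasDerivAt (deriv f) (deriv (deriv f) x) x :=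
  (h.contDiff_deriv.differentiable (by norm_num) x).hasDerivAt

theorem continuous_deriv : Continuous (deriv f) := h.contDiff_deriv.continuous

theorem continuous_deriv_deriv : Continuous (deriv (deriv f)) :=
  h.contDiff_deriv.continuous_deriv (by norm_num)

theorem tendsto_deriv_atTop : Tendsto (deriv f) atTop (𝓝 0) :=
  tendsto_zero_of_hasDerivAt_of_integrableOn_Ioi (a := 0) (fun x _ => h.hasDerivAt_deriv x)
    h.integrable_deriv_deriv.integrableOn h.integrable_deriv.integrableOn

theorem tendsto_deriv_atBot : Tendsto (deriv f) atBot (𝓝 0) :=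
  tendsto_zero_of_hasDerivAt_of_integrableOn_Iic (a := 0) (fun x _ => h.hasDerivAt_deriv x)
    h.integrable_deriv_deriv.integrableOn h.integrable_deriv.integrableOn

theorem tendsto_atBot : Tendsto f atBot (𝓝 0) := h.decay.mono_left atBot_le_cocompact

theorem tendsto_atTop : Tendsto f atTop (𝓝 0) := h.decay.mono_left atTop_le_cocompact

theorem continuous_q : Continuous (q f) := by
  have := h.continuous_deriv
  unfold q
  fun_prop

theorem integrable_q_sub_one : Integrable fun y => q f y - 1 := by
  refine h.integrable_deriv.norm.mono' (h.continuous_q.sub continuous_const).aestronglyMeasurable ?_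
  filter_upwards with y
  rw [Real.norm_of_nonneg (sub_nonneg.2 (one_le_q f y)), Real.norm_eq_abs]
  linarith [q_le f y]

theorem exists_q_le : ∃ C, ∀ x, q f x ≤ C := by
  refine ⟨1 + ∫ y, |deriv (deriv f) y|, fun x => (q_le f x).trans ?_⟩
  have h1 := integral_Iic_of_hasDerivAt_of_tendsto' (a := x) (fun y _ => h.hasDerivAt_deriv y)
    h.integrable_deriv_deriv.integrableOn h.tendsto_deriv_atBot
  rw [sub_zero] at h1
  rw [← h1]
  gcongr
  exact (abs_integral_le_integral_abs).trans
    (setIntegral_le_integral h.integrable_deriv_deriv.abs (Eventually.of_forall fun y => abs_nonneg _))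

/-- The change of variable written with an integral from `-∞`, which exposes its asymptotics
there. -/
theorem xhat_eq (x : ℝ) : xhat f x = x - lengthDefect f + ∫ y in Set.Iic x, (q f y - 1) := by
  have := intervalIntegral.integral_Iic_add_Ioi (b := x)
    h.integrable_q_sub_one.integrableOn h.integrable_q_sub_one.integrableOn
  rw [xhat, lengthDefect, ← this]
  ring

theorem hasDerivAt_xhat (x : ℝ) : HasDerivAt (xhat f) (q f x) x := by
  have h1 := ((hasDerivAt_id x).sub_const (lengthDefect f)).add
    (hasDerivAt_integral_Iic (h.continuous_q.sub continuous_const) h.integrable_q_sub_one x)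
  rw [show xhat f = fun x => x - lengthDefect f + ∫ y in Set.Iic x, (q f y - 1) from
    funext h.xhat_eq]
  exact h1.congr_deriv (by simp)

theorem continuous_xhat : Continuous (xhat f) :=
  continuous_iff_continuousAt.2 fun x => (h.hasDerivAt_xhat x).continuousAt

theorem tendsto_xhat_sub_atBot : Tendsto (fun x => xhat f x - x) atBot (𝓝 (-lengthDefect f)) := by
  have h1 := (tendsto_integral_Iic_atBot h.integrable_q_sub_one).const_add (-lengthDefect f)
  rw [add_zero] at h1
  refine h1.congr fun x => ?_
  rw [h.xhat_eq]
  ring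

theorem tendsto_xhat_sub_atTop : Tendsto (fun x => xhat f x - x) atTop (𝓝 0) := by
  have h1 := (tendsto_integral_Iic_atTop h.integrable_q_sub_one).const_add (-lengthDefect f)
  rw [lengthDefect, neg_add_cancel] at h1
  refine h1.congr fun x => ?_
  rw [h.xhat_eq, lengthDefect]
  ring

theorem strictMono_xhat : StrictMono (xhat f) :=
  strictMono_of_hasDerivAt_pos h.hasDerivAt_xhat fun x => q_pos f x

theorem surjective_xhat : Function.Surjective (xhat f) := by
  refine h.continuous_xhat.surjective ?_ ?_
  · exact (h.tendsto_xhat_sub_atTop.add_atTop tendsto_id).congr fun x => by simp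
  · exact (h.tendsto_xhat_sub_atBot.add_atBot tendsto_id).congr fun x => by simp

theorem continuous_uhatCoeff : Continuous (uhatCoeff f) := by
  have := h.continuous_q
  have := h.continuous_deriv_deriv
  refine Continuous.div (by fun_prop) (by fun_prop) fun x => ?_
  have := q_pos f x
  positivity

theorem integrable_uhatCoeff : Integrable (uhatCoeff f) := by
  refine h.integrable_deriv_deriv.norm.mono' h.continuous_uhatCoeff.aestronglyMeasurable ?_
  filter_upwards with y
  rw [uhatCoeff, norm_div]
  refine div_le_self (norm_nonneg _) ?_
  have := one_le_q f y
  rw [Real.norm_of_nonneg (by positivity)]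
  nlinarith

/-- The half angle rotates with speed `uhatCoeff`; hence the rotation produces the
potential `Û`. -/
theorem hasDerivAt_halfAngle (x : ℝ) :
    HasDerivAt (fun x => Real.arctan (deriv f x) / 2) (uhatCoeff f x) x := by
  refine (((h.hasDerivAt_deriv x).arctan).div_const 2).congr_deriv ?_
  rw [uhatCoeff, q_sq]
  field_simp

theorem hasDerivAt_halfCos (x : ℝ) :
    HasDerivAt (halfCos f) (-(uhatCoeff f x * halfSin f x)) x :=
  ((h.hasDerivAt_halfAngle x).cos).congr_deriv (by rw [halfSin]; ring)

theorem hasDerivAt_halfSin (x : ℝ) :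
    HasDerivAt (halfSin f) (uhatCoeff f x * halfCos f x) x :=
  ((h.hasDerivAt_halfAngle x).sin).congr_deriv (by rw [halfCos]; ring)

omit h in
theorem tendsto_halfCos {l : Filter ℝ} (hl : Tendsto (deriv f) l (𝓝 0)) :
    Tendsto (halfCos f) l (𝓝 1) := by
  have hc : Continuous fun p : ℝ => Real.cos (Real.arctan p / 2) := by fun_prop
  have h0 := (hc.tendsto 0).comp hl
  simp only [Real.arctan_zero, zero_div, Real.cos_zero] at h0
  exact h0

omit h in
theorem tendsto_halfSin {l : Filter ℝ} (hl : Tendsto (deriv f) l (𝓝 0)) :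
    Tendsto (halfSin f) l (𝓝 0) := by
  have hc : Continuous fun p : ℝ => Real.sin (Real.arctan p / 2) := by fun_prop
  have h0 := (hc.tendsto 0).comp hl
  simp only [Real.arctan_zero, zero_div, Real.sin_zero] at h0
  exact h0

end IsProfile

section reflect

variable (f : ℝ → ℝ) (x : ℝ)

theorem deriv_reflect : deriv (fun x => f (-x)) = fun x => -deriv f (-x) :=
  funext fun x => deriv_comp_neg f x

theorem deriv_deriv_reflect : deriv (deriv (fun x => f (-x))) = fun x => deriv (deriv f) (-x) := by
  rw [deriv_reflect]
  ext x
  rw [deriv.fun_neg, deriv_comp_neg (deriv f), neg_neg]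

theorem q_reflect : q (fun x => f (-x)) x = q f (-x) := by
  simp [q, deriv_reflect]

theorem uhatCoeff_reflect : uhatCoeff (fun x => f (-x)) x = uhatCoeff f (-x) := by
  simp [uhatCoeff, q_reflect, deriv_deriv_reflect]

theorem halfCos_reflect : halfCos (fun x => f (-x)) x = halfCos f (-x) := by
  simp [halfCos, deriv_reflect, neg_div]

theorem halfSin_reflect : halfSin (fun x => f (-x)) x = -halfSin f (-x) := by
  simp [halfSin, deriv_reflect, neg_div]

theorem lengthDefect_reflect : lengthDefect (fun x => f (-x)) = lengthDefect f := by
  simp only [lengthDefect, q_reflect]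
  exact integral_neg_eq_self (fun y => q f y - 1) volume

variable {f}

theorem IsProfile.reflect (h : IsProfile f) : IsProfile fun x => f (-x) where
  contDiff := h.contDiff.comp contDiff_neg
  decay := h.decay.comp (Homeomorph.neg ℝ).isClosedEmbedding.tendsto_cocompact
  integrable_deriv := by
    rw [deriv_reflect]
    exact h.integrable_deriv.comp_neg.neg
  integrable_deriv_deriv := by
    rw [deriv_deriv_reflect]
    exact h.integrable_deriv_deriv.comp_neg

theorem IsProfile.xhat_reflect (h : IsProfile f) :
    xhat (fun x => f (-x)) x = -(xhat f (-x) + lengthDefect f) := by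
  rw [h.xhat_eq, xhat]
  simp only [q_reflect]
  have := integral_comp_neg_Ioi x (fun y => q f y - 1)
  rw [this]
  ring

end reflect
end ShortPulse

/-! ### The Jost column normalized at minus infinity -/

namespace ShortPulse

theorem exists_norm_le_of_tendsto_atBot {E : Type*} [NormedAddCommGroup E] {v : ℝ → E} {e : E}
    (hv : Continuous v) (hl : Tendsto v atBot (𝓝 e)) (X : ℝ) : ∃ D, ∀ x ≤ X, ‖v x‖ ≤ D := by
  have h1 : ∀ᶠ x in atBot, ‖v x‖ < ‖e‖ + 1 := hl.norm.eventually_lt_const (by simp)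
  obtain ⟨a, ha⟩ := eventually_atBot.1 h1
  obtain ⟨C, hC⟩ := (isCompact_Icc (a := a) (b := X)).exists_bound_of_continuousOn hv.continuousOn
  refine ⟨max (‖e‖ + 1) C, fun x hx => ?_⟩
  rcases le_total x a with h | h
  · exact (ha x h).le.trans (le_max_left _ _)
  · exact (hC x ⟨h, hx⟩).trans (le_max_right _ _)

theorem integrableOn_Iic_mul_of_bound {α v : ℝ → ℂ} (hα : Integrable α) (hαc : Continuous α)
    (hv : Continuous v) {D X : ℝ} (hD : ∀ x ≤ X, ‖v x‖ ≤ D) :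
    IntegrableOn (fun y => α y * v y) (Set.Iic X) := by
  refine (hα.norm.integrableOn.mul_const D).mono' (by fun_prop) ?_
  filter_upwards [ae_restrict_mem measurableSet_Iic] with y hy
  rw [norm_mul]
  exact mul_le_mul_of_nonneg_left (hD y hy) (norm_nonneg _)

theorem norm_exp_two_I_mul_le {k : ℂ} (hk : 0 ≤ k.im) {s : ℝ} (hs : 0 ≤ s) :
    ‖Complex.exp (2 * Complex.I * k * s)‖ ≤ 1 := by
  rw [Complex.norm_exp, Real.exp_le_one_iff]
  simp only [Complex.mul_re, Complex.mul_im, Complex.re_ofNat, Complex.im_ofNat, Complex.I_re,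
    Complex.I_im, Complex.ofReal_re, Complex.ofReal_im]
  nlinarith [mul_nonneg hk hs]

section PhaseSystem

/-! The systems `v₀' = α v₁`, `v₁' = β v₀ + 2 i k h' v₁`. -/

variable {α β v₀ v₁ : ℝ → ℂ} {h h' : ℝ → ℝ} {k : ℂ}

/-- A solution of the system with limits `(1, 0)` at `-∞` solves the Volterra equations. The
phase `e^{2ik(h(x) - h(y))}` is bounded by one for `Im k ≥ 0` because `h` is monotone. -/
theorem volterra_of_ode (hα : Integrable α) (hαc : Continuous α) (hβ : Integrable β)
    (hβc : Continuous β) (hh : ∀ x, HasDerivAt h (h' x) x) (hmono : Monotone h) (hk : 0 ≤ k.im)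
    (h0 : ∀ x, HasDerivAt v₀ (α x * v₁ x) x)
    (h1 : ∀ x, HasDerivAt v₁ (β x * v₀ x + 2 * Complex.I * k * h' x * v₁ x) x)
    (l0 : Tendsto v₀ atBot (𝓝 1)) (l1 : Tendsto v₁ atBot (𝓝 0)) (x : ℝ) :
    v₀ x = 1 + ∫ y in Set.Iic x, α y * v₁ y ∧
    v₁ x = ∫ y in Set.Iic x,
      Complex.exp (2 * Complex.I * k * ((h x - h y : ℝ) : ℂ)) * (β y * v₀ y) := by
  have hc0 : Continuous v₀ := continuous_iff_continuousAt.2 fun x => (h0 x).continuousAt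
  have hc1 : Continuous v₁ := continuous_iff_continuousAt.2 fun x => (h1 x).continuousAt
  have hhc : Continuous h := continuous_iff_continuousAt.2 fun x => (hh x).continuousAt
  obtain ⟨D0, hD0⟩ := exists_norm_le_of_tendsto_atBot hc0 l0 x
  obtain ⟨D1, hD1⟩ := exists_norm_le_of_tendsto_atBot hc1 l1 x
  constructor
  · have := integral_Iic_of_hasDerivAt_of_tendsto' (a := x) (fun y _ => h0 y)
      (integrableOn_Iic_mul_of_bound hα hαc hc1 hD1) l0
    rw [this]
    ring
  · have hexp : ∀ y ≤ x, ‖Complex.exp (2 * Complex.I * k * ((h x - h y : ℝ) : ℂ))‖ ≤ 1 :=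
      fun y hy => norm_exp_two_I_mul_le hk (sub_nonneg.2 (hmono hy))
    have hd : ∀ y, HasDerivAt
        (fun y => Complex.exp (2 * Complex.I * k * ((h x - h y : ℝ) : ℂ)) * v₁ y)
        (Complex.exp (2 * Complex.I * k * ((h x - h y : ℝ) : ℂ)) * (β y * v₀ y)) y := by
      intro y
      have e1 : HasDerivAt (fun y => ((h x - h y : ℝ) : ℂ)) ((-h' y : ℝ) : ℂ) y :=
        ((hh y).const_sub (h x)).ofReal_comp
      refine (((e1.const_mul (2 * Complex.I * k)).cexp).mul (h1 y)).congr_deriv ?_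
      push_cast
      ring
    have hint : IntegrableOn
        (fun y => Complex.exp (2 * Complex.I * k * ((h x - h y : ℝ) : ℂ)) * (β y * v₀ y))
        (Set.Iic x) := by
      refine (integrableOn_Iic_mul_of_bound hβ hβc hc0 hD0).norm.mono'
        (by fun_prop) ?_
      filter_upwards [ae_restrict_mem measurableSet_Iic] with y hy
      rw [norm_mul]
      exact mul_le_of_le_one_left (norm_nonneg _) (hexp y hy)
    have hlim : Tendsto (fun y => Complex.exp (2 * Complex.I * k * ((h x - h y : ℝ) : ℂ)) * v₁ y)
        atBot (𝓝 0) := by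
      refine squeeze_zero_norm' ?_ (by simpa using l1.norm)
      filter_upwards [eventually_le_atBot x] with y hy
      rw [norm_mul]
      exact mul_le_of_le_one_left (norm_nonneg _) (hexp y hy)
    have := integral_Iic_of_hasDerivAt_of_tendsto' (a := x) (fun y _ => hd y) hint hlim
    rw [this]
    simp

/-- The converse of `volterra_of_ode`, for bounded solutions of the Volterra equations. -/
theorem hasDerivAt_of_volterra (hα : Integrable α) (hαc : Continuous α) (hβ : Integrable β)
    (hβc : Continuous β) (hh : ∀ x, HasDerivAt h (h' x) x) (hmono : Monotone h) (hk : 0 ≤ k.im)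
    (hc0 : Continuous v₀) (hc1 : Continuous v₁) {C : ℝ} (hC0 : ∀ x, ‖v₀ x‖ ≤ C)
    (hC1 : ∀ x, ‖v₁ x‖ ≤ C)
    (h0 : ∀ x, v₀ x = 1 + ∫ y in Set.Iic x, α y * v₁ y)
    (h1 : ∀ x, v₁ x = ∫ y in Set.Iic x,
      Complex.exp (2 * Complex.I * k * ((h x - h y : ℝ) : ℂ)) * (β y * v₀ y)) :
    (∀ x, HasDerivAt v₀ (α x * v₁ x) x) ∧
    (∀ x, HasDerivAt v₁ (β x * v₀ x + 2 * Complex.I * k * h' x * v₁ x) x) ∧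
    Tendsto v₀ atBot (𝓝 1) ∧ Tendsto v₁ atBot (𝓝 0) := by
  have hhc : Continuous h := continuous_iff_continuousAt.2 fun x => (hh x).continuousAt
  have hi0 : Integrable fun y => α y * v₁ y := by
    refine (hα.norm.mul_const C).mono' (by fun_prop) ?_
    filter_upwards with y
    rw [norm_mul]
    exact mul_le_mul_of_nonneg_left (hC1 y) (norm_nonneg _)
  have hi1 : Integrable fun y => β y * v₀ y := by
    refine (hβ.norm.mul_const C).mono' (by fun_prop) ?_
    filter_upwards with y
    rw [norm_mul]
    exact mul_le_mul_of_nonneg_left (hC0 y) (norm_nonneg _)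
  have hexp : ∀ x y, y ≤ x → ‖Complex.exp (2 * Complex.I * k * ((h x - h y : ℝ) : ℂ))‖ ≤ 1 :=
    fun x y hy => norm_exp_two_I_mul_le hk (sub_nonneg.2 (hmono hy))
  refine ⟨fun x => ?_, fun x => ?_, ?_, ?_⟩
  · rw [funext h0]
    exact (hasDerivAt_integral_Iic (by fun_prop) hi0 x).const_add _
  -- The exponential is split so that the dependence on `x` under the integral disappears.
  · have hsplit : ∀ x y, Complex.exp (2 * Complex.I * k * ((h x - h y : ℝ) : ℂ)) =
        Complex.exp (2 * Complex.I * k * h x) * Complex.exp (-(2 * Complex.I * k * h y)) := by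
      intro x y
      rw [← Complex.exp_add]
      congr 1
      push_cast
      ring
    have hint : ∀ x, IntegrableOn
        (fun y => Complex.exp (-(2 * Complex.I * k * h y)) * (β y * v₀ y)) (Set.Iic x) := by
      intro x
      have hb : IntegrableOn
          (fun y => Complex.exp (2 * Complex.I * k * ((h x - h y : ℝ) : ℂ)) * (β y * v₀ y))
          (Set.Iic x) := by
        refine hi1.integrableOn.norm.mono' (by fun_prop) ?_
        filter_upwards [ae_restrict_mem measurableSet_Iic] with y hy
        rw [norm_mul]
        exact mul_le_of_le_one_left (norm_nonneg _) (hexp x y hy)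
      refine IntegrableOn.congr_fun (hb.const_mul (Complex.exp (-(2 * Complex.I * k * h x))))
        (fun y _ => ?_) measurableSet_Iic
      simp only [hsplit]
      have e5 : Complex.exp (-(2 * Complex.I * k * h x)) * Complex.exp (2 * Complex.I * k * h x) =
          1 := by
        rw [← Complex.exp_add, neg_add_cancel, Complex.exp_zero]
      linear_combination (Complex.exp (-(2 * Complex.I * k * h y)) * (β y * v₀ y)) * e5
    have heq : v₁ = fun x => Complex.exp (2 * Complex.I * k * h x) *
        ∫ y in Set.Iic x, Complex.exp (-(2 * Complex.I * k * h y)) * (β y * v₀ y) := by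
      ext x
      rw [h1 x, ← integral_const_mul]
      refine integral_congr_ae (Eventually.of_forall fun y => ?_)
      simp only [hsplit]
      ring
    have e1 : HasDerivAt (fun x => Complex.exp (2 * Complex.I * k * h x))
        (Complex.exp (2 * Complex.I * k * h x) * (2 * Complex.I * k * h' x)) x :=
      ((hh x).ofReal_comp.const_mul (2 * Complex.I * k)).cexp
    have e2 := e1.mul (hasDerivAt_integral_Iic_of_integrableOn
      (f := fun y => Complex.exp (-(2 * Complex.I * k * h y)) * (β y * v₀ y)) (by fun_prop) hint x)
    have e3 := e2.congr_of_eventuallyEq (Eventually.of_forall fun y => congrFun heq y)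
    refine e3.congr_deriv ?_
    have e4 := congrFun heq x
    have e5 : Complex.exp (2 * Complex.I * k * h x) * Complex.exp (-(2 * Complex.I * k * h x)) = 1 := by
      rw [← Complex.exp_add, add_neg_cancel, Complex.exp_zero]
    linear_combination (-2 * Complex.I * k * h' x) * e4 + (β x * v₀ x) * e5
  · rw [funext h0]
    simpa using (tendsto_integral_Iic_atBot hi0).const_add 1
  · refine squeeze_zero_norm (a := fun x => ∫ y in Set.Iic x, ‖β y * v₀ y‖) (fun x => ?_)
      (tendsto_integral_Iic_atBot hi1.norm)
    rw [h1 x]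
    refine norm_integral_le_of_norm_le hi1.norm.integrableOn ?_
    filter_upwards [ae_restrict_mem measurableSet_Iic] with y hy
    rw [norm_mul]
    exact mul_le_of_le_one_left (norm_nonneg _) (hexp x y hy)

end PhaseSystem

/-- The `2 × 2` matrix unit `(i, j)` acting on `ℂ²`. -/
noncomputable def matUnit (i j : Fin 2) : (Fin 2 → ℂ) →L[ℂ] (Fin 2 → ℂ) :=
  (ContinuousLinearMap.single ℂ (fun _ => ℂ) i).comp (ContinuousLinearMap.proj j)

theorem matUnit_apply (i j : Fin 2) (v : Fin 2 → ℂ) (l : Fin 2) :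
    matUnit i j v l = if l = i then v j else 0 := by
  simp [matUnit, Pi.single_apply]

/-- Projection of a complex number to the closed upper half-plane. -/
noncomputable def clampIm (k : ℂ) : ℂ := k.re + (max k.im 0 : ℝ) * Complex.I

theorem clampIm_im (k : ℂ) : 0 ≤ (clampIm k).im := by simp [clampIm]

theorem clampIm_of_nonneg {k : ℂ} (hk : 0 ≤ k.im) : clampIm k = k := by
  rw [clampIm, max_eq_left hk, Complex.re_add_im]

theorem continuous_clampIm : Continuous clampIm := by
  unfold clampIm
  fun_prop

/-- The kernel of the Volterra equation for the first column of `Φ₋`. The spectral parameter is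
projected to the closed upper half-plane, so that the kernel is defined and bounded for all
parameters. -/
noncomputable def jostKernel (f : ℝ → ℝ) (k : ℂ) (x y : ℝ) : (Fin 2 → ℂ) →L[ℂ] (Fin 2 → ℂ) :=
  (uhatCoeff f y : ℂ) • (matUnit 0 1 -
    Complex.exp (2 * Complex.I * clampIm k * ((xhat f x - xhat f y : ℝ) : ℂ)) • matUnit 1 0)

theorem jostKernel_apply_zero (f : ℝ → ℝ) (k : ℂ) (x y : ℝ) (v : Fin 2 → ℂ) :
    jostKernel f k x y v 0 = uhatCoeff f y * v 1 := by
  simp [jostKernel, matUnit_apply]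

theorem jostKernel_apply_one (f : ℝ → ℝ) (k : ℂ) (x y : ℝ) (v : Fin 2 → ℂ) :
    jostKernel f k x y v 1 =
      Complex.exp (2 * Complex.I * clampIm k * ((xhat f x - xhat f y : ℝ) : ℂ)) *
        (-uhatCoeff f y * v 0) := by
  simp [jostKernel, matUnit_apply]
  ring

/-- The Volterra integral equation for the first column of `Φ₋`, written in components. -/
structure JostEq (f : ℝ → ℝ) (k : ℂ) (v : ℝ → Fin 2 → ℂ) : Prop where
  zero : ∀ x, v x 0 = 1 + ∫ y in Set.Iic x, uhatCoeff f y * v y 1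
  one : ∀ x, v x 1 = ∫ y in Set.Iic x,
    Complex.exp (2 * Complex.I * k * ((xhat f x - xhat f y : ℝ) : ℂ)) * (-uhatCoeff f y * v y 0)

theorem conjFactor_self (f : ℝ → ℝ) (k : ℂ) (i : Fin 2) (x y : ℝ) : conjFactor f k i i x y = 1 := by
  simp [conjFactor]

theorem conjFactor_one_zero (f : ℝ → ℝ) (k : ℂ) (x y : ℝ) : conjFactor f k 1 0 x y =
    Complex.exp (2 * Complex.I * k * ((xhat f x - xhat f y : ℝ) : ℂ)) := by
  rw [conjFactor]
  congr 1
  simp only [sigma3, one_ne_zero, if_false, if_true]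
  push_cast
  ring

theorem conjFactor_zero_one (f : ℝ → ℝ) (k : ℂ) (x y : ℝ) : conjFactor f k 0 1 x y =
    Complex.exp (2 * Complex.I * k * ((xhat f y - xhat f x : ℝ) : ℂ)) := by
  rw [conjFactor]
  congr 1
  simp only [sigma3, one_ne_zero, if_false, if_true]
  push_cast
  ring

theorem Uhat_mulVec_zero (f : ℝ → ℝ) (y : ℝ) (v : Fin 2 → ℂ) :
    (Uhat f y).mulVec v 0 = uhatCoeff f y * v 1 := by
  simp [Uhat, uhatCoeff, Matrix.mulVec, dotProduct]

theorem Uhat_mulVec_one (f : ℝ → ℝ) (y : ℝ) (v : Fin 2 → ℂ) :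
    (Uhat f y).mulVec v 1 = -uhatCoeff f y * v 0 := by
  simp [Uhat, uhatCoeff, Matrix.mulVec, dotProduct]

/-- The defining equation of the first column of `Φ₋` in components. -/
theorem isJostMinus_zero_iff {f : ℝ → ℝ} {k : ℂ} {v : ℝ → Fin 2 → ℂ} :
    IsJostMinus f 0 k v ↔ Continuous v ∧ (∃ C : ℝ, ∀ x i, ‖v x i‖ ≤ C) ∧ JostEq f k v := by
  have e0 : ∀ x, (∫ y in Set.Iic x, conjFactor f k 0 0 x y * (Uhat f y).mulVec (v y) 0) =
      ∫ y in Set.Iic x, uhatCoeff f y * v y 1 := by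
    intro x
    refine integral_congr_ae (Eventually.of_forall fun y => ?_)
    simp only [conjFactor_self, Uhat_mulVec_zero, one_mul]
  have e1 : ∀ x, (∫ y in Set.Iic x, conjFactor f k 1 0 x y * (Uhat f y).mulVec (v y) 1) =
      ∫ y in Set.Iic x, Complex.exp (2 * Complex.I * k * ((xhat f x - xhat f y : ℝ) : ℂ)) *
        (-uhatCoeff f y * v y 0) := by
    intro x
    refine integral_congr_ae (Eventually.of_forall fun y => ?_)
    simp only [conjFactor_one_zero, Uhat_mulVec_one]
  constructor
  · rintro ⟨h1, h2, h3⟩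
    refine ⟨h1, h2, fun x => ?_, fun x => ?_⟩
    · have := h3 x 0
      rw [e0] at this
      simpa using this
    · have := h3 x 1
      rw [e1] at this
      simpa using this
  · rintro ⟨h1, h2, h3⟩
    refine ⟨h1, h2, fun x i => ?_⟩
    fin_cases i
    · simp only [Fin.zero_eta]
      rw [e0, h3.zero x]
      simp
    · simp only [Fin.mk_one]
      rw [e1, h3.one x]
      simp

namespace IsProfile

variable {f : ℝ → ℝ} (h : IsProfile f)
include h

theorem volterraKernel_jostKernel : VolterraKernel (jostKernel f) (fun y => |uhatCoeff f y|)
    (fun x => ∫ y in Set.Iic x, |uhatCoeff f y|) where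
  weight := VolterraWeight.of_continuous h.continuous_uhatCoeff.abs h.integrable_uhatCoeff.abs
    fun x => abs_nonneg _
  meas k x := by
    have := h.continuous_uhatCoeff
    have := h.continuous_xhat
    refine Continuous.aestronglyMeasurable ?_
    unfold jostKernel
    fun_prop
  cont y := by
    have := h.continuous_xhat
    have := continuous_clampIm
    unfold jostKernel
    fun_prop
  bound k x y hxy := by
    have he := norm_exp_two_I_mul_le (clampIm_im k) (sub_nonneg.2 (h.strictMono_xhat.monotone hxy))
    refine ContinuousLinearMap.opNorm_le_bound _ (abs_nonneg _) fun v => ?_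
    refine (pi_norm_le_iff_of_nonneg (by positivity)).2 fun i => ?_
    fin_cases i
    · simp only [Fin.zero_eta]
      rw [jostKernel_apply_zero, norm_mul, Complex.norm_real, Real.norm_eq_abs]
      gcongr
      exact norm_le_pi_norm v 1
    · simp only [Fin.mk_one]
      rw [jostKernel_apply_one, norm_mul, norm_mul, norm_neg, Complex.norm_real, Real.norm_eq_abs]
      refine (mul_le_of_le_one_left (by positivity) he).trans ?_
      gcongr
      exact norm_le_pi_norm v 0

/-- The vector form of the Volterra equation. -/
theorem jostEq_iff {k : ℂ} (hk : 0 ≤ k.im) {v : ℝ → Fin 2 → ℂ} (hv : Continuous v)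
    (hb : ∀ X, ∃ D, ∀ x ≤ X, ‖v x‖ ≤ D) :
    JostEq f k v ↔ ∀ x, v x = Pi.single 0 1 + ∫ y in Set.Iic x, jostKernel f k x y (v y) := by
  have hK := h.volterraKernel_jostKernel
  have hint : ∀ x, IntegrableOn (fun y => jostKernel f k x y (v y)) (Set.Iic x) := by
    intro x
    obtain ⟨D, hD⟩ := hb x
    refine (hK.weight.integrable.mul_const D).integrableOn.mono'
      (hK.aestronglyMeasurable_apply hv k x).restrict ?_
    filter_upwards [ae_restrict_mem measurableSet_Iic] with y hy
    exact ((jostKernel f k x y).le_opNorm _).trans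
      (mul_le_mul (hK.bound k x y hy) (hD y hy) (norm_nonneg _) (abs_nonneg _))
  have hcomp : ∀ x i, (∫ y in Set.Iic x, jostKernel f k x y (v y)) i =
      ∫ y in Set.Iic x, jostKernel f k x y (v y) i := fun x i =>
    eval_integral (fun i => (hint x).eval i) i
  constructor
  · rintro ⟨h0, h1⟩ x
    ext i
    rw [Pi.add_apply, hcomp]
    fin_cases i
    · simp only [Fin.zero_eta, jostKernel_apply_zero]
      rw [h0]
      simp
    · simp only [Fin.mk_one, jostKernel_apply_one, clampIm_of_nonneg hk]
      rw [h1]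
      simp
  · intro hx
    constructor
    · intro x
      have := congrFun (hx x) 0
      rw [Pi.add_apply, hcomp] at this
      simpa only [jostKernel_apply_zero, Pi.single_eq_same] using this
    · intro x
      have := congrFun (hx x) 1
      rw [Pi.add_apply, hcomp] at this
      simpa [jostKernel_apply_one, clampIm_of_nonneg hk] using this

/-- Uniqueness holds among functions bounded near `-∞` only, by Grönwall's inequality. -/
theorem jostEq_unique {k : ℂ} (hk : 0 ≤ k.im) {u v : ℝ → Fin 2 → ℂ} (hu : Continuous u)
    (hv : Continuous v) (hub : ∀ X, ∃ D, ∀ x ≤ X, ‖u x‖ ≤ D) (hvb : ∀ X, ∃ D, ∀ x ≤ X, ‖v x‖ ≤ D)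
    (h1 : JostEq f k u) (h2 : JostEq f k v) : u = v := by
  have hK := h.volterraKernel_jostKernel
  rw [h.jostEq_iff hk hu hub] at h1
  rw [h.jostEq_iff hk hv hvb] at h2
  have hint : ∀ {w : ℝ → Fin 2 → ℂ}, Continuous w → (∀ X, ∃ D, ∀ x ≤ X, ‖w x‖ ≤ D) → ∀ x,
      IntegrableOn (fun y => jostKernel f k x y (w y)) (Set.Iic x) := by
    intro w hw hb x
    obtain ⟨D, hD⟩ := hb x
    refine (hK.weight.integrable.mul_const D).integrableOn.mono'
      (hK.aestronglyMeasurable_apply hw k x).restrict ?_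
    filter_upwards [ae_restrict_mem measurableSet_Iic] with y hy
    exact ((jostKernel f k x y).le_opNorm _).trans
      (mul_le_mul (hK.bound k x y hy) (hD y hy) (norm_nonneg _) (abs_nonneg _))
  ext1 X
  obtain ⟨D1, hD1⟩ := hub X
  obtain ⟨D2, hD2⟩ := hvb X
  have := hK.weight.gronwall (φ := fun x => ‖u x - v x‖) (X := X) (D := D1 + D2) (ε := 0)
    (fun _ _ => norm_nonneg _)
    (fun x hx => (norm_sub_le _ _).trans (add_le_add (hD1 x hx) (hD2 x hx))) le_rfl
    (fun x hx => by
      rw [zero_add, h1 x, h2 x, add_sub_add_left_eq_sub, ← integral_sub (hint hu hub x) (hint hv hvb x)]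
      have hb := (hint hu hub x).sub (hint hv hvb x)
      refine norm_integral_le_of_norm_le ((hK.weight.integrable.mul_const (D1 + D2)).integrableOn.mono'
        ((hK.weight.integrable.aestronglyMeasurable.mul
          (hu.sub hv).norm.aestronglyMeasurable).restrict) ?_) ?_
      · filter_upwards [ae_restrict_mem measurableSet_Iic] with y hy
        rw [Real.norm_of_nonneg (by positivity)]
        have hyX : y ≤ X := le_trans hy hx
        gcongr
        exact (norm_sub_le _ _).trans (add_le_add (hD1 y hyX) (hD2 y hyX))
      · filter_upwards [ae_restrict_mem measurableSet_Iic] with y hy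
        rw [← map_sub]
        exact ((jostKernel f k x y).le_opNorm _).trans
          (mul_le_mul_of_nonneg_right (hK.bound k x y hy) (norm_nonneg _))) X le_rfl
  rw [zero_mul] at this
  exact sub_eq_zero.1 (norm_le_zero_iff.1 this)

/-- The Neumann series is the first column of `Φ₋`. -/
theorem isJostMinus_volterraSol {k : ℂ} (hk : 0 ≤ k.im) :
    IsJostMinus f 0 k (volterraSol (jostKernel f) (fun _ => Pi.single 0 1) k) := by
  have hK := h.volterraKernel_jostKernel
  obtain ⟨B, hB⟩ := hK.weight.W_bounded
  have hv₀ : Continuous fun _ : ℂ => (Pi.single 0 1 : Fin 2 → ℂ) := continuous_const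
  have hc : Continuous (volterraSol (jostKernel f) (fun _ => Pi.single 0 1) k) :=
    (hK.continuous_volterraSol hv₀).comp (Continuous.prodMk_right k)
  have hb := hK.norm_volterraSol_le hv₀ hB k
  exact isJostMinus_zero_iff.2 ⟨hc, ⟨_, fun x i => (norm_le_pi_norm _ i).trans (hb x)⟩,
    (h.jostEq_iff hk hc fun X => ⟨_, fun x _ => hb x⟩).2 (hK.volterraSol_eq hv₀ k)⟩

theorem isJostMinus_jostMinus {k : ℂ} (hk : 0 ≤ k.im) : IsJostMinus f 0 k (jostMinus f 0 k) :=
  Classical.epsilon_spec ⟨_, h.isJostMinus_volterraSol hk⟩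

omit h in
theorem _root_.ShortPulse.IsJostMinus.locally_bounded {j : Fin 2} {k : ℂ} {v : ℝ → Fin 2 → ℂ}
    (hv : IsJostMinus f j k v) (X : ℝ) : ∃ D, ∀ x ≤ X, ‖v x‖ ≤ D := by
  obtain ⟨C, hC⟩ := hv.bounded
  exact ⟨C, fun x _ => (pi_norm_le_iff_of_nonneg ((norm_nonneg _).trans (hC 0 0))).2 (hC x)⟩

theorem isJostMinus_unique {k : ℂ} (hk : 0 ≤ k.im) {u v : ℝ → Fin 2 → ℂ}
    (hu : IsJostMinus f 0 k u) (hv : IsJostMinus f 0 k v) : u = v := by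
  exact h.jostEq_unique hk hu.continuous hv.continuous hu.locally_bounded hv.locally_bounded
    (isJostMinus_zero_iff.1 hu).2.2 (isJostMinus_zero_iff.1 hv).2.2

theorem jostMinus_eq_volterraSol {k : ℂ} (hk : 0 ≤ k.im) :
    jostMinus f 0 k = volterraSol (jostKernel f) (fun _ => Pi.single 0 1) k :=
  h.isJostMinus_unique hk (h.isJostMinus_jostMinus hk) (h.isJostMinus_volterraSol hk)

/-- The first column of `Φ₋` is bounded uniformly in the spectral parameter. -/
theorem exists_norm_jostMinus_le : ∃ C, 0 ≤ C ∧ ∀ k : ℂ, 0 ≤ k.im → ∀ x i,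
    ‖jostMinus f 0 k x i‖ ≤ C := by
  have hK := h.volterraKernel_jostKernel
  obtain ⟨B, hB⟩ := hK.weight.W_bounded
  have hv₀ : Continuous fun _ : ℂ => (Pi.single 0 1 : Fin 2 → ℂ) := continuous_const
  refine ⟨‖(Pi.single 0 1 : Fin 2 → ℂ)‖ * Real.exp B, by positivity, fun k hk x i => ?_⟩
  rw [h.jostMinus_eq_volterraSol hk]
  exact (norm_le_pi_norm _ i).trans (hK.norm_volterraSol_le hv₀ hB k x)

theorem continuousOn_jostMinus (x : ℝ) (i : Fin 2) :
    ContinuousOn (fun k => jostMinus f 0 k x i) {k : ℂ | 0 ≤ k.im} := by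
  have hK := h.volterraKernel_jostKernel
  have hv₀ : Continuous fun _ : ℂ => (Pi.single 0 1 : Fin 2 → ℂ) := continuous_const
  have hc : Continuous fun k : ℂ => volterraSol (jostKernel f) (fun _ => Pi.single 0 1) k x i :=
    (continuous_apply i).comp ((hK.continuous_volterraSol hv₀).comp (Continuous.prodMk_left x))
  exact hc.continuousOn.congr fun k hk => by rw [h.jostMinus_eq_volterraSol hk]

theorem differentiableOn_jostMinus (x : ℝ) (i : Fin 2) :
    DifferentiableOn ℂ (fun k => jostMinus f 0 k x i) {k : ℂ | 0 < k.im} := by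
  have hK := h.volterraKernel_jostKernel
  have hU : IsOpen {k : ℂ | 0 < k.im} := isOpen_lt continuous_const Complex.continuous_im
  have hd := hK.differentiableOn_volterraSol (v := Pi.single 0 1) hU (fun x y => by
    have : DifferentiableOn ℂ (fun k : ℂ => (uhatCoeff f y : ℂ) • (matUnit 0 1 -
      Complex.exp (2 * Complex.I * k * ((xhat f x - xhat f y : ℝ) : ℂ)) • matUnit 1 0))
      {k : ℂ | 0 < k.im} := by fun_prop
    refine this.congr fun k hk => ?_
    rw [jostKernel, clampIm_of_nonneg (le_of_lt hk)]) x
  refine ((differentiableOn_pi.1 hd) i).congr fun k hk => ?_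
  rw [h.jostMinus_eq_volterraSol (le_of_lt hk)]

/-- The first column of `Φ₋` solves `v₀' = c v₁`, `v₁' = -c v₀ + 2 i k q v₁`, where `c` is
`uhatCoeff`, with limits `(1, 0)` at `-∞`. -/
theorem jostMinus_ode {k : ℂ} (hk : 0 ≤ k.im) :
    (∀ x, HasDerivAt (fun x => jostMinus f 0 k x 0) (uhatCoeff f x * jostMinus f 0 k x 1) x) ∧
    (∀ x, HasDerivAt (fun x => jostMinus f 0 k x 1) (-uhatCoeff f x * jostMinus f 0 k x 0 +
      2 * Complex.I * k * q f x * jostMinus f 0 k x 1) x) ∧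
    Tendsto (fun x => jostMinus f 0 k x 0) atBot (𝓝 1) ∧
    Tendsto (fun x => jostMinus f 0 k x 1) atBot (𝓝 0) := by
  obtain ⟨hc, ⟨C, hC⟩, he⟩ := isJostMinus_zero_iff.1 (h.isJostMinus_jostMinus hk)
  have hw : Integrable fun x => (uhatCoeff f x : ℂ) := h.integrable_uhatCoeff.ofReal
  have hwc : Continuous fun x => (uhatCoeff f x : ℂ) :=
    Complex.continuous_ofReal.comp h.continuous_uhatCoeff
  exact hasDerivAt_of_volterra hw hwc hw.neg hwc.neg h.hasDerivAt_xhat h.strictMono_xhat.monotone hk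
    ((continuous_apply 0).comp hc) ((continuous_apply 1).comp hc) (fun x => hC x 0)
    (fun x => hC x 1) he.zero he.one

/-- The first column of `Φ₋` is characterized by its differential equation and its limit at
`-∞`. -/
theorem eq_jostMinus_of_ode {k : ℂ} (hk : 0 ≤ k.im) {v : ℝ → Fin 2 → ℂ}
    (h0 : ∀ x, HasDerivAt (fun x => v x 0) (uhatCoeff f x * v x 1) x)
    (h1 : ∀ x, HasDerivAt (fun x => v x 1) (-uhatCoeff f x * v x 0 +
      2 * Complex.I * k * q f x * v x 1) x)
    (l0 : Tendsto (fun x => v x 0) atBot (𝓝 1)) (l1 : Tendsto (fun x => v x 1) atBot (𝓝 0)) :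
    v = jostMinus f 0 k := by
  have hw : Integrable fun x => (uhatCoeff f x : ℂ) := h.integrable_uhatCoeff.ofReal
  have hwc : Continuous fun x => (uhatCoeff f x : ℂ) :=
    Complex.continuous_ofReal.comp h.continuous_uhatCoeff
  have he := volterra_of_ode hw hwc hw.neg hwc.neg h.hasDerivAt_xhat h.strictMono_xhat.monotone hk
    h0 h1 l0 l1
  have hc : Continuous v := continuous_pi fun i => by
    fin_cases i
    · exact continuous_iff_continuousAt.2 fun x => (h0 x).continuousAt
    · exact continuous_iff_continuousAt.2 fun x => (h1 x).continuousAt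
  have hl : Tendsto v atBot (𝓝 ![1, 0]) := tendsto_pi_nhds.2 fun i => by
    fin_cases i
    · simpa using l0
    · simpa using l1
  have hJ := h.isJostMinus_jostMinus hk
  exact h.jostEq_unique hk hc hJ.continuous (exists_norm_le_of_tendsto_atBot hc hl)
    hJ.locally_bounded ⟨fun x => (he x).1, fun x => (he x).2⟩ (isJostMinus_zero_iff.1 hJ).2.2

end IsProfile
end ShortPulse

/-! ### Jost columns for large and for small spectral parameters -/

namespace ShortPulse

namespace IsProfile

variable {f : ℝ → ℝ} (h : IsProfile f)
include h

/-- Integration by parts against a smooth approximation `g` of the coefficient: the integral of an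
oscillating solution is small for large `k`. -/
theorem norm_integral_oscillating_le {φ ψ : ℝ → ℂ} {k s : ℂ} {g : ℝ → ℝ} {K x : ℝ}
    (hk : k ≠ 0) (hs : ‖s‖ = 1) (hg : ContDiff ℝ 1 g) (hgs : HasCompactSupport g)
    (hφ : ∀ y, HasDerivAt φ (uhatCoeff f y * ψ y + 2 * Complex.I * k * s * q f y * φ y) y)
    (hψ : Continuous ψ) (hφK : ∀ y ≤ x, ‖φ y‖ ≤ K) (hψK : ∀ y ≤ x, ‖ψ y‖ ≤ K) :
    ‖∫ y in Set.Iic x, uhatCoeff f y * φ y‖ ≤ K * (∫ y, |uhatCoeff f y - g y * q f y|) +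
      K * (|g x| + ∫ y, (|deriv g y| + |g y * uhatCoeff f y|)) / (2 * ‖k‖) := by
  have hφc : Continuous φ := continuous_iff_continuousAt.2 fun x => (hφ x).continuousAt
  have hK : 0 ≤ K := (norm_nonneg _).trans (hφK x le_rfl)
  have hgc := hg.continuous
  have hqc := h.continuous_q
  have hwc := h.continuous_uhatCoeff
  have hg'c : Continuous (deriv g) := hg.continuous_deriv le_rfl
  have hgd : ∀ y, HasDerivAt g (deriv g y) y := fun y =>
    (hg.differentiable one_ne_zero y).hasDerivAt
  have igq : Integrable fun y => g y * q f y :=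
    (hgc.mul hqc).integrable_of_hasCompactSupport hgs.mul_right
  have igw : Integrable fun y => g y * uhatCoeff f y :=
    (hgc.mul hwc).integrable_of_hasCompactSupport hgs.mul_right
  have ig' : Integrable (deriv g) := hg'c.integrable_of_hasCompactSupport hgs.deriv
  have cast : ∀ {r : ℝ → ℝ}, Continuous r → Continuous fun y => (r y : ℂ) := fun hr =>
    Complex.continuous_ofReal.comp hr
  have i1 : IntegrableOn (fun y => ((uhatCoeff f y - g y * q f y : ℝ) : ℂ) * φ y) (Set.Iic x) :=
    integrableOn_Iic_mul_of_bound (h.integrable_uhatCoeff.sub igq).ofReal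
      (cast (hwc.sub (hgc.mul hqc))) hφc hφK
  have i2 : IntegrableOn (fun y => ((g y * q f y : ℝ) : ℂ) * φ y) (Set.Iic x) :=
    integrableOn_Iic_mul_of_bound igq.ofReal (cast (hgc.mul hqc)) hφc hφK
  have i3 : IntegrableOn (fun y => ((deriv g y : ℝ) : ℂ) * φ y) (Set.Iic x) :=
    integrableOn_Iic_mul_of_bound ig'.ofReal (cast hg'c) hφc hφK
  have i4 : IntegrableOn (fun y => ((g y * uhatCoeff f y : ℝ) : ℂ) * ψ y) (Set.Iic x) :=
    integrableOn_Iic_mul_of_bound igw.ofReal (cast (hgc.mul hwc)) hψ hψK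
  have i34 : IntegrableOn (fun y => ((deriv g y : ℝ) : ℂ) * φ y +
      ((g y * uhatCoeff f y : ℝ) : ℂ) * ψ y) (Set.Iic x) := i3.add i4
  -- The derivative of `g φ` contains `2 i k s g q φ`, which expresses the main part of the integral
  -- by terms with a factor `1 / k`.
  have hFTC := integral_Iic_of_hasDerivAt_of_tendsto' (a := x) (m := 0)
    (f := fun y => (g y : ℂ) * φ y)
    (f' := fun y => (((deriv g y : ℝ) : ℂ) * φ y + ((g y * uhatCoeff f y : ℝ) : ℂ) * ψ y) +
      2 * Complex.I * k * s * (((g y * q f y : ℝ) : ℂ) * φ y))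
    (fun y _ => (((hgd y).ofReal_comp).mul (hφ y)).congr_deriv (by push_cast; ring))
    (i34.add (i2.const_mul _)) (by
      refine tendsto_const_nhds.congr' ?_
      filter_upwards [(atBot_le_cocompact : (atBot : Filter ℝ) ≤ cocompact ℝ)
        (hgs.isCompact.compl_mem_cocompact)] with y hy
      rw [image_eq_zero_of_notMem_tsupport hy, Complex.ofReal_zero, zero_mul])
  rw [sub_zero, integral_add i34 (i2.const_mul _), integral_const_mul] at hFTC
  have hsplit : ∫ y in Set.Iic x, uhatCoeff f y * φ y =
      (∫ y in Set.Iic x, ((uhatCoeff f y - g y * q f y : ℝ) : ℂ) * φ y) +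
      ∫ y in Set.Iic x, ((g y * q f y : ℝ) : ℂ) * φ y := by
    rw [← integral_add i1 i2]
    refine integral_congr_ae (Eventually.of_forall fun y => ?_)
    push_cast
    ring
  have b1 : ‖∫ y in Set.Iic x, ((uhatCoeff f y - g y * q f y : ℝ) : ℂ) * φ y‖ ≤
      K * (∫ y, |uhatCoeff f y - g y * q f y|) := by
    have hi := (h.integrable_uhatCoeff.sub igq).abs.const_mul K
    refine (norm_integral_le_of_norm_le (g := fun y => K * |uhatCoeff f y - g y * q f y|)
      hi.integrableOn ?_).trans ?_
    · filter_upwards [ae_restrict_mem measurableSet_Iic] with y hy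
      rw [norm_mul, Complex.norm_real, Real.norm_eq_abs, mul_comm]
      exact mul_le_mul_of_nonneg_right (hφK y hy) (abs_nonneg _)
    · rw [← integral_const_mul]
      exact setIntegral_le_integral hi (Eventually.of_forall fun y => by positivity)
  have b2 : ‖∫ y in Set.Iic x, (((deriv g y : ℝ) : ℂ) * φ y +
      ((g y * uhatCoeff f y : ℝ) : ℂ) * ψ y)‖ ≤
      K * ∫ y, (|deriv g y| + |g y * uhatCoeff f y|) := by
    have hi := (ig'.abs.add igw.abs).const_mul K
    refine (norm_integral_le_of_norm_le (g := fun y => K * (|deriv g y| + |g y * uhatCoeff f y|))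
      hi.integrableOn ?_).trans ?_
    · filter_upwards [ae_restrict_mem measurableSet_Iic] with y hy
      refine (norm_add_le _ _).trans ?_
      rw [norm_mul, norm_mul, Complex.norm_real, Complex.norm_real, Real.norm_eq_abs,
        Real.norm_eq_abs, mul_add, mul_comm K, mul_comm K]
      exact add_le_add (mul_le_mul_of_nonneg_left (hφK y hy) (abs_nonneg _))
        (mul_le_mul_of_nonneg_left (hψK y hy) (abs_nonneg _))
    · rw [← integral_const_mul]
      exact setIntegral_le_integral hi (Eventually.of_forall fun y => by positivity)
  have b3 : ‖∫ y in Set.Iic x, ((g y * q f y : ℝ) : ℂ) * φ y‖ ≤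
      K * (|g x| + ∫ y, (|deriv g y| + |g y * uhatCoeff f y|)) / (2 * ‖k‖) := by
    have hk' : 0 < 2 * ‖k‖ := by positivity
    rw [le_div_iff₀ hk']
    have e1 : ‖∫ y in Set.Iic x, ((g y * q f y : ℝ) : ℂ) * φ y‖ * (2 * ‖k‖) =
        ‖(g x : ℂ) * φ x - ∫ y in Set.Iic x, (((deriv g y : ℝ) : ℂ) * φ y +
          ((g y * uhatCoeff f y : ℝ) : ℂ) * ψ y)‖ := by
      rw [← hFTC, add_sub_cancel_left]
      simp [hs]
      ring
    rw [e1]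
    refine (norm_sub_le _ _).trans ?_
    rw [mul_add]
    refine add_le_add ?_ b2
    rw [norm_mul, Complex.norm_real, Real.norm_eq_abs, mul_comm]
    exact mul_le_mul_of_nonneg_right (hφK x le_rfl) (abs_nonneg _)
  rw [hsplit]
  exact (norm_add_le _ _).trans (add_le_add b1 b3)

/-- The coefficient is integrable but need not be differentiable; it is approximated in `L¹` by
`g q` with a test function `g`, the factor `q` being the derivative of the phase `x̂`. -/
theorem exists_smooth_approx {ε : ℝ} (hε : 0 < ε) : ∃ g : ℝ → ℝ, ContDiff ℝ 1 g ∧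
    HasCompactSupport g ∧ ∫ y, |uhatCoeff f y - g y * q f y| ≤ ε := by
  obtain ⟨Q, hQ⟩ := h.exists_q_le
  have hQ0 : 0 < Q := lt_of_lt_of_le (q_pos f 0) (hQ 0)
  have hc : Continuous fun y => uhatCoeff f y / q f y :=
    h.continuous_uhatCoeff.div h.continuous_q fun y => (q_pos f y).ne'
  have hi : Integrable fun y => uhatCoeff f y / q f y := by
    refine h.integrable_uhatCoeff.norm.mono' hc.aestronglyMeasurable ?_
    filter_upwards with y
    rw [norm_div, Real.norm_of_nonneg (q_pos f y).le]
    exact div_le_self (norm_nonneg _) (one_le_q f y)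
  obtain ⟨g, hg1, hg2, hg3⟩ := (memLp_one_iff_integrable.2 hi).exist_eLpNorm_sub_le
    ENNReal.one_ne_top le_rfl (ε := ε / Q) (by positivity)
  refine ⟨g, hg2.of_le (by exact_mod_cast le_top), hg1, ?_⟩
  have ig : Integrable g := hg2.continuous.integrable_of_hasCompactSupport hg1
  have h1 : ∫ y, |uhatCoeff f y / q f y - g y| ≤ ε / Q := by
    rw [eLpNorm_one_eq_lintegral_enorm] at hg3
    have h2 := integral_norm_eq_lintegral_enorm (hi.sub ig).aestronglyMeasurable
    change ∫ y, ‖((fun y => uhatCoeff f y / q f y) - g) y‖ ≤ ε / Q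
    rw [h2]
    exact ENNReal.toReal_le_of_le_ofReal (by positivity) hg3
  have h3 : ∫ y, |uhatCoeff f y - g y * q f y| ≤ ∫ y, Q * |uhatCoeff f y / q f y - g y| := by
    refine integral_mono_of_nonneg (Eventually.of_forall fun y => abs_nonneg _)
      ((hi.sub ig).abs.const_mul Q) (Eventually.of_forall fun y => ?_)
    have e : uhatCoeff f y - g y * q f y = q f y * (uhatCoeff f y / q f y - g y) := by
      have := (q_pos f y).ne'
      field_simp
    simp only
    rw [e, abs_mul, abs_of_pos (q_pos f y)]
    exact mul_le_mul_of_nonneg_right (hQ y) (abs_nonneg _)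
  rw [integral_const_mul] at h3
  calc _ ≤ Q * (ε / Q) := h3.trans (mul_le_mul_of_nonneg_left h1 hQ0.le)
    _ = ε := by field_simp

/-- The first column of `Φ₋` tends to the first basis vector as `k → ∞` in the closed upper
half-plane. -/
theorem tendsto_jostMinus_cocompact (x : ℝ) :
    Tendsto (fun k => jostMinus f 0 k x 0) (cocompact ℂ ⊓ 𝓟 {k : ℂ | 0 ≤ k.im}) (𝓝 1) ∧
    Tendsto (fun k => jostMinus f 0 k x 1) (cocompact ℂ ⊓ 𝓟 {k : ℂ | 0 ≤ k.im}) (𝓝 0) := by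
  obtain ⟨K, hK0, hK⟩ := h.exists_norm_jostMinus_le
  have key : ∀ ε > 0, ∃ R : ℝ, ∀ k : ℂ, 0 ≤ k.im → R ≤ ‖k‖ →
      ‖jostMinus f 0 k x 0 - 1‖ < ε ∧ ‖jostMinus f 0 k x 1‖ < ε := by
    intro ε hε
    obtain ⟨g, hg, hgs, hge⟩ := h.exists_smooth_approx (ε := ε / (4 * (K + 1))) (by positivity)
    set C := K * (|g x| + ∫ y, (|deriv g y| + |g y * uhatCoeff f y|)) with hC
    have hC0 : 0 ≤ C := by
      have : 0 ≤ ∫ y, (|deriv g y| + |g y * uhatCoeff f y|) := integral_nonneg fun y => by positivity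
      positivity
    refine ⟨C / ε + 1, fun k hk hkR => ?_⟩
    have hkp : 0 < ‖k‖ := lt_of_lt_of_le (by positivity) hkR
    have hk0 : k ≠ 0 := norm_pos_iff.1 hkp
    obtain ⟨d0, d1, l0, l1⟩ := h.jostMinus_ode hk
    have hc0 : Continuous fun x => jostMinus f 0 k x 0 :=
      continuous_iff_continuousAt.2 fun x => (d0 x).continuousAt
    have hc1 : Continuous fun x => jostMinus f 0 k x 1 :=
      continuous_iff_continuousAt.2 fun x => (d1 x).continuousAt
    have he := (isJostMinus_zero_iff.1 (h.isJostMinus_jostMinus hk)).2.2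
    have hbound : K * (∫ y, |uhatCoeff f y - g y * q f y|) + C / (2 * ‖k‖) < ε := by
      have e1 : K * (∫ y, |uhatCoeff f y - g y * q f y|) ≤ ε / 4 := by
        refine (mul_le_mul_of_nonneg_left hge hK0).trans ?_
        rw [mul_div_assoc', div_le_div_iff₀ (by positivity) (by positivity)]
        nlinarith
      have e3 : C / (2 * ‖k‖) ≤ ε / 2 := by
        rw [div_le_div_iff₀ (by positivity) (by positivity)]
        have : C + ε ≤ ε * ‖k‖ := by
          calc C + ε = ε * (C / ε + 1) := by field_simp
            _ ≤ _ := mul_le_mul_of_nonneg_left hkR hε.le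
        nlinarith
      linarith
    constructor
    · rw [he.zero x, add_sub_cancel_left]
      refine lt_of_le_of_lt ?_ hbound
      exact h.norm_integral_oscillating_le (s := 1) (ψ := fun y => -jostMinus f 0 k y 0) hk0 (by simp)
        hg hgs (fun y => (d1 y).congr_deriv (by ring)) hc0.neg (fun y _ => hK k hk y 1)
        fun y _ => by rw [norm_neg]; exact hK k hk y 0
    · rw [he.one x]
      have e1 : ∫ y in Set.Iic x, Complex.exp (2 * Complex.I * k * ((xhat f x - xhat f y : ℝ) : ℂ)) *
          (-uhatCoeff f y * jostMinus f 0 k y 0) = -∫ y in Set.Iic x, uhatCoeff f y *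
          (Complex.exp (2 * Complex.I * k * ((xhat f x - xhat f y : ℝ) : ℂ)) *
            jostMinus f 0 k y 0) := by
        rw [← integral_neg]
        refine integral_congr_ae (Eventually.of_forall fun y => ?_)
        ring
      rw [e1, norm_neg]
      refine lt_of_le_of_lt ?_ hbound
      have hxc := h.continuous_xhat
      have hexp : ∀ y ≤ x, ‖Complex.exp (2 * Complex.I * k * ((xhat f x - xhat f y : ℝ) : ℂ))‖ ≤ 1 :=
        fun y hy => norm_exp_two_I_mul_le hk (sub_nonneg.2 (h.strictMono_xhat.monotone hy))
      refine h.norm_integral_oscillating_le (s := -1)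
        (ψ := fun y => Complex.exp (2 * Complex.I * k * ((xhat f x - xhat f y : ℝ) : ℂ)) *
          jostMinus f 0 k y 1) hk0 (by simp) hg hgs (fun y => ?_) (by fun_prop) (fun y hy => ?_)
        (fun y hy => ?_)
      · have e2 : HasDerivAt (fun y => ((xhat f x - xhat f y : ℝ) : ℂ)) ((-q f y : ℝ) : ℂ) y :=
          ((h.hasDerivAt_xhat y).const_sub (xhat f x)).ofReal_comp
        refine (((e2.const_mul (2 * Complex.I * k)).cexp).mul (d0 y)).congr_deriv ?_
        push_cast
        ring
      · rw [norm_mul]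
        exact (mul_le_of_le_one_left (norm_nonneg _) (hexp y hy)).trans (hK k hk y 0)
      · rw [norm_mul]
        exact (mul_le_of_le_one_left (norm_nonneg _) (hexp y hy)).trans (hK k hk y 1)
  have hev : ∀ R : ℝ, ∀ᶠ k in cocompact ℂ ⊓ 𝓟 {k : ℂ | 0 ≤ k.im}, 0 ≤ k.im ∧ R ≤ ‖k‖ := by
    intro R
    rw [eventually_inf_principal]
    filter_upwards [(tendsto_norm_cocompact_atTop (E := ℂ)).eventually_ge_atTop R] with k hk hk'
    exact ⟨hk', hk⟩
  constructor
  · rw [Metric.tendsto_nhds]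
    intro ε hε
    obtain ⟨R, hR⟩ := key ε hε
    filter_upwards [hev R] with k hk
    rw [dist_eq_norm]
    exact (hR k hk.1 hk.2).1
  · rw [Metric.tendsto_nhds]
    intro ε hε
    obtain ⟨R, hR⟩ := key ε hε
    filter_upwards [hev R] with k hk
    rw [dist_zero_right]
    exact (hR k hk.1 hk.2).2


omit h in
theorem norm_exp_neg_I_mul_le {k : ℂ} {s c : ℝ} (hs : 0 ≤ s) (hsc : s ≤ c) (hk : ‖k‖ ≤ 1) :
    ‖Complex.exp (-(Complex.I * k * s))‖ ≤ Real.exp c := by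
  rw [Complex.norm_exp, Real.exp_le_exp]
  have h1 : (-(Complex.I * k * s)).re = k.im * s := by simp
  rw [h1]
  have h2 : k.im ≤ 1 := ((le_abs_self _).trans (Complex.abs_im_le_norm k)).trans hk
  nlinarith

/-- The first column of `Φ₋` in the frame that is adapted to `k = 0`: rotating back by the
half-angle and replacing the phase `x̂` by `x` turns the Lax equation into
`φ₀' = -i k f' φ₁`, `φ₁' = 2 i k φ₁ - i k f' φ₀`. -/
noncomputable def zeroFrame (f : ℝ → ℝ) (k : ℂ) (x : ℝ) : Fin 2 → ℂ :=
  ![Complex.exp (-(Complex.I * k * ((xhat f x - x + lengthDefect f : ℝ) : ℂ))) *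
      (halfCos f x * jostMinus f 0 k x 0 - halfSin f x * jostMinus f 0 k x 1),
    Complex.exp (-(Complex.I * k * ((xhat f x - x + lengthDefect f : ℝ) : ℂ))) *
      (halfSin f x * jostMinus f 0 k x 0 + halfCos f x * jostMinus f 0 k x 1)]

/-- The coefficients of the system for `zeroFrame` carry a factor `k`, which makes the expansion
at `k = 0` a single Picard step. -/
theorem zeroFrame_ode {k : ℂ} (hk : 0 ≤ k.im) :
    (∀ x, HasDerivAt (fun x => zeroFrame f k x 0)
      (-(Complex.I * k * deriv f x) * zeroFrame f k x 1) x) ∧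
    (∀ x, HasDerivAt (fun x => zeroFrame f k x 1)
      (-(Complex.I * k * deriv f x) * zeroFrame f k x 0 +
        2 * Complex.I * k * (1 : ℝ) * zeroFrame f k x 1) x) ∧
    Tendsto (fun x => zeroFrame f k x 0) atBot (𝓝 1) ∧
    Tendsto (fun x => zeroFrame f k x 1) atBot (𝓝 0) := by
  obtain ⟨d0, d1, l0, l1⟩ := h.jostMinus_ode hk
  have hE : ∀ x, HasDerivAt
      (fun x => Complex.exp (-(Complex.I * k * ((xhat f x - x + lengthDefect f : ℝ) : ℂ))))
      (Complex.exp (-(Complex.I * k * ((xhat f x - x + lengthDefect f : ℝ) : ℂ))) *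
        (-(Complex.I * k * ((q f x - 1 : ℝ) : ℂ)))) x := fun x => by
    have e : HasDerivAt (fun x => ((xhat f x - x + lengthDefect f : ℝ) : ℂ))
        ((q f x - 1 : ℝ) : ℂ) x :=
      (((h.hasDerivAt_xhat x).sub (hasDerivAt_id x)).add_const _).ofReal_comp
    exact (e.const_mul (Complex.I * k)).neg.cexp
  have hc := fun x => (h.hasDerivAt_halfCos x).ofReal_comp
  have hs := fun x => (h.hasDerivAt_halfSin x).ofReal_comp
  have hElim : Tendsto
      (fun x => Complex.exp (-(Complex.I * k * ((xhat f x - x + lengthDefect f : ℝ) : ℂ))))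
      atBot (𝓝 1) := by
    have hcont : Continuous fun r : ℝ => Complex.exp (-(Complex.I * k * (r : ℂ))) := by fun_prop
    have e := (hcont.tendsto 0).comp
      (by simpa using h.tendsto_xhat_sub_atBot.add_const (lengthDefect f))
    simpa [Function.comp_def] using e
  have hcl : Tendsto (fun x => (halfCos f x : ℂ)) atBot (𝓝 1) := by
    simpa [Function.comp_def] using
      (Complex.continuous_ofReal.tendsto _).comp (tendsto_halfCos h.tendsto_deriv_atBot)
  have hsl : Tendsto (fun x => (halfSin f x : ℂ)) atBot (𝓝 0) := by
    simpa [Function.comp_def] using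
      (Complex.continuous_ofReal.tendsto _).comp (tendsto_halfSin h.tendsto_deriv_atBot)
  refine ⟨fun x => ?_, fun x => ?_, ?_, ?_⟩
  · refine ((hE x).mul (((hc x).mul (d0 x)).sub ((hs x).mul (d1 x)))).congr_deriv ?_
    have e1 := congrArg (fun r : ℝ => (r : ℂ)) (q_mul_halfCos f x)
    have e2 := congrArg (fun r : ℝ => (r : ℂ)) (q_mul_halfSin f x)
    simp only [zeroFrame, Matrix.cons_val_zero, Matrix.cons_val_one, Pi.mul_apply,
      Pi.sub_apply] at e1 e2 ⊢
    push_cast at e1 e2 ⊢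
    linear_combination (-Complex.I * k *
      Complex.exp (-(Complex.I * k * (xhat f x - x + lengthDefect f))) *
      jostMinus f 0 k x 0) * e1 + (-Complex.I * k *
      Complex.exp (-(Complex.I * k * (xhat f x - x + lengthDefect f))) *
      jostMinus f 0 k x 1) * e2
  · refine ((hE x).mul (((hs x).mul (d0 x)).add ((hc x).mul (d1 x)))).congr_deriv ?_
    have e1 := congrArg (fun r : ℝ => (r : ℂ)) (q_mul_halfCos f x)
    have e2 := congrArg (fun r : ℝ => (r : ℂ)) (q_mul_halfSin f x)
    simp only [zeroFrame, Matrix.cons_val_zero, Matrix.cons_val_one, Pi.mul_apply,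
      Pi.add_apply] at e1 e2 ⊢
    push_cast at e1 e2 ⊢
    linear_combination (Complex.I * k *
      Complex.exp (-(Complex.I * k * (xhat f x - x + lengthDefect f))) *
      jostMinus f 0 k x 1) * e1 - (Complex.I * k *
      Complex.exp (-(Complex.I * k * (xhat f x - x + lengthDefect f))) *
      jostMinus f 0 k x 0) * e2
  · simpa [zeroFrame] using hElim.mul ((hcl.mul l0).sub (hsl.mul l1))
  · simpa [zeroFrame] using hElim.mul ((hsl.mul l0).add (hcl.mul l1))

theorem exists_norm_zeroFrame_le : ∃ C, 0 ≤ C ∧ ∀ k : ℂ, 0 ≤ k.im → ‖k‖ ≤ 1 → ∀ x i,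
    ‖zeroFrame f k x i‖ ≤ C := by
  obtain ⟨K, hK0, hK⟩ := h.exists_norm_jostMinus_le
  refine ⟨Real.exp (lengthDefect f) * (K + K), by positivity, fun k hk hk1 x i => ?_⟩
  have hs : xhat f x - x + lengthDefect f = ∫ y in Set.Iic x, (q f y - 1) := by
    rw [h.xhat_eq]; ring
  have hq : ∀ y, 0 ≤ q f y - 1 := fun y => sub_nonneg.2 (one_le_q f y)
  have hE := norm_exp_neg_I_mul_le (k := k) (s := xhat f x - x + lengthDefect f)
    (c := lengthDefect f)
    (by rw [hs]; exact setIntegral_nonneg measurableSet_Iic fun y _ => hq y)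
    (by rw [hs]; exact setIntegral_le_integral h.integrable_q_sub_one (Eventually.of_forall hq)) hk1
  have hc : ‖(halfCos f x : ℂ)‖ ≤ 1 := by
    rw [Complex.norm_real]; exact Real.abs_cos_le_one _
  have hsn : ‖(halfSin f x : ℂ)‖ ≤ 1 := by
    rw [Complex.norm_real]; exact Real.abs_sin_le_one _
  have b : ∀ (r : ℂ) (i : Fin 2), ‖r‖ ≤ 1 → ‖r * jostMinus f 0 k x i‖ ≤ K := fun r i hr => by
    rw [norm_mul]
    exact (mul_le_of_le_one_left (norm_nonneg _) hr).trans (hK k hk x i)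
  fin_cases i
  · simp only [zeroFrame, Fin.zero_eta, Matrix.cons_val_zero]
    rw [norm_mul]
    exact mul_le_mul hE ((norm_sub_le _ _).trans (add_le_add (b _ _ hc) (b _ _ hsn)))
      (norm_nonneg _) (Real.exp_pos _).le
  · simp only [zeroFrame, Fin.mk_one, Matrix.cons_val_one, Matrix.cons_val_fin_one]
    rw [norm_mul]
    exact mul_le_mul hE ((norm_add_le _ _).trans (add_le_add (b _ _ hsn) (b _ _ hc)))
      (norm_nonneg _) (Real.exp_pos _).le

/-- The expansion `φ = (1, -i k f(x)) + o(k)` at `k = 0`. -/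
theorem zeroFrame_hasDerivWithinAt (x : ℝ) :
    zeroFrame f 0 x = ![1, 0] ∧
    HasDerivWithinAt (fun k => zeroFrame f k x 0) 0 {k : ℂ | 0 ≤ k.im} 0 ∧
    HasDerivWithinAt (fun k => zeroFrame f k x 1) (-(Complex.I * f x)) {k : ℂ | 0 ≤ k.im} 0 := by
  obtain ⟨K, hK0, hK⟩ := h.exists_norm_zeroFrame_le
  have hp : Integrable fun x : ℝ => ((deriv f x : ℝ) : ℂ) := h.integrable_deriv.ofReal
  have hpc : Continuous fun x : ℝ => ((deriv f x : ℝ) : ℂ) :=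
    Complex.continuous_ofReal.comp h.continuous_deriv
  have hvol : ∀ k : ℂ, 0 ≤ k.im → ∀ y,
      zeroFrame f k y 0 = 1 - Complex.I * k * ∫ z in Set.Iic y, deriv f z * zeroFrame f k z 1 ∧
      zeroFrame f k y 1 = -(Complex.I * k) * ∫ z in Set.Iic y,
        Complex.exp (2 * Complex.I * k * ((y - z : ℝ) : ℂ)) * (deriv f z * zeroFrame f k z 0) := by
    intro k hk y
    obtain ⟨d0, d1, l0, l1⟩ := h.zeroFrame_ode hk
    have hi : Integrable fun x => -(Complex.I * k * deriv f x) := (hp.const_mul _).neg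
    have hc : Continuous fun x => -(Complex.I * k * deriv f x) := (continuous_const.mul hpc).neg
    have e := volterra_of_ode (h := fun x => x) (h' := fun _ => 1) hi hc hi hc
      hasDerivAt_id' monotone_id hk d0 d1 l0 l1 y
    constructor
    · have e1 : ∫ z in Set.Iic y, -(Complex.I * k * deriv f z) * zeroFrame f k z 1 =
          -(Complex.I * k) * ∫ z in Set.Iic y, deriv f z * zeroFrame f k z 1 := by
        rw [← integral_const_mul]
        exact integral_congr_ae (Eventually.of_forall fun z => by ring)
      rw [e.1, e1]
      ring
    · rw [e.2, ← integral_const_mul]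
      exact integral_congr_ae (Eventually.of_forall fun z => by ring)
  set P : ℝ := ∫ z : ℝ, |deriv f z| with hP
  have hP0 : 0 ≤ P := integral_nonneg fun z => abs_nonneg _
  have hcont : ∀ k : ℂ, 0 ≤ k.im → ∀ i, Continuous fun x => zeroFrame f k x i := by
    intro k hk i
    obtain ⟨d0, d1, l0, l1⟩ := h.zeroFrame_ode hk
    fin_cases i
    · exact continuous_iff_continuousAt.2 fun x => (d0 x).continuousAt
    · exact continuous_iff_continuousAt.2 fun x => (d1 x).continuousAt
  -- The basic estimate: an integral against `f'` of a function bounded by `B`.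
  have hest : ∀ (w : ℝ → ℂ) (B : ℝ) (y : ℝ), (∀ z ≤ y, ‖w z‖ ≤ B) → 0 ≤ B →
      ‖∫ z in Set.Iic y, deriv f z * w z‖ ≤ P * B := by
    intro w B y hw hB
    have hi := h.integrable_deriv.abs.mul_const B
    refine (norm_integral_le_of_norm_le hi.integrableOn ?_).trans
      ((setIntegral_le_integral hi (Eventually.of_forall fun y => by positivity)).trans
        (le_of_eq (integral_mul_const _ _)))
    filter_upwards [ae_restrict_mem measurableSet_Iic] with z hz
    rw [norm_mul, Complex.norm_real, Real.norm_eq_abs]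
    exact mul_le_mul_of_nonneg_left (hw z hz) (abs_nonneg _)
  have hI : ‖Complex.I‖ = 1 := Complex.norm_I
  -- Both components are within `O(k)` of `(1, 0)`, uniformly in the space variable.
  have hb0 : ∀ k : ℂ, 0 ≤ k.im → ‖k‖ ≤ 1 → ∀ y, ‖zeroFrame f k y 0 - 1‖ ≤ ‖k‖ * (P * K) := by
    intro k hk hk1 y
    rw [(hvol k hk y).1, sub_sub_cancel_left, norm_neg, norm_mul, norm_mul, hI, one_mul]
    exact mul_le_mul_of_nonneg_left (hest _ K y (fun z _ => hK k hk hk1 z 1) hK0) (norm_nonneg _)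
  have hb1 : ∀ k : ℂ, 0 ≤ k.im → ‖k‖ ≤ 1 → ∀ y, ‖zeroFrame f k y 1‖ ≤ ‖k‖ * (P * K) := by
    intro k hk hk1 y
    rw [(hvol k hk y).2, norm_mul, norm_neg, norm_mul, hI, one_mul]
    refine mul_le_mul_of_nonneg_left ?_ (norm_nonneg _)
    have e : ∀ z, Complex.exp (2 * Complex.I * k * ((y - z : ℝ) : ℂ)) *
        (deriv f z * zeroFrame f k z 0) = deriv f z *
        (Complex.exp (2 * Complex.I * k * ((y - z : ℝ) : ℂ)) * zeroFrame f k z 0) :=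
      fun z => by ring
    simp_rw [e]
    refine hest _ K y (fun z hz => ?_) hK0
    rw [norm_mul]
    exact (mul_le_of_le_one_left (norm_nonneg _)
      (norm_exp_two_I_mul_le hk (sub_nonneg.2 hz))).trans (hK k hk hk1 z 0)
  have hz0 : zeroFrame f 0 x 0 = 1 := by
    have := hb0 0 (by simp) (by simp) x
    rw [norm_zero, zero_mul] at this
    exact sub_eq_zero.1 (norm_le_zero_iff.1 this)
  have hz1 : zeroFrame f 0 x 1 = 0 := by
    have := hb1 0 (by simp) (by simp) x
    rw [norm_zero, zero_mul] at this
    exact norm_le_zero_iff.1 this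
  have hnear : ∀ᶠ k : ℂ in 𝓝[{k : ℂ | 0 ≤ k.im} \ {0}] 0, (0 ≤ k.im ∧ k ≠ 0) ∧ ‖k‖ ≤ 1 := by
    refine (eventually_mem_nhdsWithin).and (nhdsWithin_le_nhds ?_)
    filter_upwards [Metric.closedBall_mem_nhds (0 : ℂ) one_pos] with k hk
    simpa using hk
  have hknorm : Tendsto (fun k : ℂ => ‖k‖) (𝓝[{k : ℂ | 0 ≤ k.im} \ {0}] 0) (𝓝 0) := by
    have := (continuous_norm (E := ℂ)).tendsto 0
    rw [norm_zero] at this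
    exact this.mono_left nhdsWithin_le_nhds
  refine ⟨?_, ?_, ?_⟩
  · ext i
    fin_cases i
    · simpa using hz0
    · simpa using hz1
  · rw [hasDerivWithinAt_iff_tendsto_slope]
    refine squeeze_zero_norm' (a := fun k => ‖k‖ * (P * (P * K))) ?_
      (by simpa using hknorm.mul_const (P * (P * K)))
    filter_upwards [hnear] with k hk
    rw [slope_def_field, hz0, (hvol k hk.1.1 x).1, sub_zero, sub_sub_cancel_left, norm_div, norm_neg,
      norm_mul, norm_mul, hI, one_mul, mul_div_cancel_left₀ _ (norm_ne_zero_iff.2 hk.1.2)]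
    refine (hest _ (‖k‖ * (P * K)) x (fun z _ => hb1 k hk.1.1 hk.2 z) (by positivity)).trans
      (le_of_eq (by ring))
  · rw [hasDerivWithinAt_iff_tendsto_slope]
    -- The slope of the second component is `-i` times an integral that tends to `∫ f' = f`.
    have hfx : (f x : ℂ) = ∫ z in Set.Iic x, ((deriv f z : ℝ) : ℂ) := by
      rw [integral_complex_ofReal, integral_Iic_of_hasDerivAt_of_tendsto' (fun y _ => h.hasDerivAt y)
        h.integrable_deriv.integrableOn h.tendsto_atBot, sub_zero]
    have hT : Tendsto (fun k : ℂ => ∫ z in Set.Iic x,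
        Complex.exp (2 * Complex.I * k * ((x - z : ℝ) : ℂ)) * (deriv f z * zeroFrame f k z 0))
        (𝓝[{k : ℂ | 0 ≤ k.im} \ {0}] 0) (𝓝 (f x)) := by
      rw [hfx]
      refine tendsto_integral_filter_of_dominated_convergence (fun z => |deriv f z| * K) ?_ ?_
        (h.integrable_deriv.abs.mul_const K).integrableOn ?_
      · filter_upwards [hnear] with k hk
        have := hcont k hk.1.1 0
        exact Continuous.aestronglyMeasurable (by fun_prop)
      · filter_upwards [hnear] with k hk
        filter_upwards [ae_restrict_mem measurableSet_Iic] with z hz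
        rw [norm_mul, norm_mul, Complex.norm_real, Real.norm_eq_abs]
        refine (mul_le_of_le_one_left (by positivity)
          (norm_exp_two_I_mul_le hk.1.1 (sub_nonneg.2 hz))).trans ?_
        exact mul_le_mul_of_nonneg_left (hK k hk.1.1 hk.2 z 0) (abs_nonneg _)
      · filter_upwards with z
        have t1 : Tendsto (fun k : ℂ => Complex.exp (2 * Complex.I * k * ((x - z : ℝ) : ℂ)))
            (𝓝[{k : ℂ | 0 ≤ k.im} \ {0}] 0) (𝓝 1) := by
          have hc : Continuous fun k : ℂ => Complex.exp (2 * Complex.I * k * ((x - z : ℝ) : ℂ)) := by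
            fun_prop
          have := hc.tendsto 0
          rw [mul_zero, zero_mul, Complex.exp_zero] at this
          exact this.mono_left nhdsWithin_le_nhds
        have t2 : Tendsto (fun k : ℂ => zeroFrame f k z 0 - 1)
            (𝓝[{k : ℂ | 0 ≤ k.im} \ {0}] 0) (𝓝 0) := by
          refine squeeze_zero_norm' (a := fun k => ‖k‖ * (P * K)) ?_
            (by simpa using hknorm.mul_const (P * K))
          filter_upwards [hnear] with k hk using hb0 k hk.1.1 hk.2 z
        have t3 := t1.mul ((t2.add_const 1).const_mul ((deriv f z : ℝ) : ℂ))
        simpa using t3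
    refine (hT.const_mul (-Complex.I)).congr' ?_ |>.trans (by rw [neg_mul])
    filter_upwards [hnear] with k hk
    rw [slope_def_field, hz1, (hvol k hk.1.1 x).2]
    have := hk.1.2
    field_simp
    ring

end IsProfile
end ShortPulse

/-! ### The Jost column normalized at plus infinity and the scattering data -/

namespace ShortPulse

/-- The matrix `(a, b; c, d)` acting on `ℂ²`. -/
noncomputable def mat₂ (a b c d : ℂ) : (Fin 2 → ℂ) →L[ℂ] (Fin 2 → ℂ) :=
  a • matUnit 0 0 + b • matUnit 0 1 + c • matUnit 1 0 + d • matUnit 1 1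

theorem mat₂_apply_zero (a b c d : ℂ) (v : Fin 2 → ℂ) : mat₂ a b c d v 0 = a * v 0 + b * v 1 := by
  simp [mat₂, matUnit_apply]

theorem mat₂_apply_one (a b c d : ℂ) (v : Fin 2 → ℂ) : mat₂ a b c d v 1 = c * v 0 + d * v 1 := by
  simp [mat₂, matUnit_apply]

/-- Solutions of a linear differential equation that agree at one point are equal. -/
theorem linearODE_unique {E : Type*} [NormedAddCommGroup E] [NormedSpace ℂ E]
    {A : ℝ → E →L[ℂ] E} (hA : Continuous A) {u v : ℝ → E} (hu : ∀ x, HasDerivAt u (A x (u x)) x)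
    (hv : ∀ x, HasDerivAt v (A x (v x)) x) {x₀ : ℝ} (h : u x₀ = v x₀) : u = v := by
  ext1 x
  obtain ⟨R, h1, h2⟩ : ∃ R : ℝ, x ∈ Set.Ioo (-R) R ∧ x₀ ∈ Set.Ioo (-R) R := by
    refine ⟨max |x| |x₀| + 1, ?_, ?_⟩ <;> rw [Set.mem_Ioo, ← abs_lt]
    · exact lt_of_le_of_lt (le_max_left _ _) (lt_add_one _)
    · exact lt_of_le_of_lt (le_max_right _ _) (lt_add_one _)
  obtain ⟨C, hC⟩ := (isCompact_Icc (a := -R) (b := R)).exists_bound_of_continuousOn hA.continuousOn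
  refine ODE_solution_unique_of_mem_Ioo (v := fun x w => A x w) (s := fun _ => Set.univ)
    (K := Real.toNNReal C) (fun y hy => ?_) h2 (fun y _ => ⟨hu y, trivial⟩)
    (fun y _ => ⟨hv y, trivial⟩) h h1
  refine ((A y).lipschitz.weaken ?_).lipschitzOnWith
  rw [← NNReal.coe_le_coe]
  exact (hC y (Set.Ioo_subset_Icc_self hy)).trans (Real.le_coe_toNNReal C)

/-- The reflection `x ↦ -x` of the profile together with the exchange of the components turns the
equation for the second column of `Φ₊` into the equation for the first column of `Φ₋`. -/
theorem isJostPlus_one_iff {f : ℝ → ℝ} (hf : IsProfile f) {k : ℂ} {v : ℝ → Fin 2 → ℂ} :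
    IsJostPlus f 1 k v ↔ IsJostMinus (fun x => f (-x)) 0 k (fun x => ![v (-x) 1, v (-x) 0]) := by
  rw [isJostMinus_zero_iff]
  have e0 : ∀ x, (∫ y in Set.Ioi x, conjFactor f k 0 1 x y * (Uhat f y).mulVec (v y) 0) =
      -∫ y in Set.Iic (-x), Complex.exp (2 * Complex.I * k *
        ((xhat (fun x => f (-x)) (-x) - xhat (fun x => f (-x)) y : ℝ) : ℂ)) *
        (-uhatCoeff (fun x => f (-x)) y * v (-y) 1) := by
    intro x
    rw [← neg_neg x, ← integral_comp_neg_Iic, neg_neg, ← integral_neg]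
    refine integral_congr_ae (Eventually.of_forall fun y => ?_)
    simp only [conjFactor_zero_one, Uhat_mulVec_zero, hf.xhat_reflect, uhatCoeff_reflect, neg_neg]
    rw [show xhat f (-y) - xhat f x = -(xhat f x + lengthDefect f) -
      -(xhat f (-y) + lengthDefect f) by ring]
    ring
  have e1 : ∀ x, (∫ y in Set.Ioi x, conjFactor f k 1 1 x y * (Uhat f y).mulVec (v y) 1) =
      -∫ y in Set.Iic (-x), uhatCoeff (fun x => f (-x)) y * v (-y) 0 := by
    intro x
    rw [← neg_neg x, ← integral_comp_neg_Iic, neg_neg, ← integral_neg]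
    refine integral_congr_ae (Eventually.of_forall fun y => ?_)
    simp only [conjFactor_self, Uhat_mulVec_one, uhatCoeff_reflect]
    ring
  constructor
  · rintro ⟨hc, ⟨C, hC⟩, hv⟩
    refine ⟨?_, ⟨C, fun x i => ?_⟩, fun x => ?_, fun x => ?_⟩
    · refine continuous_pi fun i => ?_
      have := hc.comp continuous_neg
      fin_cases i
      · exact (continuous_apply 1).comp this
      · exact (continuous_apply 0).comp this
    · fin_cases i
      · exact hC _ _
      · exact hC _ _
    · have := hv (-x) 1
      rw [e1, neg_neg] at this
      simpa using this
    · have := hv (-x) 0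
      rw [e0, neg_neg] at this
      simpa using this
  · rintro ⟨hc, ⟨C, hC⟩, hv⟩
    refine ⟨?_, ⟨C, fun x i => ?_⟩, fun x i => ?_⟩
    · refine continuous_pi fun i => ?_
      have := hc.comp continuous_neg
      fin_cases i
      · simpa [Function.comp_def] using (continuous_apply 1).comp this
      · simpa [Function.comp_def] using (continuous_apply 0).comp this
    · fin_cases i
      · simpa using hC (-x) 1
      · simpa using hC (-x) 0
    · fin_cases i
      · simp only [Fin.zero_eta]
        rw [e0]
        simpa using hv.one (-x)
      · simp only [Fin.mk_one]
        rw [e1]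
        simpa using hv.zero (-x)

namespace IsProfile

variable {f : ℝ → ℝ} (h : IsProfile f)
include h

/-- The second column of `Φ₊` is the first column of `Φ₋` of the reflected profile. -/
theorem jostPlus_eq {k : ℂ} (hk : 0 ≤ k.im) (x : ℝ) :
    jostPlus f 1 k x 0 = jostMinus (fun x => f (-x)) 0 k (-x) 1 ∧
    jostPlus f 1 k x 1 = jostMinus (fun x => f (-x)) 0 k (-x) 0 := by
  have hJ := h.reflect.isJostMinus_jostMinus hk
  have h1 : IsJostPlus f 1 k fun x => ![jostMinus (fun x => f (-x)) 0 k (-x) 1,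
      jostMinus (fun x => f (-x)) 0 k (-x) 0] := by
    rw [isJostPlus_one_iff h]
    convert hJ using 1
    ext x i
    fin_cases i <;> simp
  have h2 : IsJostPlus f 1 k (jostPlus f 1 k) := Classical.epsilon_spec ⟨_, h1⟩
  have h3 := h.reflect.isJostMinus_unique hk ((isJostPlus_one_iff h).1 h2) hJ
  have h4 := congrFun h3 (-x)
  exact ⟨by simpa using congrFun h4 1, by simpa using congrFun h4 0⟩

theorem jostPlus_ode {k : ℂ} (hk : 0 ≤ k.im) :
    (∀ x, HasDerivAt (fun x => jostPlus f 1 k x 0) (uhatCoeff f x * jostPlus f 1 k x 1 -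
      2 * Complex.I * k * q f x * jostPlus f 1 k x 0) x) ∧
    (∀ x, HasDerivAt (fun x => jostPlus f 1 k x 1) (-uhatCoeff f x * jostPlus f 1 k x 0) x) ∧
    Tendsto (fun x => jostPlus f 1 k x 0) atTop (𝓝 0) ∧
    Tendsto (fun x => jostPlus f 1 k x 1) atTop (𝓝 1) := by
  obtain ⟨d0, d1, l0, l1⟩ := h.reflect.jostMinus_ode hk
  simp only [fun x => (h.jostPlus_eq hk x).1, fun x => (h.jostPlus_eq hk x).2]
  refine ⟨fun x => ?_, fun x => ?_, l1.comp tendsto_neg_atTop_atBot,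
    l0.comp tendsto_neg_atTop_atBot⟩
  · refine ((d1 (-x)).scomp x (hasDerivAt_neg x)).congr_deriv ?_
    rw [uhatCoeff_reflect, q_reflect, neg_neg, neg_smul, one_smul]
    ring
  · refine ((d0 (-x)).scomp x (hasDerivAt_neg x)).congr_deriv ?_
    rw [uhatCoeff_reflect, neg_neg, neg_smul, one_smul]
    ring

/-- The second column of `Φ₊` is characterized by its differential equation and its limit at
`+∞`. -/
theorem eq_jostPlus_of_ode {k : ℂ} (hk : 0 ≤ k.im) {v : ℝ → Fin 2 → ℂ}
    (h0 : ∀ x, HasDerivAt (fun x => v x 0) (uhatCoeff f x * v x 1 -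
      2 * Complex.I * k * q f x * v x 0) x)
    (h1 : ∀ x, HasDerivAt (fun x => v x 1) (-uhatCoeff f x * v x 0) x)
    (l0 : Tendsto (fun x => v x 0) atTop (𝓝 0)) (l1 : Tendsto (fun x => v x 1) atTop (𝓝 1)) :
    v = jostPlus f 1 k := by
  have e := h.reflect.eq_jostMinus_of_ode hk (v := fun x => ![v (-x) 1, v (-x) 0]) (fun x => ?_)
    (fun x => ?_) (l1.comp tendsto_neg_atBot_atTop) (l0.comp tendsto_neg_atBot_atTop)
  · ext x i
    have e' := congrFun e (-x)
    fin_cases i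
    · simp only [Fin.zero_eta]
      rw [(h.jostPlus_eq hk x).1, ← e']
      simp
    · simp only [Fin.mk_one]
      rw [(h.jostPlus_eq hk x).2, ← e']
      simp
  · refine ((h1 (-x)).scomp x (hasDerivAt_neg x)).congr_deriv ?_
    rw [uhatCoeff_reflect, neg_smul, one_smul]
    simp
  · refine ((h0 (-x)).scomp x (hasDerivAt_neg x)).congr_deriv ?_
    rw [uhatCoeff_reflect, q_reflect, neg_smul, one_smul]
    simp
    ring

theorem continuousOn_jostPlus (x : ℝ) (i : Fin 2) :
    ContinuousOn (fun k => jostPlus f 1 k x i) {k : ℂ | 0 ≤ k.im} := by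
  fin_cases i
  · exact (h.reflect.continuousOn_jostMinus (-x) 1).congr fun k hk => (h.jostPlus_eq hk x).1
  · exact (h.reflect.continuousOn_jostMinus (-x) 0).congr fun k hk => (h.jostPlus_eq hk x).2

theorem differentiableOn_jostPlus (x : ℝ) (i : Fin 2) :
    DifferentiableOn ℂ (fun k => jostPlus f 1 k x i) {k : ℂ | 0 < k.im} := by
  fin_cases i
  · exact (h.reflect.differentiableOn_jostMinus (-x) 1).congr
      fun k hk => (h.jostPlus_eq (le_of_lt hk) x).1
  · exact (h.reflect.differentiableOn_jostMinus (-x) 0).congr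
      fun k hk => (h.jostPlus_eq (le_of_lt hk) x).2

theorem tendsto_jostPlus_cocompact (x : ℝ) :
    Tendsto (fun k => jostPlus f 1 k x 0) (cocompact ℂ ⊓ 𝓟 {k : ℂ | 0 ≤ k.im}) (𝓝 0) ∧
    Tendsto (fun k => jostPlus f 1 k x 1) (cocompact ℂ ⊓ 𝓟 {k : ℂ | 0 ≤ k.im}) (𝓝 1) := by
  obtain ⟨h0, h1⟩ := h.reflect.tendsto_jostMinus_cocompact (-x)
  have hev : ∀ᶠ k in cocompact ℂ ⊓ 𝓟 {k : ℂ | 0 ≤ k.im}, 0 ≤ k.im :=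
    eventually_inf_principal.2 (Eventually.of_forall fun _ hk => hk)
  constructor
  · exact h1.congr' (hev.mono fun k hk => ((h.jostPlus_eq hk x).1).symm)
  · exact h0.congr' (hev.mono fun k hk => ((h.jostPlus_eq hk x).2).symm)

/-- `a(k)` is the Wronskian of the two Jost columns at any point. -/
theorem a_eq {k : ℂ} (hk : 0 ≤ k.im) (x : ℝ) : a f k =
    jostMinus f 0 k x 0 * jostPlus f 1 k x 1 - jostMinus f 0 k x 1 * jostPlus f 1 k x 0 := by
  obtain ⟨d0, d1, -, -⟩ := h.jostMinus_ode hk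
  obtain ⟨e0, e1, -, -⟩ := h.jostPlus_ode hk
  have hd : ∀ x, HasDerivAt (fun x => jostMinus f 0 k x 0 * jostPlus f 1 k x 1 -
      jostMinus f 0 k x 1 * jostPlus f 1 k x 0) 0 x := fun x =>
    (((d0 x).mul (e1 x)).sub ((d1 x).mul (e0 x))).congr_deriv (by ring)
  exact is_const_of_deriv_eq_zero (fun x => (hd x).differentiableAt) (fun x => (hd x).deriv) 0 x

theorem continuousOn_a : ContinuousOn (a f) {k : ℂ | 0 ≤ k.im} :=
  ((h.continuousOn_jostMinus 0 0).mul (h.continuousOn_jostPlus 0 1)).sub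
    ((h.continuousOn_jostMinus 0 1).mul (h.continuousOn_jostPlus 0 0))

theorem differentiableOn_a : DifferentiableOn ℂ (a f) {k : ℂ | 0 < k.im} :=
  ((h.differentiableOn_jostMinus 0 0).mul (h.differentiableOn_jostPlus 0 1)).sub
    ((h.differentiableOn_jostMinus 0 1).mul (h.differentiableOn_jostPlus 0 0))

theorem tendsto_a_cocompact : Tendsto (a f) (cocompact ℂ ⊓ 𝓟 {k : ℂ | 0 ≤ k.im}) (𝓝 1) := by
  obtain ⟨h0, h1⟩ := h.tendsto_jostMinus_cocompact 0
  obtain ⟨g0, g1⟩ := h.tendsto_jostPlus_cocompact 0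
  have := (h0.mul g1).sub (h1.mul g0)
  rw [mul_one, mul_zero, sub_zero] at this
  exact this

end IsProfile

section Real

variable {f : ℝ → ℝ} (h : IsProfile f) (k : ℝ)
include h

open ComplexConjugate

omit h in
theorem _root_.HasDerivAt.conj_ofReal {u : ℝ → ℂ} {u' : ℂ} {x : ℝ} (hu : HasDerivAt u u' x) :
    HasDerivAt (fun x => conj (u x)) (conj u') x :=
  hu.star

omit h in
theorem ofReal_im_nonneg : 0 ≤ (k : ℂ).im := by simp

/-- On the real axis the Lax matrix is anti-Hermitian, so the columns of `Φ₋` have norm one. -/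
theorem IsProfile.jostMinus_normSq (x : ℝ) : jostMinus f 0 k x 0 * conj (jostMinus f 0 k x 0) +
    jostMinus f 0 k x 1 * conj (jostMinus f 0 k x 1) = 1 := by
  obtain ⟨d0, d1, l0, l1⟩ := h.jostMinus_ode (ofReal_im_nonneg k)
  have hd : ∀ x, HasDerivAt (fun x => jostMinus f 0 k x 0 * conj (jostMinus f 0 k x 0) +
    jostMinus f 0 k x 1 * conj (jostMinus f 0 k x 1)) 0 x := fun x => by
    refine (((d0 x).mul (d0 x).conj_ofReal).add ((d1 x).mul (d1 x).conj_ofReal)).congr_deriv ?_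
    simp only [map_add, map_mul, map_neg, Complex.conj_ofReal, Complex.conj_I, map_ofNat]
    ring
  have hc : ∀ y, _ := fun y =>
    is_const_of_deriv_eq_zero (fun x => (hd x).differentiableAt) (fun x => (hd x).deriv) x y
  have c0 := (Complex.continuous_conj.tendsto _).comp l0
  have c1 := (Complex.continuous_conj.tendsto _).comp l1
  have hl := (l0.mul c0).add (l1.mul c1)
  rw [map_one, map_zero, mul_one, mul_zero, add_zero] at hl
  refine tendsto_nhds_unique (tendsto_const_nhds.congr fun y => ?_) hl
  exact hc y

theorem IsProfile.jostPlus_normSq (x : ℝ) : jostPlus f 1 k x 0 * conj (jostPlus f 1 k x 0) +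
    jostPlus f 1 k x 1 * conj (jostPlus f 1 k x 1) = 1 := by
  rw [(h.jostPlus_eq (ofReal_im_nonneg k) x).1, (h.jostPlus_eq (ofReal_im_nonneg k) x).2, add_comm]
  exact h.reflect.jostMinus_normSq k (-x)

/-- Conjugation symmetry: the second column of `Φ₋` on the real axis. -/
theorem IsProfile.jostMinus_one_eq (x : ℝ) :
    jostMinus f 1 k x 0 = -conj (jostMinus f 0 k x 1) ∧
    jostMinus f 1 k x 1 = conj (jostMinus f 0 k x 0) := by
  have hiff : ∀ v : ℝ → Fin 2 → ℂ, IsJostMinus f 1 k v ↔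
      IsJostMinus f 0 k (fun x => ![conj (v x 1), -conj (v x 0)]) := by
    intro v
    rw [isJostMinus_zero_iff]
    have e0 : ∀ x, -conj (∫ y in Set.Iic x, conjFactor f k 0 1 x y * (Uhat f y).mulVec (v y) 0) =
        ∫ y in Set.Iic x, Complex.exp (2 * Complex.I * k * ((xhat f x - xhat f y : ℝ) : ℂ)) *
          (-uhatCoeff f y * conj (v y 1)) := by
      intro x
      rw [← integral_conj, ← integral_neg]
      refine integral_congr_ae (Eventually.of_forall fun y => ?_)
      simp only [conjFactor_zero_one, Uhat_mulVec_zero, map_mul, ← Complex.exp_conj,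
        Complex.conj_ofReal, Complex.conj_I, map_ofNat]
      rw [show 2 * -Complex.I * (k : ℂ) * ((xhat f y - xhat f x : ℝ) : ℂ) =
        2 * Complex.I * k * ((xhat f x - xhat f y : ℝ) : ℂ) by push_cast; ring]
      ring
    have e1 : ∀ x, conj (∫ y in Set.Iic x, conjFactor f k 1 1 x y * (Uhat f y).mulVec (v y) 1) =
        ∫ y in Set.Iic x, uhatCoeff f y * -conj (v y 0) := by
      intro x
      rw [← integral_conj]
      refine integral_congr_ae (Eventually.of_forall fun y => ?_)
      simp only [conjFactor_self, Uhat_mulVec_one, map_mul, map_neg, Complex.conj_ofReal, map_one]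
      ring
    have hinj : Function.Injective (starRingEnd ℂ) := RingHom.injective _
    constructor
    · rintro ⟨hc, ⟨C, hC⟩, hv⟩
      refine ⟨?_, ⟨C, fun x i => ?_⟩, fun x => ?_, fun x => ?_⟩
      · refine continuous_pi fun i => ?_
        fin_cases i
        · exact Complex.continuous_conj.comp ((continuous_apply 1).comp hc)
        · exact (Complex.continuous_conj.comp ((continuous_apply 0).comp hc)).neg
      · fin_cases i
        · simpa using hC x 1
        · simpa using hC x 0
      · have := congrArg conj (hv x 1)
        rw [map_add, e1] at this
        simpa using this
      · have := congrArg (fun z => -conj z) (hv x 0)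
        simp only [map_add, neg_add] at this
        rw [e0] at this
        simpa using this
    · rintro ⟨hc, ⟨C, hC⟩, hv⟩
      refine ⟨?_, ⟨C, fun x i => ?_⟩, fun x i => ?_⟩
      · refine continuous_pi fun i => ?_
        fin_cases i
        · have := (Complex.continuous_conj.comp ((continuous_apply 1).comp hc)).neg
          exact this.congr fun x => by simp
        · have := Complex.continuous_conj.comp ((continuous_apply 0).comp hc)
          exact this.congr fun x => by simp
      · fin_cases i
        · simpa using hC x 1
        · simpa using hC x 0
      · apply hinj
        fin_cases i
        · have := hv.one x
          simp only [Fin.zero_eta]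
          rw [map_add, ← neg_inj, neg_add, e0]
          simpa using this
        · have := hv.zero x
          simp only [Fin.mk_one]
          rw [map_add, e1]
          simpa using this
  have hJ := h.isJostMinus_jostMinus (ofReal_im_nonneg k)
  have h1 : IsJostMinus f 1 k fun x => ![-conj (jostMinus f 0 k x 1), conj (jostMinus f 0 k x 0)] := by
    rw [hiff]
    convert hJ using 1
    ext x i
    fin_cases i <;> simp
  have h2 : IsJostMinus f 1 k (jostMinus f 1 k) := Classical.epsilon_spec ⟨_, h1⟩
  have h3 := congrFun (h.isJostMinus_unique (ofReal_im_nonneg k) ((hiff _).1 h2) hJ) x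
  have g0 := congrFun h3 0
  have g1 := congrFun h3 1
  simp only [Matrix.cons_val_zero, Matrix.cons_val_one, Matrix.cons_val_fin_one] at g0 g1
  constructor
  · rw [← g1]; simp
  · rw [← g0]; simp

/-- `b(k)` is, up to a phase, the Hermitian product of the Jost columns, at any point. -/
theorem IsProfile.b_eq (x : ℝ) : b f k = Complex.exp (2 * Complex.I * k * xhat f x) *
    (jostPlus f 1 k x 0 * conj (jostMinus f 0 k x 0) +
      jostPlus f 1 k x 1 * conj (jostMinus f 0 k x 1)) := by
  obtain ⟨d0, d1, -, -⟩ := h.jostMinus_ode (ofReal_im_nonneg k)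
  obtain ⟨e0, e1, -, -⟩ := h.jostPlus_ode (ofReal_im_nonneg k)
  have hd : ∀ x, HasDerivAt (fun x => Complex.exp (2 * Complex.I * k * xhat f x) *
    (jostPlus f 1 k x 0 * conj (jostMinus f 0 k x 0) +
      jostPlus f 1 k x 1 * conj (jostMinus f 0 k x 1))) 0 x := fun x => by
    refine ((((h.hasDerivAt_xhat x).ofReal_comp.const_mul (2 * Complex.I * (k : ℂ))).cexp).mul
      (((e0 x).mul (d0 x).conj_ofReal).add ((e1 x).mul (d1 x).conj_ofReal))).congr_deriv ?_
    simp only [map_add, map_mul, map_neg, Complex.conj_ofReal, Complex.conj_I, map_ofNat,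
      Pi.add_apply, Pi.mul_apply]
    ring
  have hc := is_const_of_deriv_eq_zero (fun x => (hd x).differentiableAt) (fun x => (hd x).deriv) 0 x
  refine Eq.trans ?_ hc
  obtain ⟨m0, m1⟩ := h.jostMinus_one_eq k 0
  have hdet : (jostMinusMatrix f k 0).det = 1 := by
    rw [Matrix.det_fin_two, ← h.jostMinus_normSq k 0]
    simp only [jostMinusMatrix, Matrix.of_apply, m0, m1]
    ring
  have hinv : (jostMinusMatrix f k 0)⁻¹ = (jostMinusMatrix f k 0).adjugate := by
    rw [Matrix.inv_def, hdet]
    simp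
  have hexp : Complex.exp (2 * Complex.I * k * xhat f 0) =
      Complex.exp (Complex.I * k * xhat f 0) * Complex.exp (Complex.I * k * xhat f 0) := by
    rw [← Complex.exp_add]
    congr 1
    ring
  rw [b, scatteringMatrix, hinv, Matrix.adjugate_fin_two, hexp]
  simp only [expSigma3, jostMinusMatrix, jostPlusMatrix, Matrix.mul_apply, Fin.sum_univ_two,
    Matrix.of_apply, Matrix.cons_val', Matrix.cons_val_zero, Matrix.cons_val_one,
    Matrix.cons_val_fin_one, m0, m1, neg_neg]
  ring

end Real

/-- At a zero of `a` the two Jost columns are proportional, by the factor `chi`. -/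
theorem IsProfile.jostMinus_eq_chi {f : ℝ → ℝ} (h : IsProfile f) {k : ℂ} (hk : 0 ≤ k.im)
    (ha : a f k = 0) (x : ℝ) (i : Fin 2) : jostMinus f 0 k x i =
      chi f k * Complex.exp (2 * Complex.I * k * xhat f x) * jostPlus f 1 k x i := by
  suffices hex : ∃ c : ℂ, ∀ x i, jostMinus f 0 k x i =
      c * Complex.exp (2 * Complex.I * k * xhat f x) * jostPlus f 1 k x i from
    Classical.epsilon_spec hex x i
  obtain ⟨d0, d1, -, -⟩ := h.jostMinus_ode hk
  obtain ⟨e0, e1, -, l1⟩ := h.jostPlus_ode hk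
  have hwc : Continuous fun x => (uhatCoeff f x : ℂ) :=
    Complex.continuous_ofReal.comp h.continuous_uhatCoeff
  have hqc : Continuous fun x => (q f x : ℂ) := Complex.continuous_ofReal.comp h.continuous_q
  set A : ℝ → (Fin 2 → ℂ) →L[ℂ] (Fin 2 → ℂ) := fun x =>
    mat₂ 0 (uhatCoeff f x) (-uhatCoeff f x) (2 * Complex.I * k * q f x) with hA
  have hAc : Continuous A := by
    simp only [hA, mat₂]
    fun_prop
  set E : ℝ → ℂ := fun x => Complex.exp (2 * Complex.I * k * xhat f x) with hE
  have hEd : ∀ x, HasDerivAt E (E x * (2 * Complex.I * k * q f x)) x := fun x =>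
    ((h.hasDerivAt_xhat x).ofReal_comp.const_mul (2 * Complex.I * k)).cexp
  have hM : ∀ x, HasDerivAt (jostMinus f 0 k) (A x (jostMinus f 0 k x)) x := fun x => by
    rw [hasDerivAt_pi]
    intro i
    fin_cases i
    · refine (d0 x).congr_deriv ?_
      simp only [hA, Fin.zero_eta, mat₂_apply_zero]
      ring
    · refine (d1 x).congr_deriv ?_
      simp only [hA, Fin.mk_one, mat₂_apply_one]
  have hP : ∀ c : ℂ, ∀ x, HasDerivAt (fun x => (c * E x) • jostPlus f 1 k x)
      (A x ((c * E x) • jostPlus f 1 k x)) x := fun c x => by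
    rw [hasDerivAt_pi]
    intro i
    fin_cases i
    · refine (((hEd x).const_mul c).mul (e0 x)).congr_deriv ?_
      simp only [hA, Fin.zero_eta, mat₂_apply_zero, Pi.smul_apply, smul_eq_mul]
      ring
    · refine (((hEd x).const_mul c).mul (e1 x)).congr_deriv ?_
      simp only [hA, Fin.mk_one, mat₂_apply_one, Pi.smul_apply, smul_eq_mul]
      ring
  -- A Jost column that vanishes at one point vanishes identically, against its limit at `+∞`.
  have hne : jostPlus f 1 k 0 ≠ 0 := by
    intro h0
    have hz := linearODE_unique hAc (hP 1) (v := fun _ => 0)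
      (fun x => by simpa using hasDerivAt_const x (0 : Fin 2 → ℂ)) (x₀ := 0) (by simp [h0])
    have hz1 : ∀ x, jostPlus f 1 k x 1 = 0 := fun x => by
      have := congrFun (congrFun hz x) 1
      simpa [hE, Complex.exp_ne_zero] using this
    simp only [hz1] at l1
    exact zero_ne_one (tendsto_nhds_unique tendsto_const_nhds l1)
  have hW : jostMinus f 0 k 0 0 * jostPlus f 1 k 0 1 = jostMinus f 0 k 0 1 * jostPlus f 1 k 0 0 := by
    rw [h.a_eq hk 0] at ha
    exact sub_eq_zero.1 ha
  have hE0 : E 0 ≠ 0 := Complex.exp_ne_zero _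
  obtain ⟨c, hc⟩ : ∃ c : ℂ, jostMinus f 0 k 0 = (c * E 0) • jostPlus f 1 k 0 := by
    by_cases h0 : jostPlus f 1 k 0 0 = 0
    · have h1 : jostPlus f 1 k 0 1 ≠ 0 := fun h1 => hne (by
        ext i
        fin_cases i
        · simpa using h0
        · simpa using h1)
      refine ⟨jostMinus f 0 k 0 1 / (jostPlus f 1 k 0 1 * E 0), ?_⟩
      ext i
      fin_cases i
      · simp only [Fin.zero_eta, Pi.smul_apply, smul_eq_mul]
        rw [h0, mul_zero] at hW ⊢
        exact (mul_eq_zero.1 hW).resolve_right h1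
      · simp only [Fin.mk_one, Pi.smul_apply, smul_eq_mul]
        field_simp
    · refine ⟨jostMinus f 0 k 0 0 / (jostPlus f 1 k 0 0 * E 0), ?_⟩
      ext i
      fin_cases i
      · simp only [Fin.zero_eta, Pi.smul_apply, smul_eq_mul]
        field_simp
      · simp only [Fin.mk_one, Pi.smul_apply, smul_eq_mul]
        field_simp
        linear_combination -hW
  have heq := linearODE_unique hAc hM (hP c) hc
  exact ⟨c, fun x i => congrFun (congrFun heq x) i⟩

end ShortPulse

/-! ### Linear evolutions and zero curvature -/

namespace ShortPulse

section Evolution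

variable {E : Type*} [NormedAddCommGroup E] [NormedSpace ℂ E]

/-- A jointly continuous function is continuous in the first variable uniformly over a compact
range of the second. -/
theorem exists_forall_norm_sub_le {F : Type*} [NormedAddCommGroup F] {f : ℝ → ℝ → F}
    (hf : Continuous fun z : ℝ × ℝ => f z.1 z.2) (x t : ℝ) {ε : ℝ} (hε : 0 < ε) :
    ∃ δ > 0, ∀ y, |y - x| < δ → ∀ τ ∈ Set.Icc 0 t, ‖f y τ - f x τ‖ ≤ ε := by
  have hK : IsCompact (Metric.closedBall x 1 ×ˢ Set.Icc (0 : ℝ) t) :=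
    (isCompact_closedBall x 1).prod isCompact_Icc
  obtain ⟨δ, hδ, h⟩ := Metric.uniformContinuousOn_iff.1
    (hK.uniformContinuousOn_of_continuous hf.continuousOn) ε hε
  refine ⟨min δ 1, lt_min hδ one_pos, fun y hy τ hτ => ?_⟩
  have h1 := h (y, τ) ⟨Metric.mem_closedBall.2 (hy.le.trans (min_le_right _ _)), hτ⟩ (x, τ)
    ⟨Metric.mem_closedBall_self zero_le_one, hτ⟩
    (by simpa [Prod.dist_eq, Real.dist_eq, hδ] using hy.trans_le (min_le_left _ _))
  rw [dist_eq_norm] at h1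
  exact h1.le

/-- Grönwall's inequality on `[0, t]`, with a bound that is uniform in time. -/
theorem norm_le_of_norm_deriv_le {f f' : ℝ → E} {t K δ ε : ℝ} (hK : 0 < K) (hε : 0 ≤ ε)
    (hf : ∀ τ ∈ Set.Icc 0 t, HasDerivWithinAt f (f' τ) (Set.Icc 0 t) τ) (h0 : ‖f 0‖ ≤ δ)
    (hb : ∀ τ ∈ Set.Icc 0 t, ‖f' τ‖ ≤ K * ‖f τ‖ + ε) :
    ∀ τ ∈ Set.Icc 0 t, ‖f τ‖ ≤ (δ + ε / K) * Real.exp (K * t) := by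
  intro τ hτ
  have h := norm_le_gronwallBound_of_norm_deriv_right_le (f := f) (f' := f') (a := 0) (b := t)
    (K := K) (δ := δ) (ε := ε) (fun τ hτ => (hf τ hτ).continuousWithinAt)
    (fun τ hτ => (hf τ ⟨hτ.1, hτ.2.le⟩).mono_of_mem_nhdsWithin (Icc_mem_nhdsGE_of_mem hτ)) h0
    (fun τ hτ => hb τ ⟨hτ.1, hτ.2.le⟩) τ hτ
  refine h.trans ?_
  have hδ : 0 ≤ δ := (norm_nonneg _).trans h0
  have hεK : 0 ≤ ε / K := div_nonneg hε hK.le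
  rw [gronwallBound_of_K_ne_0 hK.ne', sub_zero]
  have h1 : Real.exp (K * τ) ≤ Real.exp (K * t) := Real.exp_le_exp.2 (by nlinarith [hτ.2])
  nlinarith [mul_le_mul_of_nonneg_left h1 hδ, mul_le_mul_of_nonneg_left h1 hεK]

/-- `w(x, ·)` solves the linear equation `w_τ = V w` on `[0, t]`, for every `x`, and `w` is
continuous. -/
structure IsEvolution (V : ℝ → ℝ → E →L[ℂ] E) (t : ℝ) (w : ℝ → ℝ → E) : Prop where
  continuous : Continuous fun z : ℝ × ℝ => w z.1 z.2
  hasDerivWithinAt : ∀ x, ∀ τ ∈ Set.Icc 0 t,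
    HasDerivWithinAt (w x) (V x τ (w x τ)) (Set.Icc 0 t) τ

namespace IsEvolution

variable {V : ℝ → ℝ → E →L[ℂ] E} {t : ℝ} {w : ℝ → ℝ → E}

theorem const_smul (h : IsEvolution V t w) (c : ℂ) : IsEvolution V t fun x τ => c • w x τ :=
  ⟨h.continuous.const_smul c, fun x τ hτ => by
    rw [map_smul]
    exact (h.hasDerivWithinAt x τ hτ).const_smul c⟩

theorem norm_le (h : IsEvolution V t w) {C : ℝ} (hC : 0 < C) {x : ℝ}
    (hV : ∀ τ ∈ Set.Icc 0 t, ‖V x τ‖ ≤ C) :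
    ∀ τ ∈ Set.Icc 0 t, ‖w x τ‖ ≤ ‖w x 0‖ * Real.exp (C * t) := by
  have := norm_le_of_norm_deriv_le hC le_rfl (h.hasDerivWithinAt x) le_rfl fun τ hτ =>
    ((V x τ).le_of_opNorm_le (hV τ hτ) _).trans (by rw [add_zero])
  simpa using this

/-- A continuous bounded family of linear equations has a continuous family of solutions. -/
theorem exists_of_bound [CompleteSpace E] (hV : Continuous fun z : ℝ × ℝ => V z.1 z.2) {C : ℝ}
    (hC : ∀ x, ∀ τ ∈ Set.Icc 0 t, ‖V x τ‖ ≤ C) (ht : 0 ≤ t) {ψ : ℝ → E} (hψ : Continuous ψ) :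
    ∃ w, IsEvolution V t w ∧ ∀ x, w x 0 = ψ x := by
  have hC0 : 0 ≤ C := (norm_nonneg _).trans (hC 0 0 ⟨le_rfl, ht⟩)
  set A : ℝ → ℝ → ℝ → E →L[ℂ] E := fun x _ σ => (Set.Ioc 0 t).indicator (V x) σ with hA
  have hcV : ∀ x, Continuous (V x) := fun x => hV.comp (Continuous.prodMk_right x)
  have hk : VolterraKernel A ((Set.Ioc 0 t).indicator fun _ => C)
      fun x => C * max 0 (min x t) := by
    refine ⟨.const_indicator hC0 ht, fun x _ => ?_, fun σ => ?_, fun x _ σ _ => ?_⟩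
    · exact (hcV x).aestronglyMeasurable.indicator measurableSet_Ioc
    · by_cases hσ : σ ∈ Set.Ioc 0 t
      · simp only [hA, Set.indicator_of_mem hσ]
        exact hV.comp (continuous_fst.prodMk continuous_const)
      · simp only [hA, Set.indicator_of_notMem hσ]
        exact continuous_const
    · by_cases hσ : σ ∈ Set.Ioc 0 t
      · simp only [hA, Set.indicator_of_mem hσ]
        exact hC x σ (Set.Ioc_subset_Icc_self hσ)
      · simp [hA, Set.indicator_of_notMem hσ]
  set w := volterraSol A ψ with hw
  have hwc := hk.continuous_volterraSol hψ
  have hcw : ∀ x, Continuous (w x) := fun x => hwc.comp (Continuous.prodMk_right x)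
  have hcVw : ∀ x, Continuous fun σ => V x σ (w x σ) := fun x => (hcV x).clm_apply (hcw x)
  have heq : ∀ x, ∀ τ ∈ Set.Icc 0 t, w x τ = ψ x + ∫ σ in 0..τ, V x σ (w x σ) := by
    intro x τ hτ
    rw [hw, hk.volterraSol_eq hψ x τ, intervalIntegral.integral_of_le hτ.1]
    congr 1
    have : ∀ σ, A x τ σ (volterraSol A ψ x σ) =
        (Set.Ioc 0 t).indicator (fun σ => V x σ (w x σ)) σ := by
      intro σ
      by_cases hσ : σ ∈ Set.Ioc 0 t
      · simp only [hA, hw, Set.indicator_of_mem hσ]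
      · simp [hA, Set.indicator_of_notMem hσ]
    simp_rw [this]
    rw [setIntegral_indicator measurableSet_Ioc]
    congr 2
    ext σ
    simp only [Set.mem_inter_iff, Set.mem_Iic, Set.mem_Ioc]
    exact ⟨fun h => ⟨h.2.1, h.1⟩, fun h => ⟨h.2, h.1, h.2.trans hτ.2⟩⟩
  refine ⟨w, ⟨hwc, fun x τ hτ => ?_⟩, fun x => ?_⟩
  · have h1 := ((intervalIntegral.integral_hasDerivAt_right
      ((hcVw x).intervalIntegrable 0 τ)
      (hcVw x).stronglyMeasurable.stronglyMeasurableAtFilter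
      (hcVw x).continuousAt).const_add (ψ x)).hasDerivWithinAt (s := Set.Icc 0 t)
    exact h1.congr (fun σ hσ => heq x σ hσ) (heq x τ hτ)
  · simpa using heq x 0 ⟨le_rfl, ht⟩

/-- If the curvature `U_τ - V_x + [U, V]` vanishes, the flow of `w_τ = V w` preserves the solutions
of `w_x = U w`. -/
theorem hasDerivAt_of_zero_curvature (hw : IsEvolution V t w) (ht : 0 ≤ t)
    (hVc : Continuous fun z : ℝ × ℝ => V z.1 z.2)
    {Vx U Uτ : ℝ → ℝ → E →L[ℂ] E} (hVxc : Continuous fun z : ℝ × ℝ => Vx z.1 z.2)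
    (hVx : ∀ y, ∀ τ ∈ Set.Icc 0 t, HasDerivAt (fun y => V y τ) (Vx y τ) y)
    (hU : ∀ x, ∀ τ ∈ Set.Icc 0 t,
      HasDerivWithinAt (fun τ => U x τ) (Uτ x τ) (Set.Icc 0 t) τ)
    (hzc : ∀ x, ∀ τ ∈ Set.Icc 0 t, ∀ v,
      Uτ x τ v + U x τ (V x τ v) = Vx x τ v + V x τ (U x τ v))
    (h0 : ∀ x, HasDerivAt (fun x => w x 0) (U x 0 (w x 0)) x) (x : ℝ) :
    HasDerivAt (fun x => w x t) (U x t (w x t)) x := by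
  have hcs : ∀ {F : Type _} [NormedAddCommGroup F] {f : ℝ → ℝ → F},
      (Continuous fun z : ℝ × ℝ => f z.1 z.2) → ∃ C, ∀ τ ∈ Set.Icc 0 t, ‖f x τ‖ ≤ C :=
    fun hf => isCompact_Icc.exists_bound_of_continuousOn
      (hf.comp (Continuous.prodMk_right x)).continuousOn
  obtain ⟨K', hK'⟩ := hcs hVc
  obtain ⟨L, hL⟩ := hcs hVxc
  obtain ⟨M, hM⟩ := hcs hw.continuous
  have hm0 : (0 : ℝ) ∈ Set.Icc 0 t := ⟨le_rfl, ht⟩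
  have hK0 : 0 ≤ K' := (norm_nonneg _).trans (hK' 0 hm0)
  have hL0 : 0 ≤ L := (norm_nonneg _).trans (hL 0 hm0)
  have hM0 : 0 ≤ M := (norm_nonneg _).trans (hM 0 hm0)
  set K := K' + 1 with hKdef
  have hK : 0 < K := by positivity
  have hKb : ∀ τ ∈ Set.Icc 0 t, ‖V x τ‖ ≤ K := fun τ hτ => (hK' τ hτ).trans (by linarith)
  -- The difference `w(y, τ) - w(x, τ) - (y - x) U w(x, τ)` solves the linear equation up to an error
  -- `o(y - x)`, uniformly in `τ`, by the zero curvature condition; `G` is the Grönwall constant.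
  set G := (1 + (M + 1 + L) / K) * Real.exp (K * t) with hG
  have hG0 : 0 < G := by positivity
  rw [hasDerivAt_iff_isLittleO, Asymptotics.isLittleO_iff]
  intro c hc
  set ε := min 1 (c / G) with hε
  have hε0 : 0 < ε := lt_min one_pos (div_pos hc hG0)
  obtain ⟨δ₁, hδ₁, h1⟩ := exists_forall_norm_sub_le hVxc x t hε0
  obtain ⟨δ₂, hδ₂, h2⟩ := exists_forall_norm_sub_le hw.continuous x t hε0
  have h3 := (hasDerivAt_iff_isLittleO.1 (h0 x)).def hε0
  filter_upwards [h3, Metric.ball_mem_nhds x (lt_min hδ₁ hδ₂)] with y hy0 hy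
  rw [Metric.mem_ball, Real.dist_eq] at hy
  have hy1 := hy.trans_le (min_le_left _ _)
  have hy2 := hy.trans_le (min_le_right _ _)
  set r := y - x with hr
  have hVlin : ∀ τ ∈ Set.Icc 0 t, ‖V y τ - V x τ - r • Vx x τ‖ ≤ ε * |r| := by
    intro τ hτ
    have hd : ∀ z ∈ Metric.ball x δ₁, HasDerivWithinAt (fun z => V z τ - z • Vx x τ)
        (Vx z τ - Vx x τ) (Metric.ball x δ₁) z := fun z _ =>
      ((hVx z τ hτ).sub (((hasDerivAt_id z).smul_const (Vx x τ)).congr_deriv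
        (by rw [one_smul]))).hasDerivWithinAt
    have := (convex_ball x δ₁).norm_image_sub_le_of_norm_hasDerivWithin_le hd
      (fun z hz => h1 z (by simpa [Real.dist_eq] using hz) τ hτ)
      (Metric.mem_ball_self hδ₁) (by simpa [Real.dist_eq] using hy1 : y ∈ Metric.ball x δ₁)
    rw [Real.norm_eq_abs] at this
    refine le_trans (le_of_eq ?_) this
    congr 1
    rw [hr, sub_smul]
    abel
  have hderiv : ∀ τ ∈ Set.Icc 0 t, HasDerivWithinAt
      (fun τ => w y τ - w x τ - r • U x τ (w x τ))
      (V x τ (w y τ - w x τ - r • U x τ (w x τ)) +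
        ((V y τ - V x τ - r • Vx x τ) (w y τ) + r • Vx x τ (w y τ - w x τ))) (Set.Icc 0 t) τ := by
    intro τ hτ
    have hd1 := hw.hasDerivWithinAt y τ hτ
    have hd2 := hw.hasDerivWithinAt x τ hτ
    have hd3 : HasDerivWithinAt (fun τ => U x τ (w x τ))
        (Uτ x τ (w x τ) + U x τ (V x τ (w x τ))) (Set.Icc 0 t) τ := by
      have hB := (ContinuousLinearMap.restrictScalarsL ℂ E E ℝ ℝ).hasFDerivAt.comp_hasDerivWithinAt
        τ (hU x τ hτ)
      exact hB.clm_apply hd2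
    refine ((hd1.sub hd2).sub (hd3.const_smul r)).congr_deriv ?_
    rw [hzc x τ hτ]
    simp only [map_sub, sub_apply, smul_apply, smul_add,
      smul_sub, (V x τ).map_smul_of_tower r]
    abel
  have hmain := norm_le_of_norm_deriv_le (δ := ε * |r|) (ε := ε * (M + 1 + L) * |r|) hK
    (by positivity) hderiv ?_ (fun τ hτ => ?_) t ⟨ht, le_rfl⟩
  · refine hmain.trans ?_
    have e1 : (ε * |r| + ε * (M + 1 + L) * |r| / K) * Real.exp (K * t) = ε * G * |r| := by
      rw [hG]; ring
    rw [e1, Real.norm_eq_abs]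
    refine mul_le_mul_of_nonneg_right ?_ (abs_nonneg _)
    calc ε * G ≤ c / G * G := mul_le_mul_of_nonneg_right (min_le_right _ _) hG0.le
      _ = c := div_mul_cancel₀ _ hG0.ne'
  · simpa using hy0
  · refine (norm_add_le _ _).trans (add_le_add ((V x τ).le_of_opNorm_le (hKb τ hτ) _) ?_)
    have hwd := h2 y hy2 τ hτ
    have hwy : ‖w y τ‖ ≤ M + 1 := by
      have := norm_le_norm_add_norm_sub' (w y τ) (w x τ)
      have := hM τ hτ
      have : ε ≤ 1 := min_le_left _ _
      linarith
    refine (norm_add_le _ _).trans ?_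
    have g1 := ((V y τ - V x τ - r • Vx x τ).le_of_opNorm_le (hVlin τ hτ) (w y τ)).trans
      (mul_le_mul_of_nonneg_left hwy (by positivity))
    have g2 : ‖r • Vx x τ (w y τ - w x τ)‖ ≤ |r| * (L * ε) := by
      rw [norm_smul, Real.norm_eq_abs]
      refine mul_le_mul_of_nonneg_left ?_ (abs_nonneg _)
      exact ((Vx x τ).le_of_opNorm_le (hL τ hτ) _).trans (mul_le_mul_of_nonneg_left hwd hL0)
    linarith

end IsEvolution

end Evolution

end ShortPulse

/-! ### The short pulse equation and its conserved length -/

namespace ShortPulse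

theorem mem_timeDomain_of_le {T : EReal} {s t : ℝ} (ht : t ∈ timeDomain T)
    (hs : s ∈ Set.Icc 0 t) : s ∈ timeDomain T :=
  ⟨hs.1, lt_of_le_of_lt (EReal.coe_le_coe_iff.2 hs.2) ht.2⟩

/-- The nearest point of `[0, t]`, used to extend functions of time continuously to `ℝ`. -/
def clampTime (t τ : ℝ) : ℝ := max 0 (min τ t)

theorem clampTime_of_mem {t τ : ℝ} (h : τ ∈ Set.Icc 0 t) : clampTime t τ = τ := by
  rw [clampTime, min_eq_left h.2, max_eq_right h.1]

theorem clampTime_mem {t : ℝ} (ht : 0 ≤ t) (τ : ℝ) : clampTime t τ ∈ Set.Icc 0 t :=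
  ⟨le_max_left _ _, max_le ht (min_le_right _ _)⟩

theorem continuous_clampTime (t : ℝ) : Continuous (clampTime t) := by
  unfold clampTime
  fun_prop

theorem clampTime_mem_timeDomain {T : EReal} {t : ℝ} (ht : t ∈ timeDomain T) (τ : ℝ) :
    clampTime t τ ∈ timeDomain T :=
  mem_timeDomain_of_le ht (clampTime_mem ht.1 τ)

theorem continuous_clampTime_of_continuousOn {T : EReal} {g : ℝ → ℝ → ℝ} {t : ℝ}
    (hg : ContinuousOn (fun z : ℝ × ℝ => g z.1 z.2) (Set.univ ×ˢ timeDomain T))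
    (ht : t ∈ timeDomain T) : Continuous fun z : ℝ × ℝ => g z.1 (clampTime t z.2) :=
  hg.comp_continuous (continuous_fst.prodMk ((continuous_clampTime t).comp continuous_snd))
    fun z => ⟨trivial, clampTime_mem_timeDomain ht z.2⟩

namespace IsDecayingSolution

variable {T : EReal} {u₀ : ℝ → ℝ} {u : ℝ → ℝ → ℝ} (hu : IsDecayingSolution T u₀ u)
include hu

theorem isProfile {t : ℝ} (ht : t ∈ timeDomain T) : IsProfile fun x => u x t :=
  ⟨hu.contDiff t ht, hu.decay t ht, hu.integrable_ux t ht, hu.integrable_uxx t ht⟩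

theorem initial_eq : (fun x => u x 0) = u₀ := funext hu.initial

/-- The equation in the form `(u_x)_t = u + u u_x² + u² u_{xx} / 2`, including the one-sided
derivative at the initial time. -/
theorem hasDerivWithinAt_deriv {t : ℝ} (ht : t ∈ timeDomain T) (x : ℝ) {τ : ℝ}
    (hτ : τ ∈ Set.Icc 0 t) :
    HasDerivWithinAt (fun τ => deriv (fun y => u y τ) x)
      (u x τ + u x τ * deriv (fun y => u y τ) x ^ 2 +
        u x τ ^ 2 * deriv (deriv (fun y => u y τ)) x / 2) (Set.Icc 0 t) τ := by
  have hpos : ∀ τ ∈ Set.Ioc 0 t, HasDerivAt (fun τ => deriv (fun y => u y τ) x)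
      (u x τ + u x τ * deriv (fun y => u y τ) x ^ 2 +
        u x τ ^ 2 * deriv (deriv (fun y => u y τ)) x / 2) τ := by
    intro τ hτ
    have hτT := mem_timeDomain_of_le ht (Set.Ioc_subset_Icc_self hτ)
    have hp := hu.isProfile hτT
    have h1 : deriv (fun y => u y τ ^ 3) = fun y => 3 * u y τ ^ 2 * deriv (fun y => u y τ) y := by
      ext y
      exact ((hp.hasDerivAt y).pow 3).deriv.trans (by norm_num)
    have h2 : deriv (deriv (fun y => u y τ ^ 3)) x = 6 * u x τ * deriv (fun y => u y τ) x ^ 2 +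
        3 * u x τ ^ 2 * deriv (deriv (fun y => u y τ)) x := by
      rw [h1]
      refine ((((hp.hasDerivAt x).pow 2).const_mul 3).mul (hp.hasDerivAt_deriv x)).deriv.trans ?_
      simp only [Pi.pow_apply]
      norm_num
      ring
    refine (hu.equation x τ hτ.1 hτT.2).congr_deriv ?_
    rw [h2]
    ring
  -- At `τ = 0` the equation is not assumed; the one-sided derivative is the limit of the
  -- derivatives at positive times. If also `t = 0`, there is nothing to prove on `{0}`.
  rcases eq_or_lt_of_le hτ.1 with h0 | h0
  · rcases eq_or_lt_of_le ht.1 with ht0 | ht0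
    · subst h0
      rw [← ht0, Set.Icc_self]
      exact HasFDerivWithinAt.of_subsingleton Set.subsingleton_singleton
    · have hcl : ∀ g : ℝ → ℝ → ℝ,
          ContinuousOn (fun z : ℝ × ℝ => g z.1 z.2) (Set.univ ×ˢ timeDomain T) →
          ContinuousOn (fun τ => g x τ) (Set.Icc 0 t) := fun g hg =>
        hg.comp (f := fun τ => (x, τ)) (Continuous.prodMk_right x).continuousOn
          fun s hs => ⟨trivial, mem_timeDomain_of_le ht hs⟩
      have c0 := hcl u hu.continuousOn_u
      have c1 := hcl (fun x τ => deriv (fun y => u y τ) x) hu.continuousOn_ux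
      have c2 := hcl (fun x τ => deriv (deriv (fun y => u y τ)) x) hu.continuousOn_uxx
      subst h0
      have hsub : Set.Ioo 0 t ⊆ Set.Icc 0 t := Set.Ioo_subset_Icc_self
      have hF : ContinuousOn (fun τ => u x τ + u x τ * deriv (fun y => u y τ) x ^ 2 +
        u x τ ^ 2 * deriv (deriv (fun y => u y τ)) x / 2) (Set.Icc 0 t) :=
        (c0.add (c0.mul (c1.pow 2))).add (((c0.pow 2).mul c2).div_const 2)
      have hmem : Set.Ioo 0 t ∈ 𝓝[>] (0 : ℝ) := Ioo_mem_nhdsGT ht0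
      refine (hasDerivWithinAt_Ici_of_tendsto_deriv (s := Set.Ioo 0 t)
        (fun τ hτ => (hpos τ ⟨hτ.1, hτ.2.le⟩).differentiableAt.differentiableWithinAt)
        ((c1 0 hτ).mono hsub) hmem ?_).mono Set.Icc_subset_Ici_self
      have hl := (hF 0 hτ).tendsto.mono_left
        (nhdsWithin_le_of_mem (mem_of_superset hmem hsub) : 𝓝[>] (0 : ℝ) ≤ 𝓝[Set.Icc 0 t] 0)
      refine hl.congr' ?_
      filter_upwards [hmem] with τ hτ
      exact (hpos τ ⟨hτ.1, hτ.2.le⟩).deriv.symm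
  · exact (hpos τ ⟨h0, hτ.2⟩).hasDerivWithinAt

/-- `∫ (q - 1)` is a conserved quantity: `q_t = (u² q / 2)_x`. -/
theorem lengthDefect_eq {t : ℝ} (ht : t ∈ timeDomain T) :
    lengthDefect (fun x => u x t) = lengthDefect u₀ := by
  obtain ⟨C, hC⟩ := hu.bounded t ht
  have hp : ∀ τ, IsProfile fun x => u x (clampTime t τ) := fun τ =>
    hu.isProfile (clampTime_mem_timeDomain ht τ)
  have c0 := continuous_clampTime_of_continuousOn hu.continuousOn_u ht
  have c1 := continuous_clampTime_of_continuousOn (g := fun x τ => deriv (fun y => u y τ) x)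
    hu.continuousOn_ux ht
  have c2 := continuous_clampTime_of_continuousOn
    (g := fun x τ => deriv (deriv (fun y => u y τ)) x) hu.continuousOn_uxx ht
  have cq : Continuous fun z : ℝ × ℝ => q (fun y => u y (clampTime t z.2)) z.1 := by
    unfold q
    fun_prop
  set F : ℝ → ℝ → ℝ := fun x τ =>
    u x (clampTime t τ) ^ 2 * q (fun y => u y (clampTime t τ)) x / 2 with hFdef
  set F' : ℝ → ℝ → ℝ := fun x τ =>
    u x (clampTime t τ) * deriv (fun y => u y (clampTime t τ)) x *
      q (fun y => u y (clampTime t τ)) x +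
    u x (clampTime t τ) ^ 2 * deriv (fun y => u y (clampTime t τ)) x *
      deriv (deriv (fun y => u y (clampTime t τ))) x /
      (2 * q (fun y => u y (clampTime t τ)) x) with hF'def
  have cF : Continuous fun z : ℝ × ℝ => F z.1 z.2 := by
    exact ((c0.pow 2).mul cq).div_const 2
  have cF' : Continuous fun z : ℝ × ℝ => F' z.1 z.2 := by
    simp only [hF'def]
    refine ((c0.mul c1).mul cq).add ((((c0.pow 2).mul c1).mul c2).div (cq.const_mul 2) fun z => ?_)
    have := q_pos (fun y => u y (clampTime t z.2)) z.1
    positivity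
  have hFd : ∀ τ x, HasDerivAt (fun x => F x τ) (F' x τ) x := by
    intro τ x
    have hq : HasDerivAt (q fun y => u y (clampTime t τ))
        (deriv (fun y => u y (clampTime t τ)) x *
          deriv (deriv (fun y => u y (clampTime t τ))) x /
          q (fun y => u y (clampTime t τ)) x) x := by
      have h1 := ((((hp τ).hasDerivAt_deriv x).pow 2).const_add 1).sqrt
        (by positivity : 1 + deriv (fun y => u y (clampTime t τ)) x ^ 2 ≠ 0)
      refine h1.congr_deriv ?_
      have := q_pos (fun y => u y (clampTime t τ)) x
      rw [show √((fun x => 1 + (deriv (fun y => u y (clampTime t τ)) ^ 2) x) x) =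
        q (fun y => u y (clampTime t τ)) x from rfl]
      field_simp
      norm_num
      ring
    refine (((((hp τ).hasDerivAt x).pow 2).mul hq).div_const 2).congr_deriv ?_
    have := q_pos (fun y => u y (clampTime t τ)) x
    simp only [hF'def, Pi.pow_apply]
    norm_num
    field_simp
  have hqt : ∀ x, ∀ τ ∈ Set.Icc 0 t,
      HasDerivWithinAt (fun τ => q (fun y => u y τ) x) (F' x τ) (Set.Icc 0 t) τ := by
    intro x τ hτ
    have h1 := (((hu.hasDerivWithinAt_deriv ht x hτ).pow 2).const_add 1).sqrt
      (by positivity : 1 + deriv (fun y => u y τ) x ^ 2 ≠ 0)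
    refine h1.congr_deriv ?_
    have hqp := q_pos (fun y => u y τ) x
    have hqs := q_sq (fun y => u y τ) x
    simp only [hF'def, clampTime_of_mem hτ]
    rw [show √((fun x_1 => 1 + ((fun τ => deriv (fun y => u y τ) x) ^ 2) x_1) τ) =
      q (fun y => u y τ) x from rfl]
    field_simp
    norm_num
    linear_combination (-4 * deriv (fun y => u y τ) x * u x τ) * hqs
  have hint : ∀ x, ∫ τ in 0..t, F' x τ = q (fun y => u y t) x - q (fun y => u y 0) x := by
    intro x
    refine intervalIntegral.integral_eq_sub_of_hasDeriv_right_of_le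
      (f := fun τ => q (fun y => u y τ) x) ht.1
      (fun τ hτ => (hqt x τ hτ).continuousWithinAt) (fun τ hτ => ?_) ?_
    · exact ((hqt x τ (Set.Ioo_subset_Icc_self hτ)).hasDerivAt
        (Icc_mem_nhds hτ.1 hτ.2)).hasDerivWithinAt
    · exact (cF'.comp (Continuous.prodMk_right x)).intervalIntegrable _ _
  -- The time integral of the flux is a primitive in `x` of the change of `q - 1`; it vanishes at
  -- both ends, so the integral of that change is zero.
  have hG : ∀ x, HasDerivAt (fun x => ∫ τ in 0..t, F x τ)
      ((q (fun y => u y t) x - 1) - (q (fun y => u y 0) x - 1)) x := by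
    intro x
    obtain ⟨B, hB⟩ := ((isCompact_closedBall x 1).prod (isCompact_Icc (a := (0 : ℝ)) (b := t))
      ).exists_bound_of_continuousOn cF'.continuousOn
    have h1 := (intervalIntegral.hasDerivAt_integral_of_dominated_loc_of_deriv_le
      (μ := volume) (F := F) (F' := F') (x₀ := x) (a := 0) (b := t) (bound := fun _ => B)
      (Metric.closedBall_mem_nhds x one_pos)
      (Eventually.of_forall fun y =>
        (cF.comp (Continuous.prodMk_right y)).aestronglyMeasurable)
      ((cF.comp (Continuous.prodMk_right x)).intervalIntegrable _ _)
      (cF'.comp (Continuous.prodMk_right x)).aestronglyMeasurable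
      (Eventually.of_forall fun τ hτ y hy => by
        rw [Set.uIoc_of_le ht.1] at hτ
        exact hB (y, τ) ⟨hy, Set.Ioc_subset_Icc_self hτ⟩)
      intervalIntegrable_const
      (Eventually.of_forall fun τ _ y _ => hFd τ y)).2
    rw [hint x] at h1
    exact h1.congr_deriv (by ring)
  have hlim : ∀ l : Filter ℝ, l.IsCountablyGenerated →
      (∀ τ, Tendsto (fun x => u x (clampTime t τ)) l (𝓝 0)) →
      Tendsto (fun x => ∫ τ in 0..t, F x τ) l (𝓝 0) := by
    intro l _ hl
    have hCb : ∀ x τ, |u x (clampTime t τ)| ≤ C ∧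
        |deriv (fun y => u y (clampTime t τ)) x| ≤ C := fun x τ => hC _ (clampTime_mem ht.1 τ) x
    have hC0 : 0 ≤ C := (abs_nonneg _).trans (hCb 0 0).1
    have hqC : ∀ x τ, q (fun y => u y (clampTime t τ)) x ≤ 1 + C := fun x τ =>
      (q_le _ _).trans (by linarith [(hCb x τ).2])
    have := intervalIntegral.tendsto_integral_filter_of_dominated_convergence (μ := volume)
      (a := 0) (b := t) (F := F) (f := fun _ => 0) (l := l) (fun _ => C * C * (1 + C) / 2)
      (Eventually.of_forall fun y =>
        (cF.comp (Continuous.prodMk_right y)).aestronglyMeasurable)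
      (Eventually.of_forall fun x => Eventually.of_forall fun τ _ => by
        have h1 := q_pos (fun y => u y (clampTime t τ)) x
        simp only [hFdef]
        rw [Real.norm_of_nonneg (by positivity), ← sq_abs]
        have h2 := hqC x τ
        have h3 := (hCb x τ).1
        have h4 : |u x (clampTime t τ)| ^ 2 ≤ C * C := by
          nlinarith [abs_nonneg (u x (clampTime t τ))]
        have h5 := mul_le_mul h4 h2 h1.le (by positivity)
        linarith)
      intervalIntegrable_const
      (Eventually.of_forall fun τ _ => by
        refine squeeze_zero_norm (fun x => ?_) (((hl τ).norm.mul_const (C * (1 + C) / 2)).trans_eq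
          (by simp))
        have h1 := q_pos (fun y => u y (clampTime t τ)) x
        simp only [hFdef]
        rw [Real.norm_of_nonneg (by positivity), ← sq_abs, Real.norm_eq_abs]
        have h2 := hqC x τ
        have h3 := (hCb x τ).1
        have h0 := abs_nonneg (u x (clampTime t τ))
        have h5 := mul_le_mul h3 h2 h1.le hC0
        nlinarith [mul_le_mul_of_nonneg_left h5 h0])
    simpa using this
  have h0 : (0 : ℝ) ∈ timeDomain T := mem_timeDomain_of_le ht ⟨le_rfl, ht.1⟩
  have hi1 := (hu.isProfile ht).integrable_q_sub_one
  have hi0 := (hu.isProfile h0).integrable_q_sub_one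
  have hfin := integral_of_hasDerivAt_of_tendsto hG (hi1.sub hi0)
    (hlim atBot inferInstance fun τ => (hp τ).tendsto_atBot)
    (hlim atTop inferInstance fun τ => (hp τ).tendsto_atTop)
  rw [integral_sub hi1 hi0, sub_self, sub_eq_zero] at hfin
  rw [lengthDefect, hfin, hu.initial_eq, lengthDefect]

end IsDecayingSolution
end ShortPulse

/-! ### The Lax pair -/

namespace ShortPulse

open ComplexConjugate

theorem hasDerivWithinAt_mat₂ {a b c d : ℝ → ℂ} {a' b' c' d' : ℂ} {s : Set ℝ} {x : ℝ}
    (ha : HasDerivWithinAt a a' s x) (hb : HasDerivWithinAt b b' s x)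
    (hc : HasDerivWithinAt c c' s x) (hd : HasDerivWithinAt d d' s x) :
    HasDerivWithinAt (fun x => mat₂ (a x) (b x) (c x) (d x)) (mat₂ a' b' c' d') s x :=
  (((ha.smul_const (matUnit 0 0)).add (hb.smul_const (matUnit 0 1))).add
    (hc.smul_const (matUnit 1 0))).add (hd.smul_const (matUnit 1 1))

theorem continuous_mat₂ {X : Type*} [TopologicalSpace X] {a b c d : X → ℂ} (ha : Continuous a)
    (hb : Continuous b) (hc : Continuous c) (hd : Continuous d) :
    Continuous fun x => mat₂ (a x) (b x) (c x) (d x) :=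
  (((ha.smul continuous_const).add (hb.smul continuous_const)).add
    (hc.smul continuous_const)).add (hd.smul continuous_const)

/-- The matrix `-ik (1, p; p, -1)` of the spatial Lax equation `ψ_x = U ψ`, where `p = u_x`. -/
noncomputable def laxU (k : ℂ) (p : ℝ) : (Fin 2 → ℂ) →L[ℂ] (Fin 2 → ℂ) :=
  mat₂ (-(Complex.I * k)) (-(Complex.I * k * p)) (-(Complex.I * k * p)) (Complex.I * k)

/-- The matrix of the temporal Lax equation `ψ_t = V ψ`, where `a = u` and `p = u_x`. -/
noncomputable def laxV (k : ℂ) (a p : ℝ) : (Fin 2 → ℂ) →L[ℂ] (Fin 2 → ℂ) :=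
  mat₂ (-(Complex.I * k * a ^ 2 / 2) - 1 / (4 * Complex.I * k))
    (-(Complex.I * k * a ^ 2 * p / 2) - a / 2) (-(Complex.I * k * a ^ 2 * p / 2) + a / 2)
    (Complex.I * k * a ^ 2 / 2 + 1 / (4 * Complex.I * k))

/-- The rotation by the half angle that relates the eigenvectors of `U` to the standard basis. -/
noncomputable def rotate (f : ℝ → ℝ) (x : ℝ) (v : Fin 2 → ℂ) : Fin 2 → ℂ :=
  ![halfCos f x * v 0 - halfSin f x * v 1, halfSin f x * v 0 + halfCos f x * v 1]

/-- The solution `e^{-ik x̂} R Φ₋^{(1)}` of the spatial Lax equation. -/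
noncomputable def laxMinus (f : ℝ → ℝ) (k : ℂ) (x : ℝ) : Fin 2 → ℂ :=
  Complex.exp (-(Complex.I * k) * xhat f x) • rotate f x (jostMinus f 0 k x)

/-- The solution `e^{ik x̂} R Φ₊^{(2)}` of the spatial Lax equation. -/
noncomputable def laxPlus (f : ℝ → ℝ) (k : ℂ) (x : ℝ) : Fin 2 → ℂ :=
  Complex.exp (Complex.I * k * xhat f x) • rotate f x (jostPlus f 1 k x)

namespace IsProfile

variable {f : ℝ → ℝ} (h : IsProfile f)
include h

/-- The rotation by the half angle followed by the phase factor `e^{σ x̂}` carries the diagonalized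
spatial system to `ψ_x = U ψ`; `σ = ∓ik` for the two Jost columns. -/
theorem hasDerivAt_rotate {k σ : ℂ} {v : ℝ → Fin 2 → ℂ} {x : ℝ}
    (d0 : HasDerivAt (fun x => v x 0)
      (uhatCoeff f x * v x 1 - (Complex.I * k + σ) * q f x * v x 0) x)
    (d1 : HasDerivAt (fun x => v x 1)
      (-uhatCoeff f x * v x 0 + (Complex.I * k - σ) * q f x * v x 1) x) :
    HasDerivAt (fun x => Complex.exp (σ * xhat f x) • rotate f x (v x))
      (laxU k (deriv f x) (Complex.exp (σ * xhat f x) • rotate f x (v x))) x := by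
  have hE : HasDerivAt (fun x => Complex.exp (σ * xhat f x))
      (Complex.exp (σ * xhat f x) * (σ * q f x)) x :=
    ((h.hasDerivAt_xhat x).ofReal_comp.const_mul σ).cexp
  have hc := (h.hasDerivAt_halfCos x).ofReal_comp
  have hs := (h.hasDerivAt_halfSin x).ofReal_comp
  have e1 := congrArg (fun r : ℝ => (r : ℂ)) (q_mul_halfCos f x)
  have e2 := congrArg (fun r : ℝ => (r : ℂ)) (q_mul_halfSin f x)
  push_cast at e1 e2 hc hs
  rw [hasDerivAt_pi]
  intro i
  fin_cases i
  · refine (hE.mul ((hc.mul d0).sub (hs.mul d1))).congr_deriv ?_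
    simp only [laxU, Fin.zero_eta, mat₂_apply_zero, rotate, Pi.smul_apply, smul_eq_mul,
      Matrix.cons_val_zero, Matrix.cons_val_one, Matrix.cons_val_fin_one, Pi.mul_apply,
      Pi.sub_apply]
    linear_combination -(Complex.I * k * Complex.exp (σ * xhat f x) * v x 0) * e1 -
      (Complex.I * k * Complex.exp (σ * xhat f x) * v x 1) * e2
  · refine (hE.mul ((hs.mul d0).add (hc.mul d1))).congr_deriv ?_
    simp only [laxU, Fin.mk_one, mat₂_apply_one, rotate, Pi.smul_apply, smul_eq_mul,
      Matrix.cons_val_zero, Matrix.cons_val_one, Matrix.cons_val_fin_one, Pi.mul_apply,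
      Pi.add_apply]
    linear_combination (Complex.I * k * Complex.exp (σ * xhat f x) * v x 1) * e1 -
      (Complex.I * k * Complex.exp (σ * xhat f x) * v x 0) * e2

/-- The inverse of the gauge transformation in `hasDerivAt_rotate`. -/
theorem hasDerivAt_unrotate {k σ : ℂ} {ψ : ℝ → Fin 2 → ℂ} {x : ℝ}
    (d : HasDerivAt ψ (laxU k (deriv f x) (ψ x)) x) :
    HasDerivAt (fun x => Complex.exp (-σ * xhat f x) * (halfCos f x * ψ x 0 + halfSin f x * ψ x 1))
      (uhatCoeff f x * (Complex.exp (-σ * xhat f x) *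
          (-halfSin f x * ψ x 0 + halfCos f x * ψ x 1)) -
        (Complex.I * k + σ) * q f x * (Complex.exp (-σ * xhat f x) *
          (halfCos f x * ψ x 0 + halfSin f x * ψ x 1))) x ∧
    HasDerivAt
      (fun x => Complex.exp (-σ * xhat f x) * (-halfSin f x * ψ x 0 + halfCos f x * ψ x 1))
      (-uhatCoeff f x * (Complex.exp (-σ * xhat f x) *
          (halfCos f x * ψ x 0 + halfSin f x * ψ x 1)) +
        (Complex.I * k - σ) * q f x * (Complex.exp (-σ * xhat f x) *
          (-halfSin f x * ψ x 0 + halfCos f x * ψ x 1))) x := by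
  have hE : HasDerivAt (fun x => Complex.exp (-σ * xhat f x))
      (Complex.exp (-σ * xhat f x) * (-σ * q f x)) x :=
    ((h.hasDerivAt_xhat x).ofReal_comp.const_mul (-σ)).cexp
  have hc := (h.hasDerivAt_halfCos x).ofReal_comp
  have hs := (h.hasDerivAt_halfSin x).ofReal_comp
  have e1 := congrArg (fun r : ℝ => (r : ℂ)) (q_mul_halfCos f x)
  have e2 := congrArg (fun r : ℝ => (r : ℂ)) (q_mul_halfSin f x)
  push_cast at e1 e2 hc hs
  have d0 := hasDerivAt_pi.1 d 0
  have d1 := hasDerivAt_pi.1 d 1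
  rw [laxU, mat₂_apply_zero] at d0
  rw [laxU, mat₂_apply_one] at d1
  constructor
  · refine (hE.mul ((hc.mul d0).add (hs.mul d1))).congr_deriv ?_
    simp only [Pi.mul_apply, Pi.add_apply]
    linear_combination (Complex.I * k * Complex.exp (-σ * xhat f x) * ψ x 0) * e1 +
      (Complex.I * k * Complex.exp (-σ * xhat f x) * ψ x 1) * e2
  · refine (hE.mul ((hs.neg.mul d0).add (hc.mul d1))).congr_deriv ?_
    simp only [Pi.mul_apply, Pi.add_apply, Pi.neg_apply]
    linear_combination -(Complex.I * k * Complex.exp (-σ * xhat f x) * ψ x 1) * e1 +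
      (Complex.I * k * Complex.exp (-σ * xhat f x) * ψ x 0) * e2

theorem hasDerivAt_laxMinus {k : ℂ} (hk : 0 ≤ k.im) (x : ℝ) :
    HasDerivAt (laxMinus f k) (laxU k (deriv f x) (laxMinus f k x)) x := by
  obtain ⟨d0, d1, -, -⟩ := h.jostMinus_ode hk
  exact h.hasDerivAt_rotate (σ := -(Complex.I * k)) ((d0 x).congr_deriv (by ring))
    ((d1 x).congr_deriv (by ring))

theorem hasDerivAt_laxPlus {k : ℂ} (hk : 0 ≤ k.im) (x : ℝ) :
    HasDerivAt (laxPlus f k) (laxU k (deriv f x) (laxPlus f k x)) x := by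
  obtain ⟨d0, d1, -, -⟩ := h.jostPlus_ode hk
  exact h.hasDerivAt_rotate (σ := Complex.I * k) ((d0 x).congr_deriv (by ring))
    ((d1 x).congr_deriv (by ring))

omit h in
theorem tendsto_rotate {l : Filter ℝ} (hl : Tendsto (deriv f) l (𝓝 0)) {v : ℝ → Fin 2 → ℂ}
    {e₀ e₁ : ℂ} (h0 : Tendsto (fun x => v x 0) l (𝓝 e₀)) (h1 : Tendsto (fun x => v x 1) l (𝓝 e₁)) :
    Tendsto (fun x => rotate f x (v x) 0) l (𝓝 e₀) ∧
    Tendsto (fun x => rotate f x (v x) 1) l (𝓝 e₁) := by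
  have hc := (Complex.continuous_ofReal.tendsto _).comp (tendsto_halfCos hl)
  have hs := (Complex.continuous_ofReal.tendsto _).comp (tendsto_halfSin hl)
  constructor
  · simpa [rotate] using (hc.mul h0).sub (hs.mul h1)
  · simpa [rotate] using (hs.mul h0).add (hc.mul h1)

omit h in
theorem tendsto_unrotate {l : Filter ℝ} (hl : Tendsto (deriv f) l (𝓝 0)) {m : ℝ → ℂ}
    {ψ : ℝ → Fin 2 → ℂ} {e₀ e₁ : ℂ} (h0 : Tendsto (fun x => m x * ψ x 0) l (𝓝 e₀))
    (h1 : Tendsto (fun x => m x * ψ x 1) l (𝓝 e₁)) :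
    Tendsto (fun x => m x * (halfCos f x * ψ x 0 + halfSin f x * ψ x 1)) l (𝓝 e₀) ∧
    Tendsto (fun x => m x * (-halfSin f x * ψ x 0 + halfCos f x * ψ x 1)) l (𝓝 e₁) := by
  have hc := (Complex.continuous_ofReal.tendsto _).comp (tendsto_halfCos hl)
  have hs := (Complex.continuous_ofReal.tendsto _).comp (tendsto_halfSin hl)
  constructor
  · refine ((hc.mul h0).add (hs.mul h1)).congr (fun x => ?_) |>.trans_eq (by simp)
    simp only [Function.comp_apply]
    ring
  · refine ((hs.neg.mul h0).add (hc.mul h1)).congr (fun x => ?_) |>.trans_eq (by simp)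
    simp only [Function.comp_apply]
    ring

theorem tendsto_laxMinus {k : ℂ} (hk : 0 ≤ k.im) (i : Fin 2) :
    Tendsto (fun x => Complex.exp (Complex.I * k * xhat f x) * laxMinus f k x i) atBot
      (𝓝 (![1, 0] i)) := by
  obtain ⟨-, -, l0, l1⟩ := h.jostMinus_ode hk
  obtain ⟨g0, g1⟩ := tendsto_rotate h.tendsto_deriv_atBot l0 l1
  have he : ∀ x i, rotate f x (jostMinus f 0 k x) i =
      Complex.exp (Complex.I * k * xhat f x) * laxMinus f k x i := fun x i => by
    rw [laxMinus, Pi.smul_apply, smul_eq_mul, ← mul_assoc, ← Complex.exp_add, neg_mul,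
      add_neg_cancel, Complex.exp_zero, one_mul]
  simp_rw [← he]
  fin_cases i
  · exact g0
  · exact g1

theorem tendsto_laxPlus {k : ℂ} (hk : 0 ≤ k.im) (i : Fin 2) :
    Tendsto (fun x => Complex.exp (-(Complex.I * k) * xhat f x) * laxPlus f k x i) atTop
      (𝓝 (![0, 1] i)) := by
  obtain ⟨-, -, l0, l1⟩ := h.jostPlus_ode hk
  obtain ⟨g0, g1⟩ := tendsto_rotate h.tendsto_deriv_atTop l0 l1
  have he : ∀ x i, rotate f x (jostPlus f 1 k x) i =
      Complex.exp (-(Complex.I * k) * xhat f x) * laxPlus f k x i := fun x i => by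
    rw [laxPlus, Pi.smul_apply, smul_eq_mul, ← mul_assoc, ← Complex.exp_add, neg_mul,
      neg_add_cancel, Complex.exp_zero, one_mul]
  simp_rw [← he]
  fin_cases i
  · exact g0
  · exact g1

omit h in
theorem rotate_unrotate (x : ℝ) (m : ℂ) (v : Fin 2 → ℂ) :
    rotate f x ![m * (halfCos f x * v 0 + halfSin f x * v 1),
      m * (-halfSin f x * v 0 + halfCos f x * v 1)] = m • v := by
  have e := congrArg (fun r : ℝ => (r : ℂ)) (halfCos_sq_add_halfSin_sq f x)
  push_cast at e
  ext i
  fin_cases i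
  · simp [rotate]
    linear_combination m * v 0 * e
  · simp [rotate]
    linear_combination m * v 1 * e

/-- The solution `laxMinus` is characterized by the spatial Lax equation and its asymptotics at
`-∞`. -/
theorem eq_laxMinus {k : ℂ} (hk : 0 ≤ k.im) {ψ : ℝ → Fin 2 → ℂ}
    (hψ : ∀ x, HasDerivAt ψ (laxU k (deriv f x) (ψ x)) x)
    (hl : ∀ i, Tendsto (fun x => Complex.exp (Complex.I * k * xhat f x) * ψ x i) atBot
      (𝓝 (![1, 0] i))) : ψ = laxMinus f k := by
  have hd := fun x => h.hasDerivAt_unrotate (σ := -(Complex.I * k)) (hψ x)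
  simp only [neg_neg, add_neg_cancel, zero_mul, sub_zero, sub_neg_eq_add] at hd
  obtain ⟨l0, l1⟩ := tendsto_unrotate h.tendsto_deriv_atBot (hl 0) (hl 1)
  have he := h.eq_jostMinus_of_ode hk (v := fun x =>
    ![Complex.exp (Complex.I * k * xhat f x) * (halfCos f x * ψ x 0 + halfSin f x * ψ x 1),
      Complex.exp (Complex.I * k * xhat f x) * (-halfSin f x * ψ x 0 + halfCos f x * ψ x 1)])
    (fun x => (hd x).1) (fun x => (hd x).2.congr_deriv (by
      simp only [Matrix.cons_val_zero, Matrix.cons_val_one, Matrix.cons_val_fin_one]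
      ring)) l0 l1
  ext1 x
  rw [laxMinus, ← he, rotate_unrotate, smul_smul, ← Complex.exp_add, neg_mul, neg_add_cancel,
    Complex.exp_zero, one_smul]

/-- The solution `laxPlus` is characterized by the spatial Lax equation and its asymptotics at
`+∞`. -/
theorem eq_laxPlus {k : ℂ} (hk : 0 ≤ k.im) {ψ : ℝ → Fin 2 → ℂ}
    (hψ : ∀ x, HasDerivAt ψ (laxU k (deriv f x) (ψ x)) x)
    (hl : ∀ i, Tendsto (fun x => Complex.exp (-(Complex.I * k) * xhat f x) * ψ x i) atTop
      (𝓝 (![0, 1] i))) : ψ = laxPlus f k := by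
  have hd := fun x => h.hasDerivAt_unrotate (σ := Complex.I * k) (hψ x)
  simp only [sub_self, zero_mul, add_zero] at hd
  obtain ⟨l0, l1⟩ := tendsto_unrotate h.tendsto_deriv_atTop (hl 0) (hl 1)
  have he := h.eq_jostPlus_of_ode hk (v := fun x =>
    ![Complex.exp (-(Complex.I * k) * xhat f x) * (halfCos f x * ψ x 0 + halfSin f x * ψ x 1),
      Complex.exp (-(Complex.I * k) * xhat f x) *
        (-halfSin f x * ψ x 0 + halfCos f x * ψ x 1)])
    (fun x => (hd x).1.congr_deriv (by
      simp only [Matrix.cons_val_zero, Matrix.cons_val_one, Matrix.cons_val_fin_one]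
      ring)) (fun x => (hd x).2) l0 l1
  ext1 x
  rw [laxPlus, ← he, rotate_unrotate, smul_smul, ← Complex.exp_add, neg_mul, add_neg_cancel,
    Complex.exp_zero, one_smul]

/-- The rotation has determinant one and the phases cancel, so `a` is also the Wronskian of the
Lax solutions. -/
theorem a_eq_lax {k : ℂ} (hk : 0 ≤ k.im) (x : ℝ) :
    a f k = laxMinus f k x 0 * laxPlus f k x 1 - laxMinus f k x 1 * laxPlus f k x 0 := by
  have e := congrArg (fun r : ℝ => (r : ℂ)) (halfCos_sq_add_halfSin_sq f x)
  have e2 : Complex.exp (-(Complex.I * k) * xhat f x) * Complex.exp (Complex.I * k * xhat f x) = 1 := by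
    rw [← Complex.exp_add, neg_mul, neg_add_cancel, Complex.exp_zero]
  push_cast at e
  rw [h.a_eq hk x]
  simp only [laxMinus, laxPlus, rotate, Pi.smul_apply, smul_eq_mul, Matrix.cons_val_zero,
    Matrix.cons_val_one, Matrix.cons_val_fin_one]
  linear_combination -(jostMinus f 0 k x 0 * jostPlus f 1 k x 1 -
    jostMinus f 0 k x 1 * jostPlus f 1 k x 0) * e - (jostMinus f 0 k x 0 * jostPlus f 1 k x 1 -
    jostMinus f 0 k x 1 * jostPlus f 1 k x 0) * (halfCos f x ^ 2 + halfSin f x ^ 2) * e2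

theorem b_eq_lax (k : ℝ) (x : ℝ) :
    b f k = laxPlus f k x 0 * conj (laxMinus f k x 0) + laxPlus f k x 1 * conj (laxMinus f k x 1) := by
  have e := congrArg (fun r : ℝ => (r : ℂ)) (halfCos_sq_add_halfSin_sq f x)
  have e2 : Complex.exp (2 * Complex.I * k * xhat f x) =
      Complex.exp (Complex.I * k * xhat f x) * Complex.exp (Complex.I * k * xhat f x) := by
    rw [← Complex.exp_add]
    ring_nf
  push_cast at e
  rw [h.b_eq k x, e2]
  simp only [laxMinus, laxPlus, rotate, Pi.smul_apply, smul_eq_mul, Matrix.cons_val_zero,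
    Matrix.cons_val_one, Matrix.cons_val_fin_one, map_mul, map_sub, map_add, ← Complex.exp_conj,
    map_neg, Complex.conj_I, Complex.conj_ofReal, neg_mul, neg_neg]
  linear_combination -(jostPlus f 1 k x 0 * conj (jostMinus f 0 k x 0) +
    jostPlus f 1 k x 1 * conj (jostMinus f 0 k x 1)) *
    Complex.exp (Complex.I * k * xhat f x) ^ 2 * e

theorem laxMinus_eq_chi {k : ℂ} (hk : 0 ≤ k.im) (ha : a f k = 0) (x : ℝ) :
    laxMinus f k x = chi f k • laxPlus f k x := by
  have he : Complex.exp (-(Complex.I * k) * xhat f x) * Complex.exp (2 * Complex.I * k * xhat f x) =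
      Complex.exp (Complex.I * k * xhat f x) := by
    rw [← Complex.exp_add]
    ring_nf
  have h0 := h.jostMinus_eq_chi hk ha x 0
  have h1 := h.jostMinus_eq_chi hk ha x 1
  ext i
  rw [laxMinus, laxPlus]
  fin_cases i
  · simp only [rotate, Pi.smul_apply, smul_eq_mul, Fin.zero_eta, Matrix.cons_val_zero]
    rw [h0, h1, ← he]
    ring
  · simp only [rotate, Pi.smul_apply, smul_eq_mul, Fin.mk_one, Matrix.cons_val_one,
      Matrix.cons_val_fin_one]
    rw [h0, h1, ← he]
    ring

end IsProfile

end ShortPulse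

/-! ### The temporal Lax equation -/

namespace ShortPulse

open ComplexConjugate

/-- The matrix `V` of the temporal Lax equation along the solution `u`, for times in `[0, t]`. -/
noncomputable def timeLax (u : ℝ → ℝ → ℝ) (t : ℝ) (k : ℂ) (x τ : ℝ) :
    (Fin 2 → ℂ) →L[ℂ] (Fin 2 → ℂ) :=
  laxV k (u x (clampTime t τ)) (deriv (fun y => u y (clampTime t τ)) x)

theorem continuous_laxV (k : ℂ) : Continuous fun z : ℝ × ℝ => laxV k z.1 z.2 := by
  refine continuous_mat₂ ?_ ?_ ?_ ?_ <;> fun_prop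

namespace IsDecayingSolution

variable {T : EReal} {u₀ : ℝ → ℝ} {u : ℝ → ℝ → ℝ} (hu : IsDecayingSolution T u₀ u) {t : ℝ}
  (ht : t ∈ timeDomain T)
include hu ht

theorem continuous_timeLax (k : ℂ) : Continuous fun z : ℝ × ℝ => timeLax u t k z.1 z.2 := by
  have c0 := continuous_clampTime_of_continuousOn hu.continuousOn_u ht
  have c1 := continuous_clampTime_of_continuousOn (g := fun x τ => deriv (fun y => u y τ) x)
    hu.continuousOn_ux ht
  have h := (continuous_laxV k).comp (c0.prodMk c1)
  simp only [Function.comp_def] at h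
  exact h

theorem exists_norm_timeLax_le (k : ℂ) : ∃ C > 0, ∀ x τ, ‖timeLax u t k x τ‖ ≤ C := by
  obtain ⟨C, hC⟩ := hu.bounded t ht
  obtain ⟨B, hB⟩ := ((isCompact_Icc (a := -C) (b := C)).prod
    (isCompact_Icc (a := -C) (b := C))).exists_bound_of_continuousOn (continuous_laxV k).continuousOn
  refine ⟨max B 1, lt_max_of_lt_right one_pos, fun x τ => le_max_of_le_left ?_⟩
  have h := hC _ (clampTime_mem ht.1 τ) x
  exact hB (u x (clampTime t τ), deriv (fun y => u y (clampTime t τ)) x)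
    ⟨abs_le.1 h.1, abs_le.1 h.2⟩

/-- The temporal flow preserves the solutions of the spatial Lax equation. -/
theorem hasDerivAt_of_isEvolution {k : ℂ} (hk : k ≠ 0) {w : ℝ → ℝ → Fin 2 → ℂ}
    (hw : IsEvolution (timeLax u t k) t w)
    (h0 : ∀ x, HasDerivAt (fun x => w x 0) (laxU k (deriv u₀ x) (w x 0)) x) (x : ℝ) :
    HasDerivAt (fun x => w x t) (laxU k (deriv (fun y => u y t) x) (w x t)) x := by
  have hp : ∀ τ, IsProfile fun x => u x (clampTime t τ) := fun τ =>
    hu.isProfile (clampTime_mem_timeDomain ht τ)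
  have c0 := continuous_clampTime_of_continuousOn hu.continuousOn_u ht
  have c1 := continuous_clampTime_of_continuousOn (g := fun x τ => deriv (fun y => u y τ) x)
    hu.continuousOn_ux ht
  have c2 := continuous_clampTime_of_continuousOn
    (g := fun x τ => deriv (deriv (fun y => u y τ)) x) hu.continuousOn_uxx ht
  have hmul : (Complex.I * k) * (1 / (4 * Complex.I * k)) = 1 / 4 := by
    field_simp
  refine hw.hasDerivAt_of_zero_curvature ht.1 (hu.continuous_timeLax ht k)
    (Vx := fun x τ => mat₂
      (-(Complex.I * k * (u x (clampTime t τ) * deriv (fun y => u y (clampTime t τ)) x : ℝ)))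
      (-(Complex.I * k * (u x (clampTime t τ) * deriv (fun y => u y (clampTime t τ)) x ^ 2 +
        u x (clampTime t τ) ^ 2 * deriv (deriv (fun y => u y (clampTime t τ))) x / 2 : ℝ)) -
        (deriv (fun y => u y (clampTime t τ)) x / 2 : ℝ))
      (-(Complex.I * k * (u x (clampTime t τ) * deriv (fun y => u y (clampTime t τ)) x ^ 2 +
        u x (clampTime t τ) ^ 2 * deriv (deriv (fun y => u y (clampTime t τ))) x / 2 : ℝ)) +
        (deriv (fun y => u y (clampTime t τ)) x / 2 : ℝ))
      (Complex.I * k * (u x (clampTime t τ) * deriv (fun y => u y (clampTime t τ)) x : ℝ)))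
    (U := fun x τ => laxU k (deriv (fun y => u y τ) x))
    (Uτ := fun x τ => mat₂ 0
      (-(Complex.I * k * (u x τ + u x τ * deriv (fun y => u y τ) x ^ 2 +
        u x τ ^ 2 * deriv (deriv (fun y => u y τ)) x / 2 : ℝ)))
      (-(Complex.I * k * (u x τ + u x τ * deriv (fun y => u y τ) x ^ 2 +
        u x τ ^ 2 * deriv (deriv (fun y => u y τ)) x / 2 : ℝ))) 0)
    ?_ (fun y τ _ => ?_) (fun x τ hτ => ?_) (fun x τ hτ v => ?_) (fun x => ?_) x
  · have e1 := Complex.continuous_ofReal.comp (c0.mul c1)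
    have e2 := Complex.continuous_ofReal.comp
      ((c0.mul (c1.pow 2)).add (((c0.pow 2).mul c2).div_const 2))
    have e3 := Complex.continuous_ofReal.comp (c1.div_const 2)
    exact continuous_mat₂ (continuous_const.mul e1).neg ((continuous_const.mul e2).neg.sub e3)
      ((continuous_const.mul e2).neg.add e3) (continuous_const.mul e1)
  · have d0 := ((hp τ).hasDerivAt y).ofReal_comp
    have d1 := ((hp τ).hasDerivAt_deriv y).ofReal_comp
    rw [← hasDerivWithinAt_univ] at d0 d1 ⊢
    have s2 := d0.pow 2
    have e0 := (s2.const_mul (Complex.I * k)).div_const 2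
    have e1 := ((s2.const_mul (Complex.I * k)).mul d1).div_const 2
    have e2 := d0.div_const 2
    refine (hasDerivWithinAt_mat₂ (e0.neg.sub_const (1 / (4 * Complex.I * k))) (e1.neg.sub e2)
      (e1.neg.add e2) (e0.add_const (1 / (4 * Complex.I * k)))).congr_deriv ?_
    simp only [Pi.pow_apply]
    congr 1 <;> push_cast <;> ring
  · have d1 := (hu.hasDerivWithinAt_deriv ht x hτ).ofReal_comp
    have e1 := (d1.const_mul (Complex.I * k)).neg
    exact hasDerivWithinAt_mat₂ (hasDerivWithinAt_const _ _ _) e1 e1 (hasDerivWithinAt_const _ _ _)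
  · simp only [timeLax, clampTime_of_mem hτ]
    set s := 1 / (4 * Complex.I * k) with hs
    ext i
    fin_cases i
    · simp only [laxU, laxV, ← hs, Fin.zero_eta, Pi.add_apply, mat₂_apply_zero, mat₂_apply_one]
      push_cast
      linear_combination (-2 * ((deriv (fun y => u y τ) x : ℝ) : ℂ) * v 1) * hmul
    · simp only [laxU, laxV, ← hs, Fin.mk_one, Pi.add_apply, mat₂_apply_zero, mat₂_apply_one]
      push_cast
      linear_combination (2 * ((deriv (fun y => u y τ) x : ℝ) : ℂ) * v 0) * hmul
  · have := h0 x
    rw [← hu.initial_eq] at this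
    exact this

/-- The asymptotics of the temporal flow where the solution vanishes: there `V` is diagonal with
entries `∓ 1 / (4ik)`. -/
theorem tendsto_of_isEvolution {k : ℂ} {w : ℝ → ℝ → Fin 2 → ℂ}
    (hw : IsEvolution (timeLax u t k) t w) {l : Filter ℝ} [l.IsCountablyGenerated]
    (hl : ∀ τ, Tendsto (fun x => u x (clampTime t τ)) l (𝓝 0)) {m : ℝ → ℂ} {e : Fin 2 → ℂ}
    (h0 : ∀ i, Tendsto (fun x => m x * w x 0 i) l (𝓝 (e i))) :
    Tendsto (fun x => m x * (Complex.exp (t / (4 * Complex.I * k)) * w x t 0)) l (𝓝 (e 0)) ∧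
    Tendsto (fun x => m x * (Complex.exp (-(t / (4 * Complex.I * k))) * w x t 1)) l
      (𝓝 (e 1)) := by
  set s := 1 / (4 * Complex.I * k) with hs
  have hts : (t : ℂ) / (4 * Complex.I * k) = s * t := by rw [hs]; ring
  obtain ⟨C, hC⟩ := hu.bounded t ht
  have hCb : ∀ x τ, |u x (clampTime t τ)| ≤ C ∧
      |deriv (fun y => u y (clampTime t τ)) x| ≤ C := fun x τ => hC _ (clampTime_mem ht.1 τ) x
  have hC0 : 0 ≤ C := (abs_nonneg _).trans (hCb 0 0).1
  obtain ⟨B, hB0, hB⟩ := hu.exists_norm_timeLax_le ht k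
  have c0 := continuous_clampTime_of_continuousOn hu.continuousOn_u ht
  have c1 := continuous_clampTime_of_continuousOn (g := fun x τ => deriv (fun y => u y τ) x)
    hu.continuousOn_ux ht
  set G := Real.exp (‖s‖ * t) with hG
  have hE : ∀ σ : ℂ, ‖σ‖ = ‖s‖ → ∀ τ ∈ Set.Icc 0 t, ‖Complex.exp (σ * τ)‖ ≤ G := by
    intro σ hσ τ hτ
    rw [Complex.norm_exp]
    refine Real.exp_le_exp.2 ((Complex.re_le_norm _).trans ?_)
    rw [norm_mul, hσ, Complex.norm_real, Real.norm_of_nonneg hτ.1]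
    exact mul_le_mul_of_nonneg_left hτ.2 (norm_nonneg _)
  -- The evolved solution is controlled by its initial value with a factor uniform in `x`.
  obtain ⟨D, hD⟩ : ∃ D, ∀ᶠ x in l, ∀ τ ∈ Set.Icc 0 t, ∀ i, ‖m x * w x τ i‖ ≤ D := by
    have hv : Tendsto (fun x => m x • w x 0) l (𝓝 e) := tendsto_pi_nhds.2 h0
    have hev := hv.norm.eventually_le_const (lt_add_one ‖e‖)
    refine ⟨(‖e‖ + 1) * Real.exp (B * t), hev.mono fun x hx τ hτ i => ?_⟩
    have h1 := (hw.const_smul (m x)).norm_le hB0 (x := x) (fun τ _ => hB x τ) τ hτ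
    exact (norm_le_pi_norm (m x • w x τ) i).trans
      (h1.trans (mul_le_mul_of_nonneg_right hx (Real.exp_pos _).le))
  -- Variation of constants for one component, with a remainder that tends to zero pointwise.
  have main : ∀ (i : Fin 2) (σ : ℂ) (α β : ℝ × ℝ → ℂ), ‖σ‖ = ‖s‖ → Continuous α → Continuous β →
      (∃ A, ∀ y p : ℝ, |y| ≤ C → |p| ≤ C → ‖α (y, p)‖ ≤ A * |y| ∧ ‖β (y, p)‖ ≤ A * |y|) →
      (∀ x, ∀ τ ∈ Set.Icc 0 t, timeLax u t k x τ (w x τ) i = -σ * w x τ i +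
        (α (u x (clampTime t τ), deriv (fun y => u y (clampTime t τ)) x) * w x τ 0 +
          β (u x (clampTime t τ), deriv (fun y => u y (clampTime t τ)) x) * w x τ 1)) →
      Tendsto (fun x => m x * (Complex.exp (σ * t) * w x t i)) l (𝓝 (e i)) := by
    rintro i σ α β hσ hα hβ ⟨A, hA⟩ hV
    set R : ℝ → ℝ → ℂ := fun x τ => Complex.exp (σ * τ) *
      (α (u x (clampTime t τ), deriv (fun y => u y (clampTime t τ)) x) * w x τ 0 +
        β (u x (clampTime t τ), deriv (fun y => u y (clampTime t τ)) x) * w x τ 1) with hR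
    have hwc : ∀ i, Continuous fun z : ℝ × ℝ => w z.1 z.2 i := fun i =>
      (continuous_apply i).comp hw.continuous
    have hRc : Continuous fun z : ℝ × ℝ => R z.1 z.2 :=
      (Complex.continuous_exp.comp (continuous_const.mul
        (Complex.continuous_ofReal.comp continuous_snd))).mul
        (((hα.comp (c0.prodMk c1)).mul (hwc 0)).add ((hβ.comp (c0.prodMk c1)).mul (hwc 1)))
    have hd : ∀ x, ∀ τ ∈ Set.Icc 0 t, HasDerivWithinAt (fun τ : ℝ => Complex.exp (σ * τ) * w x τ i)
        (R x τ) (Set.Icc 0 t) τ := by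
      intro x τ hτ
      have e1 : HasDerivAt (fun τ : ℝ => Complex.exp (σ * τ)) (Complex.exp (σ * τ) * (σ * 1)) τ :=
        ((hasDerivAt_id τ).ofReal_comp.const_mul σ).cexp
      have e2 := hasDerivWithinAt_pi.1 (hw.hasDerivWithinAt x τ hτ) i
      refine (e1.hasDerivWithinAt.mul e2).congr_deriv ?_
      rw [hV x τ hτ]
      ring
    have hint : ∀ x, ∫ τ in 0..t, R x τ = Complex.exp (σ * t) * w x t i - w x 0 i := by
      intro x
      have := intervalIntegral.integral_eq_sub_of_hasDeriv_right_of_le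
        (f := fun τ : ℝ => Complex.exp (σ * τ) * w x τ i) ht.1
        (fun τ hτ => (hd x τ hτ).continuousWithinAt) (fun τ hτ =>
          ((hd x τ (Set.Ioo_subset_Icc_self hτ)).hasDerivAt
            (Icc_mem_nhds hτ.1 hτ.2)).hasDerivWithinAt)
        ((hRc.comp (Continuous.prodMk_right x)).intervalIntegrable _ _)
      simpa using this
    have hRb : ∀ᶠ x in l, ∀ τ ∈ Set.Icc 0 t, ‖m x * R x τ‖ ≤
        G * (2 * (A * |u x (clampTime t τ)| * D)) := by
      filter_upwards [hD] with x hx τ hτ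
      obtain ⟨a1, a2⟩ := hA _ _ (hCb x τ).1 (hCb x τ).2
      have e1 : m x * R x τ = Complex.exp (σ * τ) *
        (α (u x (clampTime t τ), deriv (fun y => u y (clampTime t τ)) x) * (m x * w x τ 0) +
          β (u x (clampTime t τ), deriv (fun y => u y (clampTime t τ)) x) * (m x * w x τ 1)) := by
        simp only [hR]; ring
      rw [e1, norm_mul]
      refine mul_le_mul (hE σ hσ τ hτ) ((norm_add_le _ _).trans ?_) (norm_nonneg _)
        (Real.exp_pos _).le
      rw [norm_mul (α _), norm_mul (β _), two_mul]
      exact add_le_add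
        (mul_le_mul a1 (hx τ hτ 0) (norm_nonneg _) ((norm_nonneg _).trans a1))
        (mul_le_mul a2 (hx τ hτ 1) (norm_nonneg _) ((norm_nonneg _).trans a2))
    have hlim : Tendsto (fun x => ∫ τ in 0..t, m x * R x τ) l (𝓝 0) := by
      have := intervalIntegral.tendsto_integral_filter_of_dominated_convergence (μ := volume)
        (a := 0) (b := t) (F := fun x τ => m x * R x τ) (f := fun _ => 0) (l := l)
        (fun _ => G * (2 * (|A| * C * |D|)))
        (Eventually.of_forall fun y =>
          (continuous_const.mul (hRc.comp (Continuous.prodMk_right y))).aestronglyMeasurable)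
        (hRb.mono fun x hx => Eventually.of_forall fun τ hτ => by
          rw [Set.uIoc_of_le ht.1] at hτ
          refine (hx τ (Set.Ioc_subset_Icc_self hτ)).trans ?_
          have := (hCb x τ).1
          have h1 := le_abs_self A
          have h2 := le_abs_self D
          have h4 : A * |u x (clampTime t τ)| ≤ |A| * C :=
            mul_le_mul h1 this (abs_nonneg _) (abs_nonneg _)
          have h5 : A * |u x (clampTime t τ)| * D ≤ |A| * C * |D| := by
            refine (le_abs_self _).trans ?_
            rw [abs_mul, abs_mul, abs_abs]
            gcongr
          have : 0 ≤ G := (Real.exp_pos _).le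
          gcongr)
        intervalIntegrable_const
        (Eventually.of_forall fun τ hτ => by
          rw [Set.uIoc_of_le ht.1] at hτ
          refine squeeze_zero_norm' (hRb.mono fun x hx => hx τ (Set.Ioc_subset_Icc_self hτ)) ?_
          have := ((((hl τ).abs.const_mul A).mul_const D).const_mul 2).const_mul G
          simpa using this)
      simpa using this
    have := hlim.add (h0 i)
    rw [zero_add] at this
    refine this.congr fun x => ?_
    rw [intervalIntegral.integral_const_mul, hint x]
    ring
  -- The terms of `V` other than `∓ 1 / (4ik)` are bounded by a multiple of `|u|`.
  have hbd : ∀ (y p : ℝ), |y| ≤ C → |p| ≤ C →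
      ‖Complex.I * k * (y : ℂ) ^ 2 / 2‖ ≤ (‖k‖ * C + ‖k‖ * C * C + 1) * |y| ∧
      ‖Complex.I * k * (y : ℂ) ^ 2 * p / 2‖ + ‖(y : ℂ) / 2‖ ≤
        (‖k‖ * C + ‖k‖ * C * C + 1) * |y| := by
    intro y p hy hp
    simp only [norm_mul, norm_div, norm_pow, Complex.norm_I, one_mul, Complex.norm_real,
      Real.norm_eq_abs, Complex.norm_ofNat]
    have hn := norm_nonneg k
    have ha := abs_nonneg y
    have h1 : ‖k‖ * |y| ^ 2 ≤ ‖k‖ * C * |y| := by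
      rw [sq, mul_assoc]
      exact mul_le_mul_of_nonneg_left (mul_le_mul_of_nonneg_right hy ha) hn
    have h2 : ‖k‖ * |y| ^ 2 * |p| ≤ ‖k‖ * C * |y| * C :=
      mul_le_mul h1 hp (abs_nonneg _) (by positivity)
    have h3 : 0 ≤ ‖k‖ * C * |y| := by positivity
    have h4 : 0 ≤ ‖k‖ * C * |y| * C := by positivity
    constructor <;> nlinarith
  rw [hts]
  constructor
  · refine main 0 s (fun z => -(Complex.I * k * (z.1 : ℂ) ^ 2 / 2))
      (fun z => -(Complex.I * k * (z.1 : ℂ) ^ 2 * z.2 / 2) - z.1 / 2) rfl (by fun_prop)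
      (by fun_prop) ⟨‖k‖ * C + ‖k‖ * C * C + 1, fun y p hy hp => ⟨?_, ?_⟩⟩ fun x τ _ => ?_
    · rw [norm_neg]
      exact (hbd y p hy hp).1
    · exact ((norm_sub_le _ _).trans (by rw [norm_neg])).trans (hbd y p hy hp).2
    · simp only [timeLax, laxV, mat₂_apply_zero, ← hs]
      ring
  · rw [← neg_mul]
    refine main 1 (-s) (fun z => -(Complex.I * k * (z.1 : ℂ) ^ 2 * z.2 / 2) + z.1 / 2)
      (fun z => Complex.I * k * (z.1 : ℂ) ^ 2 / 2) (norm_neg s) (by fun_prop)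
      (by fun_prop) ⟨‖k‖ * C + ‖k‖ * C * C + 1, fun y p hy hp => ⟨?_, ?_⟩⟩ fun x τ _ => ?_
    · exact ((norm_add_le _ _).trans (by rw [norm_neg])).trans (hbd y p hy hp).2
    · exact (hbd y p hy hp).1
    · simp only [timeLax, laxV, mat₂_apply_one, ← hs]
      ring

end IsDecayingSolution

end ShortPulse

/-! ### Time evolution of the scattering data -/

namespace ShortPulse

open ComplexConjugate

theorem eq_of_hasDerivWithinAt_zero {E : Type*} [NormedAddCommGroup E] [NormedSpace ℝ E] {f : ℝ → E}
    {t : ℝ} (ht : 0 ≤ t) (hf : ∀ τ ∈ Set.Icc 0 t, HasDerivWithinAt f 0 (Set.Icc 0 t) τ) :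
    f t = f 0 :=
  constant_of_has_deriv_right_zero (fun τ hτ => (hf τ hτ).continuousWithinAt)
    (fun τ hτ => (hf τ ⟨hτ.1, hτ.2.le⟩).mono_of_mem_nhdsWithin (Icc_mem_nhdsGE_of_mem hτ)) t
    ⟨ht, le_rfl⟩

namespace IsDecayingSolution

variable {T : EReal} {u₀ : ℝ → ℝ} {u : ℝ → ℝ → ℝ} (hu : IsDecayingSolution T u₀ u) {t : ℝ}
  (ht : t ∈ timeDomain T)
include hu ht

theorem isProfile_initial : IsProfile u₀ := by
  rw [← hu.initial_eq]
  exact hu.isProfile (mem_timeDomain_of_le ht ⟨le_rfl, ht.1⟩)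

/-- The phases at times `0` and `t` agree at both ends of the line; at `-∞` this is the
conservation of the length defect. -/
theorem tendsto_exp_mul_xhat_sub {l : Filter ℝ} (σ : ℂ) (hl : l = atBot ∨ l = atTop) :
    Tendsto (fun x => Complex.exp (σ * ((xhat (fun y => u y t) x - xhat u₀ x : ℝ) : ℂ))) l
      (𝓝 1) := by
  have h0 := hu.isProfile_initial ht
  have h1 := hu.isProfile ht
  have : Tendsto (fun x => xhat (fun y => u y t) x - xhat u₀ x) l (𝓝 0) := by
    rcases hl with rfl | rfl
    · have := h1.tendsto_xhat_sub_atBot.sub h0.tendsto_xhat_sub_atBot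
      rw [hu.lengthDefect_eq ht, sub_self] at this
      exact this.congr fun x => by ring
    · have := h1.tendsto_xhat_sub_atTop.sub h0.tendsto_xhat_sub_atTop
      rw [sub_self] at this
      exact this.congr fun x => by ring
  have hc : Continuous fun y : ℝ => Complex.exp (σ * y) := by fun_prop
  simpa [Function.comp_def] using (hc.tendsto 0).comp this

/-- The temporal flow of `laxMinus` stays a multiple of `laxMinus`: it solves the spatial equation
by zero curvature, and its asymptotics at `-∞` determine the factor. -/
theorem eq_laxMinus_of_isEvolution {k : ℂ} (hk : 0 ≤ k.im) (hk0 : k ≠ 0) {w : ℝ → ℝ → Fin 2 → ℂ}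
    (hw : IsEvolution (timeLax u t k) t w) (h0 : ∀ x, w x 0 = laxMinus u₀ k x) (x : ℝ) :
    w x t = Complex.exp (-(t / (4 * Complex.I * k))) • laxMinus (fun y => u y t) k x := by
  have hp0 := hu.isProfile_initial ht
  have hp := hu.isProfile ht
  obtain ⟨l0, l1⟩ := hu.tendsto_of_isEvolution ht hw (l := atBot)
    (fun τ => (hu.isProfile (clampTime_mem_timeDomain ht τ)).tendsto_atBot)
    (m := fun x => Complex.exp (Complex.I * k * xhat u₀ x)) (e := ![1, 0])
    (fun i => by simpa only [h0] using hp0.tendsto_laxMinus hk i)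
  have hx := hu.tendsto_exp_mul_xhat_sub ht (Complex.I * k) (Or.inl rfl)
  have he : ∀ x, Complex.exp (Complex.I * k * xhat (fun y => u y t) x) =
      Complex.exp (Complex.I * k * ((xhat (fun y => u y t) x - xhat u₀ x : ℝ) : ℂ)) *
        Complex.exp (Complex.I * k * xhat u₀ x) := fun x => by
    rw [← Complex.exp_add]
    push_cast
    ring_nf
  have hd := hu.hasDerivAt_of_isEvolution ht hk0 hw fun x => by
    simp only [h0]
    exact hp0.hasDerivAt_laxMinus hk x
  have hmain := hp.eq_laxMinus hk
    (ψ := fun x => Complex.exp (t / (4 * Complex.I * k)) • w x t)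
    (fun x => by
      rw [map_smul]
      exact (hd x).const_smul (Complex.exp (t / (4 * Complex.I * k)))) (fun i => by
      fin_cases i
      · refine (hx.mul l0).congr (fun x => ?_) |>.trans_eq (by simp)
        rw [he]
        simp only [Fin.zero_eta, Pi.smul_apply, smul_eq_mul]
        ring
      -- The limit is zero, so the mismatched exponential factor is harmless.
      · refine ((hx.mul l1).const_mul (Complex.exp (t / (4 * Complex.I * k)) *
          Complex.exp (t / (4 * Complex.I * k)))).congr (fun x => ?_) |>.trans_eq (by simp)
        rw [he, Complex.exp_neg]
        simp only [Fin.mk_one, Pi.smul_apply, smul_eq_mul]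
        field_simp)
  rw [← hmain, smul_smul, ← Complex.exp_add, neg_add_cancel, Complex.exp_zero, one_smul]

/-- The analogue of `eq_laxMinus_of_isEvolution` at `+∞`. -/
theorem eq_laxPlus_of_isEvolution {k : ℂ} (hk : 0 ≤ k.im) (hk0 : k ≠ 0) {w : ℝ → ℝ → Fin 2 → ℂ}
    (hw : IsEvolution (timeLax u t k) t w) (h0 : ∀ x, w x 0 = laxPlus u₀ k x) (x : ℝ) :
    w x t = Complex.exp (t / (4 * Complex.I * k)) • laxPlus (fun y => u y t) k x := by
  have hp0 := hu.isProfile_initial ht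
  have hp := hu.isProfile ht
  obtain ⟨l0, l1⟩ := hu.tendsto_of_isEvolution ht hw (l := atTop)
    (fun τ => (hu.isProfile (clampTime_mem_timeDomain ht τ)).tendsto_atTop)
    (m := fun x => Complex.exp (-(Complex.I * k) * xhat u₀ x)) (e := ![0, 1])
    (fun i => by simpa only [h0] using hp0.tendsto_laxPlus hk i)
  have hx := hu.tendsto_exp_mul_xhat_sub ht (-(Complex.I * k)) (Or.inr rfl)
  have he : ∀ x, Complex.exp (-(Complex.I * k) * xhat (fun y => u y t) x) =
      Complex.exp (-(Complex.I * k) * ((xhat (fun y => u y t) x - xhat u₀ x : ℝ) : ℂ)) *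
        Complex.exp (-(Complex.I * k) * xhat u₀ x) := fun x => by
    rw [← Complex.exp_add]
    push_cast
    ring_nf
  have hd := hu.hasDerivAt_of_isEvolution ht hk0 hw fun x => by
    simp only [h0]
    exact hp0.hasDerivAt_laxPlus hk x
  have hmain := hp.eq_laxPlus hk
    (ψ := fun x => Complex.exp (-(t / (4 * Complex.I * k))) • w x t)
    (fun x => by
      rw [map_smul]
      exact (hd x).const_smul (Complex.exp (-(t / (4 * Complex.I * k))))) (fun i => by
      fin_cases i
      · refine ((hx.mul l0).const_mul (Complex.exp (-(t / (4 * Complex.I * k))) *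
          Complex.exp (-(t / (4 * Complex.I * k))))).congr (fun x => ?_) |>.trans_eq (by simp)
        rw [he, Complex.exp_neg]
        simp only [Fin.zero_eta, Pi.smul_apply, smul_eq_mul]
        field_simp
      · refine (hx.mul l1).congr (fun x => ?_) |>.trans_eq (by simp)
        rw [he]
        simp only [Fin.mk_one, Pi.smul_apply, smul_eq_mul]
        ring)
  rw [← hmain, smul_smul, ← Complex.exp_add, add_neg_cancel, Complex.exp_zero, one_smul]

theorem exists_evolution_laxMinus {k : ℂ} (hk : 0 ≤ k.im) (hk0 : k ≠ 0) :
    ∃ w, IsEvolution (timeLax u t k) t w ∧ (∀ x, w x 0 = laxMinus u₀ k x) ∧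
      ∀ x, w x t = Complex.exp (-(t / (4 * Complex.I * k))) • laxMinus (fun y => u y t) k x := by
  obtain ⟨C, hC0, hC⟩ := hu.exists_norm_timeLax_le ht k
  obtain ⟨w, hw, h0⟩ := IsEvolution.exists_of_bound (hu.continuous_timeLax ht k)
    (fun x τ _ => hC x τ) ht.1 (continuous_iff_continuousAt.2 fun x =>
      ((hu.isProfile_initial ht).hasDerivAt_laxMinus hk x).continuousAt)
  exact ⟨w, hw, h0, hu.eq_laxMinus_of_isEvolution ht hk hk0 hw h0⟩

theorem exists_evolution_laxPlus {k : ℂ} (hk : 0 ≤ k.im) (hk0 : k ≠ 0) :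
    ∃ w, IsEvolution (timeLax u t k) t w ∧ (∀ x, w x 0 = laxPlus u₀ k x) ∧
      ∀ x, w x t = Complex.exp (t / (4 * Complex.I * k)) • laxPlus (fun y => u y t) k x := by
  obtain ⟨C, hC0, hC⟩ := hu.exists_norm_timeLax_le ht k
  obtain ⟨w, hw, h0⟩ := IsEvolution.exists_of_bound (hu.continuous_timeLax ht k)
    (fun x τ _ => hC x τ) ht.1 (continuous_iff_continuousAt.2 fun x =>
      ((hu.isProfile_initial ht).hasDerivAt_laxPlus hk x).continuousAt)
  exact ⟨w, hw, h0, hu.eq_laxPlus_of_isEvolution ht hk hk0 hw h0⟩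

/-- Since `V` is traceless, the Wronskian of the evolved Lax solutions is constant in time; their
exponential factors cancel in it. -/
theorem a_eq_of_ne_zero {k : ℂ} (hk : 0 ≤ k.im) (hk0 : k ≠ 0) :
    a (fun y => u y t) k = a u₀ k := by
  obtain ⟨v, hv, v0, vt⟩ := hu.exists_evolution_laxMinus ht hk hk0
  obtain ⟨w, hw, w0, wt⟩ := hu.exists_evolution_laxPlus ht hk hk0
  have hd := eq_of_hasDerivWithinAt_zero (f := fun τ => v 0 τ 0 * w 0 τ 1 - v 0 τ 1 * w 0 τ 0) ht.1
    fun τ hτ => by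
      have e := hasDerivWithinAt_pi.1 (hv.hasDerivWithinAt 0 τ hτ)
      have d := hasDerivWithinAt_pi.1 (hw.hasDerivWithinAt 0 τ hτ)
      refine (((e 0).mul (d 1)).sub ((e 1).mul (d 0))).congr_deriv ?_
      simp only [timeLax, laxV, mat₂_apply_zero, mat₂_apply_one]
      ring
  have he : Complex.exp (-(t / (4 * Complex.I * k))) * Complex.exp (t / (4 * Complex.I * k)) = 1 := by
    rw [← Complex.exp_add, neg_add_cancel, Complex.exp_zero]
  rw [(hu.isProfile ht).a_eq_lax hk 0, (hu.isProfile_initial ht).a_eq_lax hk 0, ← v0, ← w0]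
  refine Eq.trans ?_ hd
  simp only [vt, wt, Pi.smul_apply, smul_eq_mul]
  linear_combination (-(laxMinus (fun y => u y t) k 0 0 * laxPlus (fun y => u y t) k 0 1) +
    laxMinus (fun y => u y t) k 0 1 * laxPlus (fun y => u y t) k 0 0) * he

/-- The spectral function `a` does not depend on time; the value at `k = 0` follows by
continuity. -/
theorem a_conserved {k : ℂ} (hk : 0 ≤ k.im) : a (fun y => u y t) k = a u₀ k := by
  by_cases hk0 : k = 0
  · subst hk0
    have hne : (𝓝[{k : ℂ | 0 < k.im}] (0 : ℂ)).NeBot := by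
      rw [← mem_closure_iff_nhdsWithin_neBot, Complex.closure_setOfPred_lt_im]
      simp
    have hsub : {k : ℂ | 0 < k.im} ⊆ {k : ℂ | 0 ≤ k.im} := fun k (hk : 0 < k.im) => hk.le
    have h1 := ((hu.isProfile ht).continuousOn_a 0 hk).tendsto.mono_left (nhdsWithin_mono 0 hsub)
    have h2 := ((hu.isProfile_initial ht).continuousOn_a 0 hk).tendsto.mono_left
      (nhdsWithin_mono 0 hsub)
    refine tendsto_nhds_unique h1 (h2.congr' ?_)
    filter_upwards [self_mem_nhdsWithin] with k (hk : 0 < k.im)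
    exact (hu.a_eq_of_ne_zero ht hk.le (by rintro rfl; simp at hk)).symm
  · exact hu.a_eq_of_ne_zero ht hk hk0

/-- The time dependence of the spectral function `b`. -/
theorem b_evolution {k : ℝ} (hk0 : k ≠ 0) :
    b u₀ k = Complex.exp (2 * (t / (4 * Complex.I * k))) * b (fun y => u y t) k := by
  have hk := ofReal_im_nonneg k
  have hk0' : (k : ℂ) ≠ 0 := Complex.ofReal_ne_zero.2 hk0
  obtain ⟨v, hv, v0, vt⟩ := hu.exists_evolution_laxMinus ht hk hk0'
  obtain ⟨w, hw, w0, wt⟩ := hu.exists_evolution_laxPlus ht hk hk0'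
  have hI : conj (1 / (4 * Complex.I * (k : ℂ))) = -(1 / (4 * Complex.I * k)) := by
    simp only [map_div₀, map_mul, map_one, Complex.conj_ofReal, Complex.conj_I, map_ofNat]
    rw [mul_neg, neg_mul, div_neg]
  have hd := eq_of_hasDerivWithinAt_zero
    (f := fun τ => w 0 τ 0 * conj (v 0 τ 0) + w 0 τ 1 * conj (v 0 τ 1)) ht.1
    fun τ hτ => by
      have e := hasDerivWithinAt_pi.1 (hv.hasDerivWithinAt 0 τ hτ)
      have d := hasDerivWithinAt_pi.1 (hw.hasDerivWithinAt 0 τ hτ)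
      refine (((d 0).mul (e 0).star).add ((d 1).mul (e 1).star)).congr_deriv ?_
      simp only [timeLax, laxV, mat₂_apply_zero, mat₂_apply_one, ← starRingEnd_apply, map_add,
        map_sub, map_neg, map_mul, map_pow, hI, Complex.conj_I, Complex.conj_ofReal, map_div₀,
        map_ofNat]
      ring
  have he : conj (Complex.exp (-(t / (4 * Complex.I * k)))) =
      Complex.exp (t / (4 * Complex.I * k)) := by
    rw [← Complex.exp_conj, map_neg, div_eq_mul_one_div, map_mul, hI, Complex.conj_ofReal]
    ring_nf
  have he2 : Complex.exp (2 * (t / (4 * Complex.I * k))) =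
      Complex.exp (t / (4 * Complex.I * k)) * Complex.exp (t / (4 * Complex.I * k)) := by
    rw [← Complex.exp_add, two_mul]
  rw [(hu.isProfile ht).b_eq_lax k 0, (hu.isProfile_initial ht).b_eq_lax k 0, ← v0, ← w0]
  refine hd.symm.trans ?_
  simp only [vt, wt, Pi.smul_apply, smul_eq_mul, map_mul, he, he2]
  ring

/-- The time dependence of the proportionality constant `chi` at a zero of `a`. -/
theorem laxMinus_eq_chi_smul {k : ℂ} (hk : 0 ≤ k.im) (hk0 : k ≠ 0) (ha : a u₀ k = 0) (x : ℝ) :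
    laxMinus (fun y => u y t) k x =
      (chi u₀ k * Complex.exp (2 * (t / (4 * Complex.I * k)))) • laxPlus (fun y => u y t) k x := by
  obtain ⟨w, hw, w0, wt⟩ := hu.exists_evolution_laxPlus ht hk hk0
  have h1 := hu.eq_laxMinus_of_isEvolution ht hk hk0 (hw.const_smul (chi u₀ k)) (fun x => by
    rw [w0, (hu.isProfile_initial ht).laxMinus_eq_chi hk ha]) x
  rw [wt, smul_smul] at h1
  have h2 := congrArg (fun v => Complex.exp (t / (4 * Complex.I * k)) • v) h1
  simp only [smul_smul] at h2
  rw [← Complex.exp_add, add_neg_cancel, Complex.exp_zero, one_smul] at h2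
  rw [← h2, two_mul, Complex.exp_add]
  congr 1
  ring

/-- The relation `laxMinus_eq_chi_smul` for the Jost columns themselves, after removal of the
rotation and of the phases. -/
theorem jostMinus_eq_chi_mul {k : ℂ} (hk : 0 ≤ k.im) (hk0 : k ≠ 0) (ha : a u₀ k = 0) (x : ℝ)
    (i : Fin 2) : jostMinus (fun y => u y t) 0 k x i =
      chi u₀ k * Complex.exp (2 * (t / (4 * Complex.I * k)) +
        2 * Complex.I * k * xhat (fun y => u y t) x) * jostPlus (fun y => u y t) 1 k x i := by
  have h := hu.laxMinus_eq_chi_smul ht hk hk0 ha x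
  have e := congrArg (fun r : ℝ => (r : ℂ)) (halfCos_sq_add_halfSin_sq (fun y => u y t) x)
  push_cast at e
  have hE : Complex.exp (Complex.I * k * xhat (fun y => u y t) x) *
      Complex.exp (-(Complex.I * k) * xhat (fun y => u y t) x) = 1 := by
    rw [← Complex.exp_add, neg_mul, add_neg_cancel, Complex.exp_zero]
  have hE2 : Complex.exp (2 * (t / (4 * Complex.I * k)) +
        2 * Complex.I * k * xhat (fun y => u y t) x) =
      Complex.exp (2 * (t / (4 * Complex.I * k))) *
      (Complex.exp (Complex.I * k * xhat (fun y => u y t) x) *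
        Complex.exp (Complex.I * k * xhat (fun y => u y t) x)) := by
    rw [← Complex.exp_add, ← Complex.exp_add]
    ring_nf
  rw [hE2]
  -- The rotation is removed by multiplying with its transpose.
  have g0 : rotate (fun y => u y t) x (jostMinus (fun y => u y t) 0 k x) =
      (chi u₀ k * (Complex.exp (2 * (t / (4 * Complex.I * k))) *
      (Complex.exp (Complex.I * k * xhat (fun y => u y t) x) *
        Complex.exp (Complex.I * k * xhat (fun y => u y t) x)))) •
        rotate (fun y => u y t) x (jostPlus (fun y => u y t) 1 k x) := by
    have h2 := congrArg (fun v => Complex.exp (Complex.I * k * xhat (fun y => u y t) x) • v) h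
    simp only [laxMinus, laxPlus, smul_smul, hE, one_smul] at h2
    rw [h2]
    congr 1
    ring
  have r0 := congrFun g0 0
  have r1 := congrFun g0 1
  simp only [rotate, Pi.smul_apply, smul_eq_mul, Matrix.cons_val_zero,
    Matrix.cons_val_one, Matrix.cons_val_fin_one] at r0 r1
  set X := chi u₀ k * (Complex.exp (2 * (t / (4 * Complex.I * k))) *
      (Complex.exp (Complex.I * k * xhat (fun y => u y t) x) *
        Complex.exp (Complex.I * k * xhat (fun y => u y t) x)))
  fin_cases i
  · simp only [Fin.zero_eta]
    linear_combination (halfCos (fun y => u y t) x : ℂ) * r0 + halfSin (fun y => u y t) x * r1 -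
      (jostMinus (fun y => u y t) 0 k x 0 - X * jostPlus (fun y => u y t) 1 k x 0) * e
  · simp only [Fin.mk_one]
    linear_combination (halfCos (fun y => u y t) x : ℂ) * r1 - halfSin (fun y => u y t) x * r0 -
      (jostMinus (fun y => u y t) 0 k x 1 - X * jostPlus (fun y => u y t) 1 k x 1) * e

end IsDecayingSolution

end ShortPulse

/-! ### The Riemann--Hilbert solution built from the Jost columns -/

namespace ShortPulse

open ComplexConjugate

/-- The conjugation `A ↦ J (conj A) J⁻¹` with `J = (0, 1; -1, 0)`, a ring homomorphism. -/
noncomputable def conjSym (A : Matrix (Fin 2) (Fin 2) ℂ) : Matrix (Fin 2) (Fin 2) ℂ :=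
  !![conj (A 1 1), -conj (A 1 0); -conj (A 0 1), conj (A 0 0)]

theorem conjSym_conjSym (A : Matrix (Fin 2) (Fin 2) ℂ) : conjSym (conjSym A) = A := by
  ext i j
  fin_cases i <;> fin_cases j <;> simp [conjSym]

theorem continuous_conjSym : Continuous conjSym := by
  have h : ∀ i j, Continuous fun A : Matrix (Fin 2) (Fin 2) ℂ => conj (A i j) := fun i j =>
    Complex.continuous_conj.comp ((continuous_apply j).comp (continuous_apply i))
  refine continuous_pi fun i => continuous_pi fun j => ?_
  fin_cases i <;> fin_cases j
  · exact h 1 1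
  · exact (h 1 0).neg
  · exact (h 0 1).neg
  · exact h 0 0

theorem det_conjSym (A : Matrix (Fin 2) (Fin 2) ℂ) : (conjSym A).det = conj A.det := by
  rw [Matrix.det_fin_two, Matrix.det_fin_two]
  simp [conjSym]
  ring

theorem tendsto_matrix {X : Type*} {l : Filter X} {M : X → Matrix (Fin 2) (Fin 2) ℂ}
    {A : Matrix (Fin 2) (Fin 2) ℂ} (h : ∀ i j, Tendsto (fun x => M x i j) l (𝓝 (A i j))) :
    Tendsto M l (𝓝 A) :=
  tendsto_pi_nhds.2 fun i => tendsto_pi_nhds.2 fun j => h i j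

theorem tendsto_conj_lower (s : ℝ) :
    Tendsto conj (𝓝[{k : ℂ | k.im < 0}] (s : ℂ)) (𝓝[{k : ℂ | 0 < k.im}] (s : ℂ)) := by
  refine tendsto_nhdsWithin_of_tendsto_nhds_of_eventually_within _ ?_ ?_
  · have := (Complex.continuous_conj.tendsto (s : ℂ)).mono_left
      (nhdsWithin_le_nhds (s := {k : ℂ | k.im < 0}))
    rwa [Complex.conj_ofReal] at this
  · filter_upwards [self_mem_nhdsWithin] with k (hk : k.im < 0)
    simpa using hk

/-- The matrix `(Φ₋^{(1)} / a, Φ₊^{(2)})` in the upper half-plane. -/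
noncomputable def rhUpper (f : ℝ → ℝ) (x : ℝ) (k : ℂ) : Matrix (Fin 2) (Fin 2) ℂ :=
  !![jostMinus f 0 k x 0 / a f k, jostPlus f 1 k x 0;
    jostMinus f 0 k x 1 / a f k, jostPlus f 1 k x 1]

/-- The solution of the Riemann--Hilbert problem built from the Jost columns, continued to the
lower half-plane by conjugation. -/
noncomputable def rhSolution (f : ℝ → ℝ) (x : ℝ) (k : ℂ) : Matrix (Fin 2) (Fin 2) ℂ :=
  if 0 < k.im then rhUpper f x k else conjSym (rhUpper f x (conj k))

theorem rhSolution_of_pos {f : ℝ → ℝ} {x : ℝ} {k : ℂ} (hk : 0 < k.im) :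
    rhSolution f x k = rhUpper f x k := if_pos hk

/-- The conjugation symmetry `M(k) = J conj(M(conj k)) J⁻¹`. -/
theorem rhSolution_eq_conjSym (f : ℝ → ℝ) (x : ℝ) {k : ℂ} (hk : k.im ≠ 0) :
    rhSolution f x k = conjSym (rhSolution f x (conj k)) := by
  rcases lt_or_gt_of_ne hk with h | h
  · rw [rhSolution, if_neg h.not_gt, rhSolution, if_pos (by simpa using h)]
  · rw [rhSolution, if_pos h, rhSolution, if_neg (by simpa using h.le), conjSym_conjSym,
      Complex.conj_conj]

theorem rhSolution_of_neg {f : ℝ → ℝ} {x : ℝ} {k : ℂ} (hk : k.im < 0) :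
    rhSolution f x k = conjSym (rhUpper f x (conj k)) := if_neg hk.not_gt

theorem rhUpper_apply_zero (f : ℝ → ℝ) (x : ℝ) (k : ℂ) (i : Fin 2) :
    rhUpper f x k i 0 = jostMinus f 0 k x i / a f k := by
  fin_cases i <;> simp [rhUpper]

theorem rhUpper_apply_one (f : ℝ → ℝ) (x : ℝ) (k : ℂ) (i : Fin 2) :
    rhUpper f x k i 1 = jostPlus f 1 k x i := by
  fin_cases i <;> simp [rhUpper]

theorem isOpen_upperHalf : IsOpen {k : ℂ | 0 < k.im} :=
  isOpen_lt continuous_const Complex.continuous_im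

theorem isOpen_lowerHalf : IsOpen {k : ℂ | k.im < 0} :=
  isOpen_lt Complex.continuous_im continuous_const

theorem differentiableAt_conj_comp {g : ℂ → ℂ} {k : ℂ} (hg : DifferentiableAt ℂ g (conj k)) :
    DifferentiableAt ℂ (fun k => conj (g (conj k))) k := by
  have := hg.star_star
  rwa [← starRingEnd_apply, Complex.conj_conj] at this

namespace IsProfile

variable {f : ℝ → ℝ} (h : IsProfile f)
include h

/-- The determinant is the Wronskian of the Jost columns divided by `a`. -/
theorem det_rhSolution (x : ℝ) {k : ℂ} (hk : k.im ≠ 0) (hk1 : k ∉ zeros f)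
    (hk2 : conj k ∉ zeros f) : (rhSolution f x k).det = 1 := by
  have key : ∀ k : ℂ, 0 < k.im → k ∉ zeros f → (rhUpper f x k).det = 1 := by
    intro k hk hz
    have ha : a f k ≠ 0 := fun ha => hz ⟨hk, ha⟩
    rw [Matrix.det_fin_two]
    simp only [rhUpper_apply_zero, rhUpper_apply_one]
    have := h.a_eq hk.le x
    field_simp
    rw [this]
    ring
  rcases lt_or_gt_of_ne hk with hn | hp
  · rw [rhSolution, if_neg hn.not_gt, det_conjSym, key _ (by simpa using hn) hk2, map_one]
  · rw [rhSolution_of_pos hp, key k hp hk1]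

theorem differentiableAt_rhSolution_zero (x : ℝ) (i : Fin 2) {k : ℂ} (hk : k.im ≠ 0)
    (hz : k ∉ zeros f) : DifferentiableAt ℂ (fun k => rhSolution f x k i 0) k := by
  rcases lt_or_gt_of_ne hk with hn | hp
  · have hc : 0 < (conj k).im := by simpa using hn
    have hd : ∀ i, DifferentiableAt ℂ (fun k => conj (jostPlus f 1 (conj k) x i)) k := fun i =>
      differentiableAt_conj_comp ((h.differentiableOn_jostPlus x i).differentiableAt
        (isOpen_upperHalf.mem_nhds hc))
    have hev : ∀ᶠ k in 𝓝 k, k.im < 0 := isOpen_lowerHalf.mem_nhds hn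
    fin_cases i
    · refine (hd 1).congr_of_eventuallyEq (hev.mono fun k hk => ?_)
      simp [rhSolution_of_neg hk, conjSym, rhUpper_apply_one]
    · refine (hd 0).neg.congr_of_eventuallyEq (hev.mono fun k hk => ?_)
      simp [rhSolution_of_neg hk, conjSym, rhUpper_apply_one]
  · have ha : a f k ≠ 0 := fun ha => hz ⟨hp, ha⟩
    have hm := isOpen_upperHalf.mem_nhds hp
    refine (((h.differentiableOn_jostMinus x i).differentiableAt hm).div
      (h.differentiableOn_a.differentiableAt hm) ha).congr_of_eventuallyEq ?_
    filter_upwards [hm] with k hk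
    rw [rhSolution_of_pos hk, rhUpper_apply_zero]
    rfl

omit h in
theorem rhSolution_apply_one (x : ℝ) {k : ℂ} (hk : k.im ≠ 0) :
    rhSolution f x k 0 1 = -conj (rhSolution f x (conj k) 1 0) ∧
    rhSolution f x k 1 1 = conj (rhSolution f x (conj k) 0 0) := by
  rw [rhSolution_eq_conjSym f x hk]
  simp [conjSym]

theorem differentiableAt_rhSolution_one (x : ℝ) (i : Fin 2) {k : ℂ} (hk : k.im ≠ 0)
    (hz : conj k ∉ zeros f) : DifferentiableAt ℂ (fun k => rhSolution f x k i 1) k := by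
  have hd : ∀ i, DifferentiableAt ℂ (fun k => conj (rhSolution f x (conj k) i 0)) k := fun i =>
    differentiableAt_conj_comp (h.differentiableAt_rhSolution_zero x i (by simpa using hk) hz)
  have hev : ∀ᶠ k : ℂ in 𝓝 k, k.im ≠ 0 :=
    (isOpen_ne_fun Complex.continuous_im continuous_const).mem_nhds hk
  fin_cases i
  · exact (hd 1).neg.congr_of_eventuallyEq (hev.mono fun k hk => (rhSolution_apply_one x hk).1)
  · exact (hd 0).congr_of_eventuallyEq (hev.mono fun k hk => (rhSolution_apply_one x hk).2)

/-- The residue at a simple zero of `a`, where the two Jost columns are proportional. -/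
theorem tendsto_residue_first {x : ℝ} {z c : ℂ} (hz : z ∈ zeros f) (hs : deriv (a f) z ≠ 0)
    (hc : ∀ i, jostMinus f 0 z x i = deriv (a f) z * c * jostPlus f 1 z x i) (i : Fin 2) :
    Tendsto (fun k => (k - z) * rhSolution f x k i 0) (𝓝[≠] z) (𝓝 (c * rhSolution f x z i 1)) := by
  have hm := isOpen_upperHalf.mem_nhds hz.1
  have h1 := ((h.differentiableOn_a.differentiableAt hm).hasDerivAt).tendsto_slope
  have h2 := ((h.differentiableOn_jostMinus x i).differentiableAt hm).continuousAt.tendsto.mono_left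
    (nhdsWithin_le_nhds (s := {z}ᶜ))
  have h3 := h2.div h1 hs
  rw [hc i] at h3
  rw [rhSolution_of_pos hz.1, rhUpper_apply_one, show c * jostPlus f 1 z x i =
    deriv (a f) z * c * jostPlus f 1 z x i / deriv (a f) z by field_simp]
  refine h3.congr' ?_
  filter_upwards [nhdsWithin_le_nhds hm, self_mem_nhdsWithin] with k hk (hkz : k ≠ z)
  rw [rhSolution_of_pos hk, rhUpper_apply_zero, Pi.div_apply, slope_def_field, hz.2, sub_zero]
  have := sub_ne_zero.2 hkz
  rw [div_div_eq_mul_div]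
  ring

omit h in
/-- The residue condition in the lower half-plane follows from the one in the upper half-plane by
the conjugation symmetry. -/
theorem tendsto_residue_second {x : ℝ} {z c : ℂ} (hz : z ∈ zeros f)
    (hr : ∀ i, Tendsto (fun k => (k - z) * rhSolution f x k i 0) (𝓝[≠] z)
      (𝓝 (c * rhSolution f x z i 1))) (i : Fin 2) :
    Tendsto (fun k => (k - conj z) * rhSolution f x k i 1) (𝓝[≠] (conj z))
      (𝓝 (-conj c * rhSolution f x (conj z) i 0)) := by
  have hcl : Tendsto conj (𝓝[≠] (conj z)) (𝓝[≠] z) := by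
    refine tendsto_nhdsWithin_of_tendsto_nhds_of_eventually_within _ ?_ ?_
    · have := (Complex.continuous_conj.tendsto (conj z)).mono_left
        (nhdsWithin_le_nhds (s := {conj z}ᶜ))
      rwa [Complex.conj_conj] at this
    · filter_upwards [self_mem_nhdsWithin] with k (hk : k ≠ conj z) hkz
      exact hk (by rw [← (hkz : conj k = z), Complex.conj_conj])
  have hev : ∀ᶠ k : ℂ in 𝓝[≠] (conj z), k.im ≠ 0 :=
    nhdsWithin_le_nhds ((isOpen_ne_fun Complex.continuous_im continuous_const).mem_nhds
      (by simpa using hz.1.ne'))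
  have hr' : ∀ i, Tendsto (fun k => conj ((conj k - z) * rhSolution f x (conj k) i 0))
      (𝓝[≠] (conj z)) (𝓝 (conj (c * rhSolution f x z i 1))) := fun i =>
    (Complex.continuous_conj.tendsto _).comp ((hr i).comp hcl)
  obtain ⟨e1, e2⟩ := rhSolution_apply_one (f := f) x hz.1.ne'
  fin_cases i
  · refine ((hr' 1).neg.congr' (hev.mono fun k hk => ?_)).trans_eq ?_
    · simp only [Fin.zero_eta, (rhSolution_apply_one x hk).1, map_mul, map_sub, Complex.conj_conj]
      ring
    · simp only [Fin.zero_eta, e2, map_mul, Complex.conj_conj]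
      ring_nf
  · refine ((hr' 0).congr' (hev.mono fun k hk => ?_)).trans_eq ?_
    · simp only [Fin.mk_one, (rhSolution_apply_one x hk).2, map_mul, map_sub, Complex.conj_conj]
    · simp only [Fin.mk_one, e1, map_mul, map_neg, Complex.conj_conj]
      ring_nf

theorem tendsto_rhUpper (hreal : ∀ s : ℝ, a f s ≠ 0) (x s : ℝ) :
    Tendsto (rhUpper f x) (𝓝[{k : ℂ | 0 < k.im}] (s : ℂ)) (𝓝 (rhUpper f x s)) := by
  have hsub : {k : ℂ | 0 < k.im} ⊆ {k : ℂ | 0 ≤ k.im} := fun k (hk : 0 < k.im) => hk.le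
  have hs := ofReal_im_nonneg s
  refine tendsto_matrix fun i j => ?_
  fin_cases j
  · simp only [Fin.zero_eta, rhUpper_apply_zero]
    exact ((((h.continuousOn_jostMinus x i) s hs).div (h.continuousOn_a s hs) (hreal s)).mono
      hsub).tendsto
  · simp only [Fin.mk_one, rhUpper_apply_one]
    exact (((h.continuousOn_jostPlus x i) s hs).mono hsub).tendsto

theorem tendsto_rhSolution_upper (hreal : ∀ s : ℝ, a f s ≠ 0) (x s : ℝ) :
    Tendsto (rhSolution f x) (𝓝[{k : ℂ | 0 < k.im}] (s : ℂ)) (𝓝 (rhUpper f x s)) := by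
  refine (h.tendsto_rhUpper hreal x s).congr' ?_
  filter_upwards [self_mem_nhdsWithin] with k hk
  exact (rhSolution_of_pos hk).symm

theorem tendsto_rhSolution_lower (hreal : ∀ s : ℝ, a f s ≠ 0) (x s : ℝ) :
    Tendsto (rhSolution f x) (𝓝[{k : ℂ | k.im < 0}] (s : ℂ)) (𝓝 (conjSym (rhUpper f x s))) := by
  refine ((continuous_conjSym.tendsto _).comp
    ((h.tendsto_rhUpper hreal x s).comp (tendsto_conj_lower s))).congr' ?_
  filter_upwards [self_mem_nhdsWithin] with k hk
  exact (rhSolution_of_neg hk).symm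

theorem tendsto_rhSolution_cocompact (x : ℝ) :
    Tendsto (rhSolution f x) (cocompact ℂ ⊓ 𝓟 {k : ℂ | k.im ≠ 0}) (𝓝 1) := by
  have hup : Tendsto (rhUpper f x) (cocompact ℂ ⊓ 𝓟 {k : ℂ | 0 < k.im}) (𝓝 1) := by
    have hle : cocompact ℂ ⊓ 𝓟 {k : ℂ | 0 < k.im} ≤ cocompact ℂ ⊓ 𝓟 {k : ℂ | 0 ≤ k.im} :=
      inf_le_inf_left _ (principal_mono.2 fun k (hk : 0 < k.im) => hk.le)
    have ha := h.tendsto_a_cocompact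
    obtain ⟨m0, m1⟩ := h.tendsto_jostMinus_cocompact x
    obtain ⟨p0, p1⟩ := h.tendsto_jostPlus_cocompact x
    refine Tendsto.mono_left (tendsto_matrix fun i j => ?_) hle
    fin_cases i <;> fin_cases j
    · exact (m0.div ha one_ne_zero).trans_eq (by simp)
    · exact p0.trans_eq (by simp)
    · exact (m1.div ha one_ne_zero).trans_eq (by simp)
    · exact p1.trans_eq (by simp)
  have hset : {k : ℂ | k.im ≠ 0} = {k : ℂ | 0 < k.im} ∪ {k : ℂ | k.im < 0} := by
    ext k
    exact ne_iff_gt_or_lt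
  rw [hset, ← sup_principal, inf_sup_left]
  refine Tendsto.sup ?_ ?_
  · refine hup.congr' ?_
    filter_upwards [mem_inf_of_right (mem_principal_self _)] with k hk
    exact (rhSolution_of_pos hk).symm
  · have hcc : Tendsto conj (cocompact ℂ ⊓ 𝓟 {k : ℂ | k.im < 0})
        (cocompact ℂ ⊓ 𝓟 {k : ℂ | 0 < k.im}) := by
      refine tendsto_inf.2 ⟨?_, ?_⟩
      · exact (Complex.conjLIE.toHomeomorph.isClosedEmbedding.tendsto_cocompact).mono_left inf_le_left
      · refine tendsto_principal.2 ?_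
        filter_upwards [mem_inf_of_right (mem_principal_self _)] with k (hk : k.im < 0)
        simpa using hk
    have h1 : conjSym 1 = 1 := by
      ext i j
      fin_cases i <;> fin_cases j <;> simp [conjSym]
    have := ((continuous_conjSym.tendsto 1).comp (hup.comp hcc))
    rw [h1] at this
    refine this.congr' ?_
    filter_upwards [mem_inf_of_right (mem_principal_self _)] with k hk
    exact (rhSolution_of_neg hk).symm

/-- The jump relation on the real axis: a consequence of the normalization of the Jost columns,
of `|a|² + |b|² = 1`, and of the formula for `b` as a Hermitian product. -/
theorem rhUpper_eq_mul_jump {r : ℝ → ℂ} {x t s : ℝ} (ha : a f s ≠ 0)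
    (hr : r s * Complex.exp (2 * (Complex.I * s * xhat f x + t / (4 * Complex.I * s))) =
      conj (jostPlus f 1 s x 0 * conj (jostMinus f 0 s x 0) +
        jostPlus f 1 s x 1 * conj (jostMinus f 0 s x 1)) / a f s) :
    rhUpper f x s = conjSym (rhUpper f x s) * jump r (xhat f x) t s := by
  set θ : ℂ := Complex.I * s * xhat f x + t / (4 * Complex.I * s) with hθ
  have hm := h.jostMinus_normSq s x
  have hp := h.jostPlus_normSq s x
  have haE := h.a_eq (ofReal_im_nonneg s) x
  have hθc : conj θ = -θ := by
    simp only [hθ, map_add, map_mul, map_div₀, Complex.conj_I, Complex.conj_ofReal, map_ofNat]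
    ring
  have hn : Complex.exp (-θ) * Complex.exp θ = 1 := by
    rw [← Complex.exp_add, neg_add_cancel, Complex.exp_zero]
  have h2 : Complex.exp (2 * θ) = Complex.exp θ * Complex.exp θ := by
    rw [← Complex.exp_add, two_mul]
  set m0 := jostMinus f 0 s x 0
  set m1 := jostMinus f 0 s x 1
  set p0 := jostPlus f 1 s x 0
  set p1 := jostPlus f 1 s x 1
  have haE' : conj (a f s) = conj m0 * conj p1 - conj m1 * conj p0 := by
    rw [haE]
    simp only [map_sub, map_mul]
  have hac : conj (a f s) ≠ 0 := (map_ne_zero _).2 ha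
  have hr1 : r s * (Complex.exp θ * Complex.exp θ) =
      (conj p0 * m0 + conj p1 * m1) / a f s := by
    rw [← h2, hr]
    simp only [map_add, map_mul, Complex.conj_conj]
  have hr2 : conj (r s) * (Complex.exp (-θ) * Complex.exp (-θ)) =
      (p0 * conj m0 + p1 * conj m1) / conj (a f s) := by
    have := congrArg conj hr1
    simp only [map_mul, map_add, map_div₀, ← Complex.exp_conj, hθc, Complex.conj_conj] at this
    exact this
  -- All entries of the jump are expressed by `a`, its conjugate and the Hermitian products of the
  -- Jost columns, so that the relation becomes an algebraic identity.
  have hrr : ((‖r s‖ ^ 2 : ℝ) : ℂ) = (conj p0 * m0 + conj p1 * m1) *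
      (p0 * conj m0 + p1 * conj m1) / (a f s * conj (a f s)) := by
    have e : r s * conj (r s) = ((‖r s‖ ^ 2 : ℝ) : ℂ) := by
      rw [Complex.mul_conj, Complex.normSq_eq_norm_sq]
    rw [← e, mul_div_mul_comm, ← hr1, ← hr2]
    linear_combination (-(r s * conj (r s)) * (Complex.exp (-θ) * Complex.exp θ + 1)) * hn
  have hJ : jump r (xhat f x) t s =
      !![1 + ((‖r s‖ ^ 2 : ℝ) : ℂ), (p0 * conj m0 + p1 * conj m1) / conj (a f s);
        (conj p0 * m0 + conj p1 * m1) / a f s, 1] := by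
    rw [jump, ← hθ, ← hr1, ← hr2]
    ext i j
    fin_cases i <;> fin_cases j <;>
      simp only [J0, expSigma3, Matrix.mul_apply, Fin.sum_univ_two, Matrix.of_apply,
        Matrix.cons_val', Matrix.cons_val_zero, Matrix.cons_val_one, Matrix.cons_val_fin_one,
        Fin.zero_eta, Fin.mk_one, neg_neg]
    · linear_combination (1 + ((‖r s‖ ^ 2 : ℝ) : ℂ)) * hn
    · ring
    · ring
    · linear_combination hn
  -- This is `|a|² + |b|² = 1`.
  have hone : a f s * conj (a f s) +
      (conj p0 * m0 + conj p1 * m1) * (p0 * conj m0 + p1 * conj m1) = 1 := by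
    rw [haE', haE]
    linear_combination (p0 * conj p0 + p1 * conj p1) * hm + hp
  rw [hJ, hrr]
  ext i j
  fin_cases i <;> fin_cases j <;>
    simp only [rhUpper, conjSym, Matrix.mul_apply, Fin.sum_univ_two, Matrix.of_apply,
      Matrix.cons_val', Matrix.cons_val_zero, Matrix.cons_val_one, Matrix.cons_val_fin_one,
      Fin.zero_eta, Fin.mk_one, map_div₀]
  · field_simp
    linear_combination (-conj p1) * hone + m0 * haE' + conj p1 * hm
  · field_simp
    linear_combination p0 * haE' - conj m1 * hp
  · field_simp
    linear_combination conj p0 * hone + m1 * haE' - conj p0 * hm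
  · field_simp
    linear_combination p1 * haE' + conj m0 * hp

end IsProfile

end ShortPulse

/-! ### Expansion at the origin of the spectral plane -/

namespace ShortPulse

open ComplexConjugate

/-- The rotation by the half angle as a matrix. -/
noncomputable def rotMatrix (f : ℝ → ℝ) (x : ℝ) : Matrix (Fin 2) (Fin 2) ℂ :=
  !![(halfCos f x : ℂ), -halfSin f x; halfSin f x, halfCos f x]

theorem det_rotMatrix (f : ℝ → ℝ) (x : ℝ) : (rotMatrix f x).det = 1 := by
  have e := congrArg (fun r : ℝ => (r : ℂ)) (halfCos_sq_add_halfSin_sq f x)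
  push_cast at e
  rw [Matrix.det_fin_two]
  simp only [rotMatrix, Matrix.of_apply, Matrix.cons_val', Matrix.cons_val_zero,
    Matrix.cons_val_one, Matrix.cons_val_fin_one]
  linear_combination e

theorem isUnit_det_rotMatrix (f : ℝ → ℝ) (x : ℝ) : IsUnit (rotMatrix f x).det := by
  rw [det_rotMatrix]
  exact isUnit_one

theorem conjSym_rotMatrix_mul_sub_one (f : ℝ → ℝ) (x : ℝ) (c : ℂ) (A : Matrix (Fin 2) (Fin 2) ℂ) :
    c • (rotMatrix f x * conjSym A - 1) = conjSym (conj c • (rotMatrix f x * A - 1)) := by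
  ext i j
  fin_cases i <;> fin_cases j <;>
    simp only [rotMatrix, conjSym, Matrix.smul_apply, Matrix.sub_apply, Matrix.mul_apply,
      Matrix.one_apply, Fin.sum_univ_two, Matrix.of_apply, Matrix.cons_val', Matrix.cons_val_zero,
      Matrix.cons_val_one, Matrix.cons_val_fin_one, Fin.zero_eta, Fin.mk_one, smul_eq_mul, map_mul,
      map_sub, map_add, map_neg, Complex.conj_ofReal, Complex.conj_conj, if_true, map_one,
      zero_ne_one, one_ne_zero, if_false, map_zero] <;> ring

namespace IsProfile

variable {f : ℝ → ℝ} (h : IsProfile f)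
include h

/-- The zero frame of the reflected profile, in terms of the second column of `Φ₊`. -/
theorem zeroFrame_reflect {k : ℂ} (hk : 0 ≤ k.im) (x : ℝ) :
    zeroFrame (fun x => f (-x)) k (-x) 0 = Complex.exp (Complex.I * k * ((xhat f x - x : ℝ) : ℂ)) *
      (halfSin f x * jostPlus f 1 k x 0 + halfCos f x * jostPlus f 1 k x 1) ∧
    zeroFrame (fun x => f (-x)) k (-x) 1 = Complex.exp (Complex.I * k * ((xhat f x - x : ℝ) : ℂ)) *
      (halfCos f x * jostPlus f 1 k x 0 - halfSin f x * jostPlus f 1 k x 1) := by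
  have he : -(Complex.I * k *
      ((xhat (fun x => f (-x)) (-x) - -x + lengthDefect (fun x => f (-x)) : ℝ) : ℂ)) =
      Complex.I * k * ((xhat f x - x : ℝ) : ℂ) := by
    rw [h.xhat_reflect, lengthDefect_reflect, neg_neg]
    push_cast
    ring
  obtain ⟨e0, e1⟩ := h.jostPlus_eq hk x
  simp only [zeroFrame, he, halfCos_reflect, halfSin_reflect, neg_neg, ← e0, ← e1,
    Matrix.cons_val_zero, Matrix.cons_val_one, Matrix.cons_val_fin_one]
  push_cast
  constructor <;> ring

/-- In the upper half-plane the rotated solution of the Riemann--Hilbert problem is expressed by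
the two frames that are regular at `k = 0`. -/
theorem rotMatrix_mul_rhUpper {k : ℂ} (hk : 0 ≤ k.im) (x : ℝ) :
    rotMatrix f x * rhUpper f x k =
      !![Complex.exp (Complex.I * k * ((xhat f x - x : ℝ) : ℂ)) * zeroFrame f k x 0 /
          (zeroFrame f k x 0 * zeroFrame (fun x => f (-x)) k (-x) 0 -
            zeroFrame f k x 1 * zeroFrame (fun x => f (-x)) k (-x) 1),
        Complex.exp (-(Complex.I * k * ((xhat f x - x : ℝ) : ℂ))) *
          zeroFrame (fun x => f (-x)) k (-x) 1;
        Complex.exp (Complex.I * k * ((xhat f x - x : ℝ) : ℂ)) * zeroFrame f k x 1 /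
          (zeroFrame f k x 0 * zeroFrame (fun x => f (-x)) k (-x) 0 -
            zeroFrame f k x 1 * zeroFrame (fun x => f (-x)) k (-x) 1),
        Complex.exp (-(Complex.I * k * ((xhat f x - x : ℝ) : ℂ))) *
          zeroFrame (fun x => f (-x)) k (-x) 0] := by
  obtain ⟨z0, z1⟩ := h.zeroFrame_reflect hk x
  have e := congrArg (fun r : ℝ => (r : ℂ)) (halfCos_sq_add_halfSin_sq f x)
  push_cast at e
  set δ : ℂ := ((xhat f x - x : ℝ) : ℂ) with hδ
  set F := Complex.exp (Complex.I * k * δ) with hF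
  set G := Complex.exp (Complex.I * k * lengthDefect f) with hG
  have hF0 : F ≠ 0 := Complex.exp_ne_zero _
  have hG0 : G ≠ 0 := Complex.exp_ne_zero _
  have hFi : Complex.exp (-(Complex.I * k * δ)) = F⁻¹ := by rw [Complex.exp_neg]
  have hFG : Complex.exp (-(Complex.I * k * ((xhat f x - x + lengthDefect f : ℝ) : ℂ))) =
      F⁻¹ * G⁻¹ := by
    rw [hF, hG, ← Complex.exp_neg, ← Complex.exp_neg, ← Complex.exp_add, hδ]
    push_cast
    ring_nf
  have y0 : zeroFrame f k x 0 = F⁻¹ * G⁻¹ *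
      (halfCos f x * jostMinus f 0 k x 0 - halfSin f x * jostMinus f 0 k x 1) := by
    simp [zeroFrame, ← hFG]
  have y1 : zeroFrame f k x 1 = F⁻¹ * G⁻¹ *
      (halfSin f x * jostMinus f 0 k x 0 + halfCos f x * jostMinus f 0 k x 1) := by
    simp [zeroFrame, ← hFG]
  have hD : zeroFrame f k x 0 * zeroFrame (fun x => f (-x)) k (-x) 0 -
      zeroFrame f k x 1 * zeroFrame (fun x => f (-x)) k (-x) 1 = G⁻¹ * a f k := by
    rw [y0, y1, z0, z1, h.a_eq hk x]
    field_simp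
    linear_combination (jostMinus f 0 k x 0 * jostPlus f 1 k x 1 -
      jostMinus f 0 k x 1 * jostPlus f 1 k x 0) * e
  have hcol : ∀ y : ℂ, F * (F⁻¹ * G⁻¹ * y) / (G⁻¹ * a f k) = y / a f k := fun y => by
    rw [show F * (F⁻¹ * G⁻¹ * y) = G⁻¹ * y by field_simp, mul_div_mul_left _ _ (inv_ne_zero hG0)]
  rw [hD, hFi, y0, y1, z0, z1]
  ext i j
  fin_cases i <;> fin_cases j <;>
    simp only [rotMatrix, rhUpper, Matrix.mul_apply, Fin.sum_univ_two, Matrix.of_apply,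
      Matrix.cons_val', Matrix.cons_val_zero, Matrix.cons_val_one, Matrix.cons_val_fin_one,
      Fin.zero_eta, Fin.mk_one]
  · rw [hcol]
    ring
  · field_simp
    ring
  · rw [hcol]
    ring
  · field_simp

/-- The expansion from the upper half-plane, obtained by differentiating the entries in
`rotMatrix_mul_rhUpper` at `k = 0`. -/
theorem tendsto_rotMatrix_mul_rhUpper (x : ℝ) :
    Tendsto (fun k : ℂ => (Complex.I / k) • (rotMatrix f x * rhUpper f x k - 1))
      (𝓝[{k : ℂ | 0 < k.im}] 0)
      (𝓝 !![((x - xhat f x : ℝ) : ℂ), (f x : ℂ); (f x : ℂ), -((x - xhat f x : ℝ) : ℂ)]) := by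
  obtain ⟨z, d0, d1⟩ := h.zeroFrame_hasDerivWithinAt x
  obtain ⟨z', d0', d1'⟩ := h.reflect.zeroFrame_hasDerivWithinAt (-x)
  rw [neg_neg] at d1'
  have hz0 : zeroFrame f 0 x 0 = 1 := by rw [z]; rfl
  have hz1 : zeroFrame f 0 x 1 = 0 := by rw [z]; rfl
  have hz0' : zeroFrame (fun x => f (-x)) 0 (-x) 0 = 1 := by rw [z']; rfl
  have hz1' : zeroFrame (fun x => f (-x)) 0 (-x) 1 = 0 := by rw [z']; rfl
  set δ : ℂ := ((xhat f x - x : ℝ) : ℂ) with hδ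
  have hE : HasDerivWithinAt (fun k : ℂ => Complex.exp (Complex.I * k * δ)) (Complex.I * δ)
      {k : ℂ | 0 ≤ k.im} 0 := by
    have h1 : HasDerivAt (fun k : ℂ => Complex.I * k * δ) (Complex.I * 1 * δ) 0 :=
      ((hasDerivAt_id (0 : ℂ)).const_mul Complex.I).mul_const δ
    exact (h1.cexp.congr_deriv (by simp)).hasDerivWithinAt
  have hE' : HasDerivWithinAt (fun k : ℂ => Complex.exp (-(Complex.I * k * δ))) (-(Complex.I * δ))
      {k : ℂ | 0 ≤ k.im} 0 := by
    have h1 : HasDerivAt (fun k : ℂ => -(Complex.I * k * δ)) (-(Complex.I * 1 * δ)) 0 :=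
      (((hasDerivAt_id (0 : ℂ)).const_mul Complex.I).mul_const δ).neg
    exact (h1.cexp.congr_deriv (by simp)).hasDerivWithinAt
  have hD : HasDerivWithinAt (fun k => zeroFrame f k x 0 *
      zeroFrame (fun x => f (-x)) k (-x) 0 -
        zeroFrame f k x 1 * zeroFrame (fun x => f (-x)) k (-x) 1) 0 {k : ℂ | 0 ≤ k.im} 0 :=
    ((d0.mul d0').sub (d1.mul d1')).congr_deriv (by simp [hz0, hz1, hz1'])
  have hD0 : zeroFrame f 0 x 0 * zeroFrame (fun x => f (-x)) 0 (-x) 0 -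
      zeroFrame f 0 x 1 * zeroFrame (fun x => f (-x)) 0 (-x) 1 ≠ 0 := by
    simp [hz0, hz0', hz1]
  have key : ∀ {g : ℂ → ℂ} {g' c : ℂ}, HasDerivWithinAt g g' {k : ℂ | 0 ≤ k.im} 0 → g 0 = c →
      Tendsto (fun k : ℂ => Complex.I / k * (g k - c)) (𝓝[{k : ℂ | 0 < k.im}] 0)
        (𝓝 (Complex.I * g')) := by
    rintro g g' c hg rfl
    have h1 := (hasDerivWithinAt_iff_tendsto_slope'
      (fun h => lt_irrefl (0 : ℝ) h : (0 : ℂ) ∉ {k : ℂ | 0 < k.im})).1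
      (hg.mono (fun k (hk : 0 < k.im) => hk.le : {k : ℂ | 0 < k.im} ⊆ {k : ℂ | 0 ≤ k.im}))
    refine (h1.const_mul Complex.I).congr fun k => ?_
    rw [slope_def_field, sub_zero]
    ring
  have hev : ∀ᶠ k : ℂ in 𝓝[{k : ℂ | 0 < k.im}] 0, 0 ≤ k.im := by
    filter_upwards [self_mem_nhdsWithin] with k (hk : 0 < k.im)
    exact hk.le
  have hI : Complex.I * Complex.I = -1 := Complex.I_mul_I
  refine tendsto_matrix fun i j => ?_
  fin_cases i <;> fin_cases j
  · refine ((key ((hE.mul d0).div hD hD0) (c := 1) (by simp [hz0, hz0', hz1])).congr'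
      (hev.mono fun k hk => ?_)).trans_eq ?_
    · simp [h.rotMatrix_mul_rhUpper hk x, ← hδ]
    · simp [hz0, hz0', hz1, hδ]
      linear_combination ((xhat f x : ℂ) - x) * hI
  · refine ((key (hE'.mul d1') (c := 0) (by simp [hz1'])).congr'
      (hev.mono fun k hk => ?_)).trans_eq ?_
    · simp [h.rotMatrix_mul_rhUpper hk x, ← hδ]
    · simp [hz1']
      linear_combination (-(f x : ℂ)) * hI
  · refine ((key ((hE.mul d1).div hD hD0) (c := 0) (by simp [hz1])).congr'
      (hev.mono fun k hk => ?_)).trans_eq ?_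
    · simp [h.rotMatrix_mul_rhUpper hk x, ← hδ]
    · simp [hz0, hz0', hz1]
      linear_combination (-(f x : ℂ)) * hI
  · refine ((key (hE'.mul d0') (c := 1) (by simp [hz0'])).congr'
      (hev.mono fun k hk => ?_)).trans_eq ?_
    · simp [h.rotMatrix_mul_rhUpper hk x, ← hδ]
    · simp [hz0', hδ]
      linear_combination (-(xhat f x : ℂ) + x) * hI

/-- The expansion of the rotated solution at `k = 0`: the first coefficient recovers the
profile. -/
theorem tendsto_rotMatrix_mul_rhSolution (x : ℝ) :
    Tendsto (fun k : ℂ => (Complex.I / k) • (rotMatrix f x * rhSolution f x k - 1))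
      (𝓝[{k : ℂ | k.im ≠ 0}] 0)
      (𝓝 !![((x - xhat f x : ℝ) : ℂ), (f x : ℂ); (f x : ℂ), -((x - xhat f x : ℝ) : ℂ)]) := by
  rw [nhdsWithin_im_ne_zero]
  have hup := h.tendsto_rotMatrix_mul_rhUpper x
  refine Tendsto.sup ?_ ?_
  · refine hup.congr' ?_
    filter_upwards [self_mem_nhdsWithin] with k hk
    rw [rhSolution_of_pos hk]
  · have hcl := tendsto_conj_lower 0
    rw [Complex.ofReal_zero] at hcl
    refine ((continuous_conjSym.tendsto _).comp (hup.comp hcl).neg).congr' ?_ |>.trans_eq ?_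
    · filter_upwards [self_mem_nhdsWithin] with k hk
      rw [rhSolution_of_neg hk, conjSym_rotMatrix_mul_sub_one, Function.comp_apply,
        Function.comp_apply, map_div₀, Complex.conj_I, ← neg_smul, neg_div]
    · congr 1
      ext i j
      fin_cases i <;> fin_cases j <;> simp [conjSym]

end IsProfile

/-- A family with a first-order expansion at `k = 0` after multiplication by an invertible
matrix converges to the inverse of that matrix. -/
theorem tendsto_inv_of_expansion {R F : Matrix (Fin 2) (Fin 2) ℂ} (hR : IsUnit R.det)
    {M : ℂ → Matrix (Fin 2) (Fin 2) ℂ}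
    (hM : Tendsto (fun k : ℂ => (Complex.I / k) • (R * M k - 1)) (𝓝[{k : ℂ | k.im ≠ 0}] 0) (𝓝 F)) :
    Tendsto M (𝓝[{k : ℂ | k.im ≠ 0}] 0) (𝓝 R⁻¹) := by
  have hk : Tendsto (fun k : ℂ => k / Complex.I) (𝓝[{k : ℂ | k.im ≠ 0}] 0) (𝓝 0) := by
    have : Continuous fun k : ℂ => k / Complex.I := by fun_prop
    simpa using (this.tendsto 0).mono_left (nhdsWithin_le_nhds (s := {k : ℂ | k.im ≠ 0}))
  have h1 := (hk.smul hM).add_const 1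
  rw [zero_smul, zero_add] at h1
  have h2 := h1.const_mul R⁻¹
  rw [mul_one] at h2
  refine h2.congr' ?_
  filter_upwards [self_mem_nhdsWithin] with k (hk : k.im ≠ 0)
  have hk0 : k ≠ 0 := by
    rintro rfl
    simp at hk
  rw [smul_smul, show k / Complex.I * (Complex.I / k) = 1 by field_simp, one_smul,
    sub_add_cancel, ← mul_assoc, Matrix.nonsing_inv_mul _ hR, one_mul]

namespace IsDecayingSolution

variable {T : EReal} {u₀ : ℝ → ℝ} {u : ℝ → ℝ → ℝ} (hu : IsDecayingSolution T u₀ u) {t : ℝ}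
  (ht : t ∈ timeDomain T)
include hu ht

theorem zeros_eq : zeros (fun y => u y t) = zeros u₀ := by
  ext k
  exact and_congr_right fun hk => by rw [hu.a_conserved ht (le_of_lt hk)]

/-- The Jost columns of `u(·, t)` solve the Riemann--Hilbert problem with the evolved data. -/
theorem isRHSolution_rhSolution (hgen : Generic u₀) (x : ℝ) :
    IsRHSolution (reflection u₀) (zeros u₀) (gamma u₀) (xhat (fun y => u y t) x) t
      (rhSolution (fun y => u y t) x) := by
  have hp := hu.isProfile ht
  have hZ := hu.zeros_eq ht
  have hreal : ∀ s : ℝ, a (fun y => u y t) s ≠ 0 := fun s => by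
    rw [hu.a_conserved ht (ofReal_im_nonneg s)]
    exact hgen.no_real s
  have hder : ∀ z ∈ zeros u₀, deriv (a fun y => u y t) z = deriv (a u₀) z := fun z hz => by
    refine Filter.EventuallyEq.deriv_eq ?_
    filter_upwards [isOpen_upperHalf.mem_nhds hz.1] with k hk
    exact hu.a_conserved ht (le_of_lt hk)
  have hres : ∀ z ∈ zeros u₀, ∀ i,
      Tendsto (fun k => (k - z) * rhSolution (fun y => u y t) x k i 0) (𝓝[≠] z)
        (𝓝 (Complex.I * gamma u₀ z *
          Complex.exp (2 * Complex.I * (z * xhat (fun y => u y t) x - t / (4 * z))) *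
            rhSolution (fun y => u y t) x z i 1)) := by
    intro z hz i
    have hz0 : z ≠ 0 := by
      rintro rfl
      exact lt_irrefl _ hz.1
    have hs := hgen.simple z hz
    refine hp.tendsto_residue_first (by rw [hZ]; exact hz) (by rw [hder z hz]; exact hs)
      (fun i => ?_) i
    have he : 2 * (t / (4 * Complex.I * z)) + 2 * Complex.I * z * xhat (fun y => u y t) x =
        2 * Complex.I * (z * xhat (fun y => u y t) x - t / (4 * z)) := by
      have : t / (4 * Complex.I * z) = -(Complex.I * (t / (4 * z))) := by
        field_simp
        rw [Complex.I_sq]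
        ring
      rw [this]
      ring
    rw [hu.jostMinus_eq_chi_mul ht hz.1.le hz0 hz.2 x i, he, hder z hz, gamma]
    have hI := Complex.I_ne_zero
    field_simp
  refine ⟨fun i k hk => ?_, fun i k hk => ?_, hres, fun z hz i => ?_, ?_,
    hp.tendsto_rhSolution_cocompact x⟩
  · exact (hp.differentiableAt_rhSolution_zero x i hk.1
      (by rw [hZ]; exact hk.2)).differentiableWithinAt
  · exact (hp.differentiableAt_rhSolution_one x i hk.1
      (by rw [hZ]; exact hk.2)).differentiableWithinAt
  · refine (IsProfile.tendsto_residue_second (by rw [hZ]; exact hz) (hres z hz) i).trans_eq ?_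
    simp only [map_mul, ← Complex.exp_conj, map_sub, map_div₀, Complex.conj_I,
      Complex.conj_ofReal, map_ofNat]
    congr 2
    ring_nf
  · refine ⟨fun s => rhUpper (fun y => u y t) x s, fun s => conjSym (rhUpper (fun y => u y t) x s),
      hp.tendsto_rhSolution_upper hreal x, hp.tendsto_rhSolution_lower hreal x, fun s hs => ?_⟩
    refine hp.rhUpper_eq_mul_jump (hreal s) ?_
    rw [reflection, hu.b_evolution ht hs, hp.b_eq s x, hu.a_conserved ht (ofReal_im_nonneg s),
      div_mul_eq_mul_div]
    congr 1
    have hE : conj (Complex.exp (2 * (t / (4 * Complex.I * s)))) *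
        conj (Complex.exp (2 * Complex.I * s * xhat (fun y => u y t) x)) *
        Complex.exp (2 * (Complex.I * s * xhat (fun y => u y t) x + t / (4 * Complex.I * s))) = 1 := by
      rw [← Complex.exp_conj, ← Complex.exp_conj, ← Complex.exp_add, ← Complex.exp_add,
        ← Complex.exp_zero]
      congr 1
      simp only [map_mul, map_div₀, Complex.conj_I, Complex.conj_ofReal, map_ofNat]
      ring
    rw [map_mul, map_mul]
    linear_combination (conj (jostPlus (fun y => u y t) 1 s x 0 *
      conj (jostMinus (fun y => u y t) 0 s x 0) + jostPlus (fun y => u y t) 1 s x 1 *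
      conj (jostMinus (fun y => u y t) 0 s x 1))) * hE

/-- Uniqueness identifies the given solution of the Riemann--Hilbert problem near `k = 0`. -/
theorem eventuallyEq_rhSolution (hgen : Generic u₀) {M : ℂ → Matrix (Fin 2) (Fin 2) ℂ} {x : ℝ}
    (hM : IsRHSolution (reflection u₀) (zeros u₀) (gamma u₀) (xhat (fun y => u y t) x) t M) :
    ∀ᶠ k in 𝓝[{k : ℂ | k.im ≠ 0}] 0, rhSolution (fun y => u y t) x k = M k := by
  have hZ := hu.zeros_eq ht
  have hun := IsRHSolution.unique hgen.finite (fun z hz => hz.1) hM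
    (hu.isRHSolution_rhSolution ht hgen x) (fun k hk h1 h2 =>
      (hu.isProfile ht).det_rhSolution x hk (by rw [hZ]; exact h1) (by rw [hZ]; exact h2))
  have h0 : ∀ᶠ k : ℂ in 𝓝 0, k ∉ zeros u₀ :=
    hgen.finite.isClosed.isOpen_compl.mem_nhds fun h => lt_irrefl _ h.1
  have h0' : ∀ᶠ k : ℂ in 𝓝 0, conj k ∉ zeros u₀ := by
    have := Complex.continuous_conj.tendsto (0 : ℂ)
    rw [map_zero] at this
    exact this.eventually h0
  filter_upwards [self_mem_nhdsWithin, nhdsWithin_le_nhds h0, nhdsWithin_le_nhds h0']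
    with k hk h1 h2
  exact (hun k hk h1 h2).symm

end IsDecayingSolution

end ShortPulse

theorem theorem3p1 (T : EReal) (hT : 0 < T) (u₀ : ℝ → ℝ) (u : ℝ → ℝ → ℝ)
    (hu : ShortPulse.IsDecayingSolution T u₀ u)
    (hgen : ShortPulse.Generic u₀)
    (M : ℝ → ℝ → ℂ → Matrix (Fin 2) (Fin 2) ℂ)
    (hM : ∀ xh : ℝ, ∀ t ∈ ShortPulse.timeDomain T,
      ShortPulse.IsRHSolution (ShortPulse.reflection u₀) (ShortPulse.zeros u₀)
        (ShortPulse.gamma u₀) xh t (M xh t)) :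
    ∃ (M0 : ℝ → ℝ → Matrix (Fin 2) (Fin 2) ℂ) (f₁ f₂ : ℝ → ℝ → ℝ),
      ∀ t ∈ ShortPulse.timeDomain T,
        (∀ xh : ℝ,
          Tendsto (M xh t) (𝓝[{k : ℂ | k.im ≠ 0}] 0) (𝓝 (M0 xh t)) ∧
          IsUnit (M0 xh t).det ∧
          Tendsto (fun k : ℂ => (Complex.I / k) • ((M0 xh t)⁻¹ * M xh t k - 1))
            (𝓝[{k : ℂ | k.im ≠ 0}] 0)
            (𝓝 !![(f₁ xh t : ℂ), (f₂ xh t : ℂ); (f₂ xh t : ℂ), -(f₁ xh t : ℂ)]) ∧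
          ShortPulse.xhat (fun y => u y t) (xh + f₁ xh t) = xh) ∧
        ∀ x : ℝ,
          ShortPulse.xhat (fun y => u y t) x +
            f₁ (ShortPulse.xhat (fun y => u y t) x) t = x ∧
          u x t = f₂ (ShortPulse.xhat (fun y => u y t) x) t := by
  have hsurj : ∀ t ∈ ShortPulse.timeDomain T, ∀ xh : ℝ,
      ∃ x, ShortPulse.xhat (fun y => u y t) x = xh := fun t ht xh =>
    (hu.isProfile ht).surjective_xhat xh
  choose! X hX using hsurj
  -- With `x = X t xh`, the limit at `k = 0` is the inverse of the rotation at `x`, and the first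
  -- coefficients are `x - xh` and `u x t`.
  refine ⟨fun xh t => (ShortPulse.rotMatrix (fun y => u y t) (X t xh))⁻¹,
    fun xh t => X t xh - xh, fun xh t => u (X t xh) t, fun t ht => ⟨fun xh => ?_, fun x => ?_⟩⟩
  · have hdet := ShortPulse.isUnit_det_rotMatrix (fun y => u y t) (X t xh)
    have hM' := hM xh t ht
    rw [← hX t ht xh] at hM'
    have hev := hu.eventuallyEq_rhSolution ht hgen hM'
    rw [hX t ht xh] at hev
    have hlim := (hu.isProfile ht).tendsto_rotMatrix_mul_rhSolution (X t xh)
    rw [hX t ht xh] at hlim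
    have hlim' := hlim.congr' (hev.mono fun k hk => by rw [hk])
    refine ⟨ShortPulse.tendsto_inv_of_expansion hdet hlim', ?_, ?_, ?_⟩
    · exact Matrix.isUnit_nonsing_inv_det _ hdet
    · simpa only [Matrix.nonsing_inv_nonsing_inv _ hdet] using hlim'
    · rw [add_sub_cancel, hX t ht xh]
  · have hx : X t (ShortPulse.xhat (fun y => u y t) x) = x :=
      (hu.isProfile ht).strictMono_xhat.injective (hX t ht _)
    exact ⟨by simp only [hx, add_sub_cancel], by simp only [hx]⟩
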